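/- Let $\Omega\subset\mathbb{R}^3$ be a bounded open set with Lipschitz boundary, let $I\subset\mathbb{R}$ be an open set of times (for example $I=(0,T)$), and let $A,K_u,\mu_0,\tau\in\mathbb{R}$, $M_s>0$, $\gamma>0$, $\alpha\ge 0$ be constants. Let $\mathbf{H}_e(\mathbf{x},t)\in\mathbb{R}^3$ be an external field such that $\mathbf{H}_e$ and $\mathbf{H}_e'=\partial_t\mathbf{H}_e$ exist and are continuous on $\overline\Omega\times I$. For $\mathbf{m}:\Omega\to\mathbb{R}^3$ put $$U[\mathbf{m}](\mathbf{x})=\int_\Omega\nabla N(\mathbf{x}-\mathbf{y})\cdot\mathbf{m}(\mathbf{y})\,d\mathbf{y},\qquad N(\mathbf{z})=-\frac1{4\pi|\mathbf{z}|},\qquad \mathbf{H}_s[\mathbf{m}]=-\nabla U[\mathbf{m}],$$ and, at each time $t$, let the Landau–Lifshitz energy and the effective field be $$\mathcal{F}[\mathbf{M}]=\frac12\int_\Omega\Big[\frac{A}{M_s^2}|\nabla\mathbf{M}|^2+\frac{K_u}{M_s^2}(M_2^2+M_3^2)-2\mu_0\mathbf{H}_e\cdot\mathbf{M}\Big]d\mathbf{x}+\frac{\mu_0}{2}\int_{\mathbb{R}^3}|\nabla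 U[\mathbf{M}]|^2\,d\mathbf{x},$$ $$\mathbf{H}_{\mathrm{eff}}=\frac{A}{M_s^2}\Delta\mathbf{M}-\frac{K_u}{M_s^2}(M_2\mathbf{e}_2+M_3\mathbf{e}_3)+\mu_0\mathbf{H}_e+\mu_0\mathbf{H}_s[\mathbf{M}].$$ Let $\mathbf{M}:\overline\Omega\times I\to\mathbb{R}^3$ be a classical solution of the inertial Landau–Lifshitz–Gilbert equation, i.e. $\mathbf{M}$ is $C^2$ on $\overline\Omega\times I$ (up to the boundary of $\Omega$), $|\mathbf{M}|=M_s$, for all $\mathbf{x}\in\Omega$, $t\in I$ $$\partial_t\mathbf{M}=-\gamma\,\mathbf{M}\times\Big(\mathbf{H}_{\mathrm{eff}}-\frac{\alpha}{\gamma M_s}\big(\partial_t\mathbf{M}+\tau\,\partial_{tt}\mathbf{M}\big)\Big),$$ and $\partial\mathbf{M}/\partial\boldsymbol\nu=0$ at every point of $\partial\Omega$ at which $\Omega$ has an outward normal $\boldsymbol\nu$. Define the total energy $$\mathcal{J}[\mathbf{M}]=\mathcal{F}[\mathbf{M}]+\frac{\alpha\tau}{2\gamma M_s}\int_\Omega|\partial_t\mathbf{M}|^2\,d\mathbf{x}.$$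 Then for every $t\in I$ all these integrals converge, $U[\mathbf{M}]$ is differentiable off $\partial\Omega$, and $\mathcal{J}$ is differentiable in $t$ with $$\frac{d\mathcal{J}[\mathbf{M}]}{dt}=-\frac{\alpha}{\gamma M_s}\int_\Omega|\partial_t\mathbf{M}|^2\,d\mathbf{x}-\mu_0\int_\Omega\mathbf{M}\cdot\mathbf{H}_e'(t)\,d\mathbf{x}.$$ If the external field is zero or constant (does not depend on time in $I$), then for every $t\in I$ $$\frac{d\mathcal{J}[\mathbf{M}]}{dt}=-\frac{\alpha}{\gamma M_s}\int_\Omega|\partial_t\mathbf{M}|^2\,d\mathbf{x}\le 0.$$ -/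

import Mathlib

open MeasureTheory Set Topology
open scoped RealInnerProductSpace NNReal ContDiff Matrix

noncomputable section

namespace ILLG

/-- Three-dimensional Euclidean space. -/
abbrev E3 : Type := EuclideanSpace ℝ (Fin 3)

/-- The cross product on Euclidean three-space. -/
def cross (a b : E3) : E3 := WithLp.toLp 2 (a.ofLp ⨯₃ b.ofLp)

/-- The standard basis vectors of Euclidean three-space (indexed by 0, 1, 2). -/
def basisVec (i : Fin 3) : E3 := EuclideanSpace.single i 1

/-- The physical constants of the model. -/
structure Params where
  /-- exchange constant -/
  A : ℝ
  /-- saturation magnetization -/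
  Ms : ℝ
  /-- anisotropy constant -/
  Ku : ℝ
  /-- permeability of vacuum -/
  μ₀ : ℝ
  /-- gyromagnetic ratio -/
  γ : ℝ
  /-- Gilbert damping parameter -/
  α : ℝ
  /-- characteristic time of the inertial dynamics -/
  τ : ℝ

/-! ### Domains -/

/-- The set `Ω` has Lipschitz boundary: near every boundary point, after a choice of a unit
direction `e`, it is the set of points below the graph of a Lipschitz function `g` of the
coordinates orthogonal to `e` (a function on the whole space that is constant along `e`). -/
def HasLipschitzBoundary (Ω : Set E3) : Prop :=
  ∀ p ∈ frontier Ω, ∃ (e : E3) (g : E3 → ℝ) (K : ℝ≥0),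
    ‖e‖ = 1 ∧ LipschitzWith K g ∧ (∀ (x : E3) (s : ℝ), g (x + s • e) = g x) ∧
      ∀ᶠ x in 𝓝 p, (x ∈ Ω ↔ ⟪e, x⟫ < g x)

/-- `ν` is the outward unit normal of `Ω` at `p`: to first order at `p`, the set `Ω` is the
half-space of the points `x` with `⟪x - p, ν⟫ < 0`. On a Lipschitz boundary such a vector exists
exactly at the points at which the boundary has a tangent plane, that is, at almost all of them. -/
def IsOutwardUnitNormal (Ω : Set E3) (p ν : E3) : Prop :=
  ‖ν‖ = 1 ∧ ∀ ε > 0, ∀ᶠ x in 𝓝 p,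
    (⟪x - p, ν⟫ < -(ε * ‖x - p‖) → x ∈ Ω) ∧ (ε * ‖x - p‖ < ⟪x - p, ν⟫ → x ∉ Ω)

/-! ### Stray field -/

/-- The Newtonian potential `N z = -1 / (4 π |z|)`. -/
def newton (z : E3) : ℝ := -(1 / (4 * Real.pi)) * (1 / ‖z‖)

/-- The magnetostatic potential `U x = ∫_Ω ∇N(x - y) · m(y) dy` of a magnetization `m` of `Ω`. -/
def potential (Ω : Set E3) (m : E3 → E3) (x : E3) : ℝ :=
  ∫ y in Ω, ⟪gradient newton (x - y), m y⟫

/-- The stray field `H_s = -∇U`. -/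
def strayField (Ω : Set E3) (m : E3 → E3) (x : E3) : E3 :=
  -gradient (potential Ω m) x

/-! ### Landau-Lifshitz energy and effective field -/

/-- The squared (Frobenius) norm `|∇m|² = ∑ᵢ |∂ᵢ m|²` of the gradient of a vector field. -/
def gradNormSq (m : E3 → E3) (x : E3) : ℝ :=
  ∑ i : Fin 3, ‖fderiv ℝ m x (basisVec i)‖ ^ 2

/-- The uniaxial anisotropy density `Φ(m / Ms) = Ku (m₂² + m₃²) / Ms²`. -/
def anisotropy (P : Params) (v : E3) : ℝ :=
  P.Ku * (v 1 ^ 2 + v 2 ^ 2) / P.Ms ^ 2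

/-- The integrand over `Ω` in the Landau-Lifshitz energy (exchange, anisotropy, Zeeman). -/
def energyDensity (P : Params) (h m : E3 → E3) (x : E3) : ℝ :=
  P.A / P.Ms ^ 2 * gradNormSq m x + anisotropy P (m x) - 2 * P.μ₀ * ⟪h x, m x⟫

/-- The Landau-Lifshitz energy of the magnetization `m` of `Ω` in the external field `h`. -/
def llEnergy (P : Params) (Ω : Set E3) (h m : E3 → E3) : ℝ :=
  1 / 2 * (∫ x in Ω, energyDensity P h m x)
    + P.μ₀ / 2 * (∫ x : E3, ‖gradient (potential Ω m) x‖ ^ 2)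

/-- The effective field of the magnetization `m` of `Ω` in the external field `h`. -/
def effectiveField (P : Params) (Ω : Set E3) (h m : E3 → E3) (x : E3) : E3 :=
  (P.A / P.Ms ^ 2) • Laplacian.laplacian m x
    - (P.Ku / P.Ms ^ 2) • (m x 1 • basisVec 1 + m x 2 • basisVec 2)
    + P.μ₀ • h x + P.μ₀ • strayField Ω m x

/-! ### Time-dependent fields and the inertial equation -/

/-- The time derivative of a time-dependent vector field. -/
def timeDeriv (f : ℝ → E3 → E3) (t : ℝ) (x : E3) : E3 :=
  deriv (fun s => f s x) t

/-- An admissible external field: it and its time derivative exist and are continuous on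
`I × closure Ω`. -/
structure IsExternalField (Ω : Set E3) (I : Set ℝ) (He : ℝ → E3 → E3) : Prop where
  continuousOn : ContinuousOn (fun q : ℝ × E3 => He q.1 q.2) (I ×ˢ closure Ω)
  differentiableAt : ∀ t ∈ I, ∀ x ∈ closure Ω, DifferentiableAt ℝ (fun s => He s x) t
  continuousOn_timeDeriv :
    ContinuousOn (fun q : ℝ × E3 => timeDeriv He q.1 q.2) (I ×ˢ closure Ω)

/-- `M` is a classical solution of the inertial Landau-Lifshitz-Gilbert equation on `I × Ω`,
twice continuously differentiable up to the boundary of `Ω`, of constant modulus `Ms`, and with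
homogeneous Neumann boundary condition. -/
structure IsClassicalSolution (P : Params) (Ω : Set E3) (I : Set ℝ) (He M : ℝ → E3 → E3) :
    Prop where
  contDiffOn : ContDiffOn ℝ 2 (fun q : ℝ × E3 => M q.1 q.2) (I ×ˢ closure Ω)
  norm_eq : ∀ t ∈ I, ∀ x ∈ Ω, ‖M t x‖ = P.Ms
  equation : ∀ t ∈ I, ∀ x ∈ Ω,
    timeDeriv M t x =
      -(P.γ • cross (M t x) (effectiveField P Ω (He t) (M t) x
        - (P.α / (P.γ * P.Ms)) • (timeDeriv M t x + P.τ • timeDeriv (timeDeriv M) t x)))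
  neumann : ∀ t ∈ I, ∀ p ∈ frontier Ω, ∀ ν : E3, IsOutwardUnitNormal Ω p ν →
    fderivWithin ℝ (M t) (closure Ω) p ν = 0

/-- The total energy `J = F + (α τ / (2 γ Ms)) ∫_Ω |∂ₜM|²` at time `t`. -/
def totalEnergy (P : Params) (Ω : Set E3) (He M : ℝ → E3 → E3) (t : ℝ) : ℝ :=
  llEnergy P Ω (He t) (M t)
    + P.α * P.τ / (2 * P.γ * P.Ms) * (∫ x in Ω, ‖timeDeriv M t x‖ ^ 2)

end ILLG

end

noncomputable section

namespace ILLG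

open Filter

/-! ### The Newtonian kernel -/

/-! The equation makes `∂ₜM` a cross product with second factor `X = H_eff - α/(γ Ms) (∂ₜM + τ
∂ₜₜM)`, so `X` is orthogonal to `∂ₜM` at every point of `Ω` (`power_eq_zero`). Integrated over `Ω`,
this is the energy law, once the time derivative of the energy is known to be minus the integral of
`H_eff · ∂ₜM`, minus `μ₀` times the integral of `M · ∂ₜHe`, plus the derivative of the inertial
term. Anisotropy, Zeeman and inertial terms are differentiated under the integral sign. Exchange and
stray field need more.

Exchange: `∑ᵢ ∂ᵢM · ∂ₜ∂ᵢM` equals the divergence of the flux `∑ᵢ (∂ᵢM · ∂ₜM) eᵢ` minus `ΔM · ∂ₜM`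
(`divergence_exchangeFlux`), and the Neumann condition annihilates the normal flux. The divergence
theorem is needed only for fields with zero normal component, and no surface measure enters
(`integral_divergence_eq_zero`). Localized by a partition of unity, the field is tested against a
cutoff that vanishes near the Lipschitz graph. The gradient of the cutoff yields an average over a
strip of width `ε`, which tends to the trace of the normal component, hence to zero. By Rademacher's
theorem the normal exists along almost every vertical line, which is enough.

Stray field: everything follows from the identity `∫ ∇U[m] · ∇U[n] = ∫_Ω ∇U[m] · n`. For compactly
supported `C²` fields it holds by integrating by parts twice, because `U[n] = N * div n` and `N` is
the fundamental solution of the Laplacian (`integral_inner_gradient_potential_univ`). With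
Cauchy-Schwarz it makes `m ↦ ∇U[m]` a contraction of `L²`. The magnetization `M(t)` does not vanish
on the boundary, so it is multiplied by cutoffs exhausting `Ω`: off the boundary, which is a null
set, the gradients converge pointwise, and Fatou's lemma and the contraction carry the identity to
the limit (`IsRegularField.inner_gradient_potential`). The field energy is then a symmetric
quadratic form, continuous on `L²`, and `t ↦ M(t)` is differentiable into `L²`, which gives its
derivative (`hasDerivAt_field_energy`). -/

lemma hasGradientAt_newton {z : E3} (hz : z ≠ 0) :
    HasGradientAt newton ((4 * Real.pi)⁻¹ • (‖z‖ ^ 3)⁻¹ • z) z := by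
  have hn : ‖z‖ ≠ 0 := norm_ne_zero_iff.2 hz
  have h1 : HasFDerivAt (fun y : E3 => ‖y‖ ^ 2) (2 • innerSL ℝ z) z :=
    (hasStrictFDerivAt_norm_sq z).hasFDerivAt
  have h2 : HasFDerivAt (fun y : E3 => √(‖y‖ ^ 2)) ((1 / (2 * √(‖z‖ ^ 2))) • (2 • innerSL ℝ z)) z :=
    h1.sqrt (by positivity)
  have h3 : HasFDerivAt (fun y : E3 => ‖y‖) ((1 / (2 * √(‖z‖ ^ 2))) • (2 • innerSL ℝ z)) z := by
    convert! h2 using 2 with y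
    rw [Real.sqrt_sq (norm_nonneg _)]
  have h4 := ((hasDerivAt_inv hn).comp_hasFDerivAt z h3).const_mul (-(1 / (4 * Real.pi)))
  rw [hasGradientAt_iff_hasFDerivAt]
  have h5 : newton = fun y : E3 => -(1 / (4 * Real.pi)) * (Inv.inv ∘ fun y : E3 => ‖y‖) y := by
    funext y; simp [newton]
  rw [h5]
  convert! h4 using 1
  ext v
  simp [Real.sqrt_sq (norm_nonneg z), InnerProductSpace.toDual_apply_apply]
  field_simp

/-- At the origin both sides are default values: `newton` tends to `-∞` there, so it is not
differentiable and its gradient is zero by convention. A formula valid everywhere gives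
measurability at once. -/
lemma gradient_newton (z : E3) :
    gradient newton z = (4 * Real.pi)⁻¹ • (‖z‖ ^ 3)⁻¹ • z := by
  by_cases hz : z = 0
  · subst hz
    simp only [smul_zero]
    apply gradient_eq_zero_of_not_differentiableAt
    intro h
    have hc : Tendsto newton (𝓝[≠] 0) (𝓝 (newton 0)) :=
      h.continuousAt.tendsto.mono_left nhdsWithin_le_nhds
    have h1 : Tendsto (fun z : E3 => ‖z‖) (𝓝[≠] 0) (𝓝[>] 0) := tendsto_norm_nhdsNE_zero
    have h2 : Tendsto (fun z : E3 => ‖z‖⁻¹) (𝓝[≠] 0) atTop := tendsto_inv_nhdsGT_zero.comp h1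
    have h3 : Tendsto newton (𝓝[≠] 0) atBot := by
      have := h2.const_mul_atTop_of_neg (r := -(1 / (4 * Real.pi)))
        (neg_lt_zero.2 (by positivity))
      refine this.congr fun z => ?_
      simp [newton]
    exact not_tendsto_atBot_of_tendsto_nhds hc h3
  · exact (hasGradientAt_newton hz).gradient

lemma norm_gradient_newton_le (z : E3) : ‖gradient newton z‖ ≤ ‖z‖ ^ (-2 : ℝ) := by
  rw [gradient_newton, norm_smul, norm_smul, norm_inv, norm_inv, norm_pow, norm_norm]
  have hpi : ‖4 * Real.pi‖⁻¹ ≤ 1 := by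
    rw [Real.norm_of_nonneg (by positivity)]
    exact inv_le_one_of_one_le₀ (by nlinarith [Real.pi_gt_three])
  by_cases hz : z = 0
  · subst hz; simp
  have hn : 0 < ‖z‖ := norm_pos_iff.2 hz
  have : (‖z‖ ^ 3)⁻¹ * ‖z‖ = ‖z‖ ^ (-2 : ℝ) := by
    rw [Real.rpow_neg hn.le]
    norm_cast
    field_simp
  rw [this]
  have h0 : 0 ≤ ‖z‖ ^ (-2 : ℝ) := by positivity
  nlinarith

lemma measurable_gradient_newton : Measurable (gradient newton) := by
  have : gradient newton = fun z : E3 => (4 * Real.pi)⁻¹ • (‖z‖ ^ 3)⁻¹ • z :=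
    funext gradient_newton
  rw [this]
  fun_prop

lemma measurable_newton : Measurable newton := by
  unfold newton
  fun_prop

lemma finrank_E3 : Module.finrank ℝ E3 = 3 := by simp

lemma locallyIntegrable_gradient_newton : LocallyIntegrable (gradient newton) := by
  -- The singularity of order 2 is integrable because 2 is less than the dimension 3.
  refine locallyIntegrable_of_norm_le_rpow (C := 1) (α := 2) (by rw [finrank_E3]; norm_num)
    (by rw [finrank_E3]; norm_num) (ae_of_all _ fun z => ?_)
    measurable_gradient_newton.aestronglyMeasurable
  simpa using norm_gradient_newton_le z

lemma abs_newton_le (z : E3) : |newton z| ≤ ‖z‖⁻¹ := by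
  rw [newton, abs_mul, abs_neg, one_div, one_div, abs_inv, abs_inv, abs_norm]
  have hpi : |4 * Real.pi|⁻¹ ≤ 1 := by
    rw [abs_of_nonneg (by positivity)]
    exact inv_le_one_of_one_le₀ (by nlinarith [Real.pi_gt_three])
  have h0 : 0 ≤ ‖z‖⁻¹ := by positivity
  nlinarith

lemma locallyIntegrable_newton : LocallyIntegrable newton := by
  refine locallyIntegrable_of_norm_le_rpow (C := 1) (α := 1) (by rw [finrank_E3]; norm_num)
    (by rw [finrank_E3]; norm_num) (ae_of_all _ fun z => ?_)
    measurable_newton.aestronglyMeasurable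
  rw [Real.rpow_neg_one, one_mul]
  exact abs_newton_le z

/-- Integration in polar coordinates. -/
lemma integral_polar {f : E3 → ℝ} (hf : Integrable f) :
    ∫ x, f x = ∫ u : Metric.sphere (0 : E3) 1, (∫ r in Ioi (0 : ℝ), r ^ 2 * f (r • (u : E3)))
      ∂(volume : Measure E3).toSphere := by
  have hm := (volume : Measure E3).measurePreserving_homeomorphUnitSphereProd
  have hemb := (homeomorphUnitSphereProd E3).measurableEmbedding
  -- The origin is a null set, and the punctured space is the product of the unit sphere and the
  -- positive half-line.
  have h1 : ∫ x, f x = ∫ x : ({(0)}ᶜ : Set E3), f x ∂((volume : Measure E3).comap (↑)) := by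
    rw [integral_subtype_comap (measurableSet_singleton _).compl f, restrict_compl_singleton]
  set F : Metric.sphere (0 : E3) 1 × Ioi (0 : ℝ) → ℝ := fun p => f (p.2.1 • (p.1 : E3)) with hF
  have hF' : ∀ x : ({(0)}ᶜ : Set E3), F (homeomorphUnitSphereProd E3 x) = f x := by
    intro x
    simp only [hF, homeomorphUnitSphereProd_apply_snd_coe, homeomorphUnitSphereProd_apply_fst_coe]
    rw [smul_smul, mul_inv_cancel₀ (norm_ne_zero_iff.2 x.2), one_smul]
  have h2 := hm.integral_comp hemb F
  simp only [hF'] at h2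
  have hint : Integrable F ((volume : Measure E3).toSphere.prod
      (.volumeIoiPow (Module.finrank ℝ E3 - 1))) := by
    rw [← hm.integrable_comp_emb hemb]
    have : F ∘ homeomorphUnitSphereProd E3 = fun x : ({(0)}ᶜ : Set E3) => f x := funext hF'
    rw [this]
    have h3 : IntegrableOn f ({0}ᶜ) := hf.integrableOn
    rw [integrableOn_iff_comap_subtypeVal (by measurability)] at h3
    exact h3
  rw [h1, h2, integral_prod _ hint]
  refine integral_congr_ae (ae_of_all _ fun u => ?_)
  simp only [Measure.volumeIoiPow, ENNReal.ofReal, hF]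
  rw [integral_withDensity_eq_integral_smul,
    integral_subtype_comap measurableSet_Ioi
      fun a : ℝ ↦ Real.toNNReal (a ^ (Module.finrank ℝ E3 - 1)) • f (a • (u : E3)),
    setIntegral_congr_fun measurableSet_Ioi fun x hx ↦ ?_]
  · simp only [finrank_E3]
    rw [NNReal.smul_def, Real.coe_toNNReal _ (pow_nonneg hx.out.le _), smul_eq_mul]
  · exact (measurable_subtype_coe.pow_const _).real_toNNReal

/-- The Newtonian potential is a fundamental solution of the Laplace equation. -/
lemma integral_fderiv_gradient_newton {g : E3 → ℝ} (hg : ContDiff ℝ 1 g)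
    (hc : HasCompactSupport g) : ∫ z, fderiv ℝ g z (gradient newton z) = -g 0 := by
  have hint : Integrable fun z => fderiv ℝ g z (gradient newton z) := by
    have h1 : Integrable (fun z => ‖fderiv ℝ g z‖ • gradient newton z) :=
      locallyIntegrable_gradient_newton.integrable_smul_left_of_hasCompactSupport
        (hg.continuous_fderiv (by simp)).norm (hc.fderiv ℝ).norm
    refine h1.mono ?_ (ae_of_all _ fun z => ?_)
    · exact ((continuous_fst.clm_apply continuous_snd).measurable.comp
        ((hg.continuous_fderiv (by simp)).measurable.prodMk
          measurable_gradient_newton)).aestronglyMeasurable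
    · rw [norm_smul, norm_norm]; exact (fderiv ℝ g z).le_opNorm _
  rw [integral_polar hint]
  -- On each ray the Jacobian `r ^ 2` cancels the decay of `∇N`, leaving the radial derivative of
  -- `g`, whose integral is `-g 0`.
  have hin : ∀ u : Metric.sphere (0 : E3) 1,
      ∫ r in Ioi (0 : ℝ), r ^ 2 * fderiv ℝ g (r • (u : E3)) (gradient newton (r • (u : E3)))
        = (4 * Real.pi)⁻¹ * -g 0 := by
    intro u
    have hu : ‖(u : E3)‖ = 1 := by simp
    have h1 : ∀ r ∈ Ioi (0 : ℝ), r ^ 2 * fderiv ℝ g (r • (u : E3)) (gradient newton (r • (u : E3)))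
        = (4 * Real.pi)⁻¹ * deriv (fun r : ℝ => g (r • (u : E3))) r := by
      intro r hr
      have hr' : (0 : ℝ) < r := hr
      have h2 : HasDerivAt (fun r : ℝ => g (r • (u : E3))) (fderiv ℝ g (r • (u : E3)) u) r := by
        have h3 : HasDerivAt (fun r : ℝ => r • (u : E3)) ((1 : ℝ) • (u : E3)) r :=
          (hasDerivAt_id r).smul_const _
        rw [one_smul] at h3
        exact ((hg.differentiable (by simp)) (r • (u : E3))).hasFDerivAt.comp_hasDerivAt r h3
      rw [h2.deriv, gradient_newton, norm_smul, hu, Real.norm_of_nonneg hr'.le, map_smul, map_smul,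
        map_smul]
      simp only [smul_eq_mul]
      field_simp
    rw [setIntegral_congr_fun measurableSet_Ioi h1, integral_const_mul]
    congr 1
    have hcd : ContDiff ℝ 1 (fun r : ℝ => g (r • (u : E3))) := by fun_prop
    have hcs : HasCompactSupport (fun r : ℝ => g (r • (u : E3))) := by
      apply hc.comp_isClosedEmbedding
      apply Isometry.isClosedEmbedding
      refine AddMonoidHomClass.isometry_of_norm (LinearMap.toSpanSingleton ℝ E3 (u : E3)) fun x => ?_
      simp [norm_smul]
    have := hcs.integral_Ioi_deriv_eq hcd 0
    simpa using this
  simp only [hin, integral_const, smul_eq_mul]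
  -- The area of the sphere is three times the volume of the unit ball, that is `4π`, which cancels
  -- the normalization of `N`.
  rw [Measure.toSphere_real_apply_univ, finrank_E3, Measure.real,
    InnerProductSpace.volume_ball_of_dim_odd (k := 1) (by simp)]
  simp [Nat.doubleFactorial]
  rw [ENNReal.toReal_ofReal (by positivity)]
  field_simp
  ring

/-- A smooth regularization of the Newtonian potential. -/
def newtonReg (ε : ℝ) (z : E3) : ℝ := -(1 / (4 * Real.pi)) * (√(ε ^ 2 + ‖z‖ ^ 2))⁻¹

lemma hasFDerivAt_newtonReg {ε : ℝ} (hε : 0 < ε) (z : E3) :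
    HasFDerivAt (newtonReg ε)
      (innerSL ℝ ((4 * Real.pi)⁻¹ • (√(ε ^ 2 + ‖z‖ ^ 2) ^ 3)⁻¹ • z)) z := by
  have hp : 0 < ε ^ 2 + ‖z‖ ^ 2 := by positivity
  have h1 : HasFDerivAt (fun y : E3 => ε ^ 2 + ‖y‖ ^ 2) (2 • innerSL ℝ z) z :=
    (hasStrictFDerivAt_norm_sq z).hasFDerivAt.const_add _
  have h2 := h1.sqrt hp.ne'
  have h4 := ((hasDerivAt_inv (Real.sqrt_pos.2 hp).ne').comp_hasFDerivAt z h2).const_mul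
    (-(1 / (4 * Real.pi)))
  refine (h4.congr_fderiv ?_ : HasFDerivAt (newtonReg ε) _ z)
  ext v
  simp
  have := (Real.sqrt_pos.2 hp).ne'
  field_simp

lemma norm_le_sqrt_add (ε : ℝ) (z : E3) : ‖z‖ ≤ √(ε ^ 2 + ‖z‖ ^ 2) :=
  Real.le_sqrt_of_sq_le (by nlinarith [sq_nonneg ε])

/-- Integration by parts against the Newtonian potential. -/
lemma integral_newton_mul_fderiv {g : E3 → ℝ} (hg : ContDiff ℝ 1 g)
    (hc : HasCompactSupport g) (v : E3) :
    ∫ z, newton z * fderiv ℝ g z v = -∫ z, ⟪gradient newton z, v⟫ * g z := by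
  have hgv : Continuous fun z => fderiv ℝ g z v :=
    (hg.continuous_fderiv (by simp)).clm_apply continuous_const
  have hcv : HasCompactSupport fun z => fderiv ℝ g z v := hc.fderiv_apply ℝ v
  have hcont : ∀ ε : ℝ, 0 < ε → Continuous fun z : E3 =>
      (4 * Real.pi)⁻¹ • (√(ε ^ 2 + ‖z‖ ^ 2) ^ 3)⁻¹ • z := by
    intro ε hε
    have : ∀ z : E3, √(ε ^ 2 + ‖z‖ ^ 2) ^ 3 ≠ 0 := fun z => by positivity
    fun_prop (disch := exact this _)
  have hdiff : ∀ ε : ℝ, 0 < ε → Continuous (newtonReg ε) := fun ε hε =>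
    continuous_iff_continuousAt.2 fun z => (hasFDerivAt_newtonReg hε z).continuousAt
  -- The regularized kernel is differentiable at the origin too, so ordinary integration by parts
  -- applies. As `ε → 0`, it and its gradient are dominated by their singular counterparts, which
  -- are locally integrable.
  have key : ∀ ε : ℝ, 0 < ε → ∫ z, newtonReg ε z * fderiv ℝ g z v
      = -∫ z, ⟪(4 * Real.pi)⁻¹ • (√(ε ^ 2 + ‖z‖ ^ 2) ^ 3)⁻¹ • z, v⟫ * g z := by
    intro ε hε
    have h1 : ∀ z, fderiv ℝ (newtonReg ε) z v
        = ⟪(4 * Real.pi)⁻¹ • (√(ε ^ 2 + ‖z‖ ^ 2) ^ 3)⁻¹ • z, v⟫ := fun z => by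
      rw [(hasFDerivAt_newtonReg hε z).fderiv, innerSL_apply_apply]
    simp_rw [← h1]
    apply integral_mul_fderiv_eq_neg_fderiv_mul_of_integrable
    · simp_rw [h1]
      exact (((hcont ε hε).inner continuous_const).mul
        hg.continuous).integrable_of_hasCompactSupport hc.mul_left
    · exact ((hdiff ε hε).mul hgv).integrable_of_hasCompactSupport hcv.mul_left
    · exact ((hdiff ε hε).mul hg.continuous).integrable_of_hasCompactSupport hc.mul_left
    · exact fun z _ => (hasFDerivAt_newtonReg hε z).differentiableAt
    · exact fun z _ => hg.differentiable (by simp) z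
  have hne : ∀ᵐ z : E3, z ≠ 0 := by
    simp [ae_iff]
  have hsq : ∀ z : E3, Tendsto (fun ε : ℝ => √(ε ^ 2 + ‖z‖ ^ 2)) (𝓝[>] 0) (𝓝 ‖z‖) := by
    intro z
    have hc0 : Continuous fun ε : ℝ => √(ε ^ 2 + ‖z‖ ^ 2) := by fun_prop
    have := (hc0.tendsto 0).mono_left (nhdsWithin_le_nhds (s := Ioi 0))
    simpa using this
  have hl : Tendsto (fun ε : ℝ => ∫ z, newtonReg ε z * fderiv ℝ g z v) (𝓝[>] 0)
      (𝓝 (∫ z, newton z * fderiv ℝ g z v)) := by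
    have hi : Integrable fun z : E3 => ‖z‖⁻¹ * ‖fderiv ℝ g z v‖ := by
      have : LocallyIntegrable fun z : E3 => ‖z‖⁻¹ := by
        refine locallyIntegrable_of_norm_le_rpow (C := 1) (α := 1) (by rw [finrank_E3]; norm_num)
          (by rw [finrank_E3]; norm_num) (ae_of_all _ fun z => ?_)
          (by fun_prop)
        rw [Real.rpow_neg_one, one_mul, norm_inv, norm_norm]
      exact this.integrable_smul_right_of_hasCompactSupport hgv.norm hcv.norm
    refine tendsto_integral_filter_of_dominated_convergence _ ?_ ?_ hi ?_
    · filter_upwards [self_mem_nhdsWithin] with ε hε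
      exact ((hdiff ε hε).mul hgv).aestronglyMeasurable
    · filter_upwards [self_mem_nhdsWithin] with ε hε
      filter_upwards [hne] with z hz
      rw [norm_mul]
      gcongr
      rw [newtonReg, norm_mul, norm_neg, norm_inv, Real.norm_of_nonneg (Real.sqrt_nonneg _),
        Real.norm_of_nonneg (by positivity)]
      have h1 : (√(ε ^ 2 + ‖z‖ ^ 2))⁻¹ ≤ ‖z‖⁻¹ :=
        inv_anti₀ (norm_pos_iff.2 hz) (norm_le_sqrt_add ε z)
      have h2 : 1 / (4 * Real.pi) ≤ 1 := by
        rw [div_le_one (by positivity)]; nlinarith [Real.pi_gt_three]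
      have h3 : 0 ≤ (√(ε ^ 2 + ‖z‖ ^ 2))⁻¹ := by positivity
      nlinarith
    · filter_upwards [hne] with z hz
      refine Tendsto.mul_const _ ?_
      simp only [newtonReg, newton, one_div ‖z‖]
      exact ((hsq z).inv₀ (norm_ne_zero_iff.2 hz)).const_mul _
  have hr : Tendsto (fun ε : ℝ => ∫ z, ⟪(4 * Real.pi)⁻¹ • (√(ε ^ 2 + ‖z‖ ^ 2) ^ 3)⁻¹ • z, v⟫ * g z)
      (𝓝[>] 0) (𝓝 (∫ z, ⟪gradient newton z, v⟫ * g z)) := by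
    have hi : Integrable fun z : E3 => ‖gradient newton z‖ * (‖v‖ * ‖g z‖) := by
      have := (locallyIntegrable_gradient_newton.integrable_smul_left_of_hasCompactSupport
        (hg.continuous.norm.const_mul ‖v‖) hc.norm.mul_left).norm
      refine this.congr (ae_of_all _ fun z => ?_)
      simp only [norm_smul, norm_mul, norm_norm]
      ring
    refine tendsto_integral_filter_of_dominated_convergence _ ?_ ?_ hi ?_
    · filter_upwards [self_mem_nhdsWithin] with ε hε
      exact (((hcont ε hε).inner continuous_const).mul hg.continuous).aestronglyMeasurable
    · filter_upwards [self_mem_nhdsWithin] with ε hε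
      filter_upwards [hne] with z hz
      rw [norm_mul, ← mul_assoc]
      gcongr
      refine (norm_inner_le_norm _ _).trans ?_
      gcongr
      rw [gradient_newton, norm_smul, norm_smul, norm_smul, norm_smul]
      gcongr
      rw [Real.norm_of_nonneg (by positivity), Real.norm_of_nonneg (by positivity)]
      have := norm_pos_iff.2 hz
      gcongr
      exact norm_le_sqrt_add ε z
    · filter_upwards [hne] with z hz
      refine Tendsto.mul_const _ ?_
      rw [gradient_newton]
      refine Tendsto.inner ?_ tendsto_const_nhds
      refine Tendsto.const_smul (Tendsto.smul_const ?_ _) _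
      exact ((hsq z).pow 3).inv₀ (by have := norm_ne_zero_iff.2 hz; positivity)
  refine tendsto_nhds_unique hl (hr.neg.congr' ?_)
  filter_upwards [self_mem_nhdsWithin] with ε hε
  exact (key ε hε).symm

/-! ### Convolution with the Newtonian kernel -/

/-- Convolution of scalar functions on Euclidean three-space. -/
def conv (k g : E3 → ℝ) (x : E3) : ℝ := ∫ t, k t * g (x - t)

lemma conv_eq (k g : E3 → ℝ) : conv k g = convolution k g (ContinuousLinearMap.mul ℝ ℝ) := by
  funext x; rfl

/-- The derivative falls on the smooth factor, so the kernel may be singular. -/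
lemma hasFDerivAt_conv {k g : E3 → ℝ} (hk : LocallyIntegrable k) (hg : ContDiff ℝ 1 g)
    (hc : HasCompactSupport g) (x : E3) : DifferentiableAt ℝ (conv k g) x ∧
      ∀ v, fderiv ℝ (conv k g) x v = conv k (fun y => fderiv ℝ g y v) x := by
  have h := hc.hasFDerivAt_convolution_right (ContinuousLinearMap.mul ℝ ℝ) hk hg x
  rw [← conv_eq] at h
  refine ⟨h.differentiableAt, fun v => ?_⟩
  rw [h.fderiv, convolution_precompR_apply _ hk (hc.fderiv ℝ) (hg.continuous_fderiv (by simp))]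
  rfl

lemma continuous_conv {k g : E3 → ℝ} (hk : LocallyIntegrable k) (hg : Continuous g)
    (hc : HasCompactSupport g) : Continuous (conv k g) := by
  rw [conv_eq]
  exact hc.continuous_convolution_right _ hk hg

lemma integrable_conv_integrand {k g : E3 → ℝ} (hk : LocallyIntegrable k) (hg : Continuous g)
    (hc : HasCompactSupport g) (x : E3) : Integrable fun t => k t * g (x - t) :=
  (hc.convolutionExists_right (ContinuousLinearMap.mul ℝ ℝ) hk hg x).integrable

lemma locallyIntegrable_inner_gradient_newton (v : E3) :
    LocallyIntegrable fun z => ⟪gradient newton z, v⟫ := by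
  refine locallyIntegrable_of_norm_le_rpow (C := ‖v‖) (α := 2) (by rw [finrank_E3]; norm_num)
    (by rw [finrank_E3]; norm_num) (ae_of_all _ fun z => ?_)
    (measurable_gradient_newton.inner measurable_const).aestronglyMeasurable
  refine (norm_inner_le_norm _ _).trans ?_
  rw [mul_comm]
  gcongr
  exact norm_gradient_newton_le z

lemma fderiv_comp_const_sub {g : E3 → ℝ} (hg : ContDiff ℝ 1 g) (x t v : E3) :
    fderiv ℝ (fun t => g (x - t)) t v = -fderiv ℝ g (x - t) v := by
  have h1 : HasFDerivAt (fun t => x - t) (-ContinuousLinearMap.id ℝ E3) t :=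
    (hasFDerivAt_id t).const_sub x
  have h2 := ((hg.differentiable (by simp) (x - t)).hasFDerivAt.comp t h1).fderiv
  have h3 : (fun t => g (x - t)) = g ∘ fun t => x - t := rfl
  rw [h3, h2]
  simp

lemma contDiff_comp_const_sub {g : E3 → ℝ} {n : WithTop ℕ∞} (hg : ContDiff ℝ n g) (x : E3) :
    ContDiff ℝ n fun t => g (x - t) := by fun_prop

lemma hasCompactSupport_comp_const_sub {g : E3 → ℝ} (hg : HasCompactSupport g) (x : E3) :
    HasCompactSupport fun t => g (x - t) :=
  hg.comp_homeomorph (Homeomorph.subLeft x)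

/-- Integration by parts against `t ↦ g (x - t)`: its minus sign cancels the one coming from the
reflection. -/
lemma conv_inner_gradient_newton {g : E3 → ℝ} (hg : ContDiff ℝ 1 g) (hc : HasCompactSupport g)
    (v x : E3) : conv (fun z => ⟪gradient newton z, v⟫) g x
      = conv newton (fun y => fderiv ℝ g y v) x := by
  have := integral_newton_mul_fderiv (contDiff_comp_const_sub hg x)
    (hasCompactSupport_comp_const_sub hc x) v
  simp only [fderiv_comp_const_sub hg, mul_neg, integral_neg, neg_inj] at this
  exact this.symm

lemma inner_eq_sum (a b : E3) : ⟪a, b⟫ = ∑ i, ⟪a, basisVec i⟫ * b i := by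
  simp [PiLp.inner_apply, basisVec, mul_comm]

lemma inner_basisVec (a : E3) (i : Fin 3) : ⟪a, basisVec i⟫ = a i := by
  rw [basisVec, EuclideanSpace.inner_single_right]; simp

lemma norm_basisVec (i : Fin 3) : ‖basisVec i‖ = 1 := by simp [basisVec]

lemma eq_sum_basisVec (v : E3) : v = ∑ i, v i • basisVec i := by
  ext j
  simp [basisVec, Finset.sum_apply, Pi.single_apply]

/-- The divergence of a vector field. -/
def divergence (F : E3 → E3) (x : E3) : ℝ := ∑ i, fderiv ℝ F x (basisVec i) i

lemma fderiv_coord {E : Type*} [NormedAddCommGroup E] [NormedSpace ℝ E] {F : E → E3} {x : E}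
    (hF : DifferentiableAt ℝ F x) (i : Fin 3) (v : E) :
    fderiv ℝ (fun y => F y i) x v = fderiv ℝ F x v i := by
  have := ((EuclideanSpace.proj (𝕜 := ℝ) i).hasFDerivAt.comp x hF.hasFDerivAt).fderiv
  have h2 : (fun y => F y i) = (EuclideanSpace.proj (𝕜 := ℝ) i) ∘ F := rfl
  rw [h2, this]; rfl

lemma contDiff_coord {F : E3 → E3} {n : WithTop ℕ∞} (hF : ContDiff ℝ n F) (i : Fin 3) :
    ContDiff ℝ n fun y => F y i :=
  contDiff_euclidean.1 hF i

lemma hasCompactSupport_coord {F : E3 → E3} (hF : HasCompactSupport F) (i : Fin 3) :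
    HasCompactSupport fun y => F y i :=
  hF.comp_left (g := fun v : E3 => v i) rfl

lemma contDiff_divergence {F : E3 → E3} (hF : ContDiff ℝ 2 F) : ContDiff ℝ 1 (divergence F) := by
  have h : ContDiff ℝ 1 (fderiv ℝ F) := hF.fderiv_right (by norm_num)
  exact ContDiff.sum fun i _ => contDiff_coord (h.clm_apply contDiff_const) i

lemma hasCompactSupport_divergence {F : E3 → E3} (hF : HasCompactSupport F) :
    HasCompactSupport (divergence F) :=
  (hF.fderiv ℝ).comp_left (g := fun L : E3 →L[ℝ] E3 => ∑ i, L (basisVec i) i) (by simp)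

lemma potential_univ_eq_sum_conv {φ : E3 → E3} (hφ : Continuous φ) (hc : HasCompactSupport φ)
    (x : E3) : potential univ φ x
      = ∑ i, conv (fun z => ⟪gradient newton z, basisVec i⟫) (fun y => φ y i) x := by
  rw [potential, setIntegral_univ, ← integral_sub_left_eq_self _ _ x]
  simp only [sub_sub_cancel]
  simp_rw [inner_eq_sum (gradient newton _) (φ _)]
  rw [integral_finsetSum]
  · rfl
  · exact fun i _ => integrable_conv_integrand (locallyIntegrable_inner_gradient_newton _)
      (g := fun y => φ y i) (by fun_prop) (hasCompactSupport_coord hc i) x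

lemma potential_univ_eq_conv_divergence {φ : E3 → E3} (hφ : ContDiff ℝ 2 φ)
    (hc : HasCompactSupport φ) : potential univ φ = conv newton (divergence φ) := by
  funext x
  rw [potential_univ_eq_sum_conv hφ.continuous hc]
  have h1 : ∀ i, ContDiff ℝ 1 fun y => φ y i :=
    fun i => (contDiff_coord hφ i).of_le (by norm_num)
  simp_rw [fun i => conv_inner_gradient_newton (h1 i) (hasCompactSupport_coord hc i) (basisVec i) x]
  unfold conv
  rw [← integral_finsetSum]
  · congr 1 with t
    rw [divergence, Finset.mul_sum]
    congr 1 with i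
    dsimp only
    rw [fderiv_coord (hφ.differentiable (by norm_num) _)]
  · intro i _
    exact integrable_conv_integrand locallyIntegrable_newton
      (g := fun y => fderiv ℝ (fun y => φ y i) y (basisVec i))
      (((h1 i).continuous_fderiv (by simp)).clm_apply continuous_const)
      ((hasCompactSupport_coord hc i).fderiv_apply ℝ _) x

/-- This is `ΔN = δ` translated to `x`, with one derivative on the kernel and the other on `g`. -/
lemma sum_conv_inner_gradient_newton {g : E3 → ℝ} (hg : ContDiff ℝ 1 g)
    (hc : HasCompactSupport g) (x : E3) :
    ∑ i, conv (fun z => ⟪gradient newton z, basisVec i⟫) (fun y => fderiv ℝ g y (basisVec i)) x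
      = g x := by
  have h := integral_fderiv_gradient_newton (contDiff_comp_const_sub hg x)
    (hasCompactSupport_comp_const_sub hc x)
  simp only [fderiv_comp_const_sub hg, integral_neg, neg_inj, sub_zero] at h
  rw [← h]
  unfold conv
  rw [← integral_finsetSum]
  · congr 1 with t
    conv_rhs => rw [eq_sum_basisVec (gradient newton t), map_sum]
    congr 1 with i
    rw [map_smul, smul_eq_mul]
    dsimp only
    rw [inner_basisVec]
  · intro i _
    exact integrable_conv_integrand (locallyIntegrable_inner_gradient_newton _)
      (g := fun y => fderiv ℝ g y (basisVec i))
      ((hg.continuous_fderiv (by simp)).clm_apply continuous_const) (hc.fderiv_apply ℝ _) x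

/-! ### Decay at infinity and square integrability. -/

/-- Near the support, continuity on a compact ball suffices; far away, the kernel itself decays
quadratically. Quadratic decay is square integrable because 4 exceeds the dimension 3. -/
lemma exists_conv_decay {g : E3 → ℝ} (hg : Continuous g) (hc : HasCompactSupport g) (v : E3) :
    ∃ C, ∀ x, |conv (fun z => ⟪gradient newton z, v⟫) g x| ≤ C * (1 + ‖x‖) ^ (-2 : ℝ) := by
  obtain ⟨R, hR1, hR⟩ : ∃ R : ℝ, 1 ≤ R ∧ ∀ y, g y ≠ 0 → ‖y‖ ≤ R := by
    obtain ⟨R, hR⟩ := hc.isCompact.isBounded.subset_closedBall 0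
    refine ⟨max R 1, le_max_right _ _, fun y hy => ?_⟩
    have := hR (subset_tsupport _ hy)
    exact (mem_closedBall_zero_iff.1 this).trans (le_max_left _ _)
  have hcont := continuous_conv (locallyIntegrable_inner_gradient_newton v) hg hc
  obtain ⟨B, hB⟩ := (isCompact_closedBall (0 : E3) (2 * R)).exists_bound_of_continuousOn
    hcont.continuousOn
  have hgi : Integrable g := hg.integrable_of_hasCompactSupport hc
  refine ⟨max (B * (1 + 2 * R) ^ (2 : ℝ)) (16 * ‖v‖ * ∫ y, ‖g y‖), fun x => ?_⟩
  have hpos : 0 < 1 + ‖x‖ := by positivity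
  by_cases hx : ‖x‖ ≤ 2 * R
  · have h1 := hB x (mem_closedBall_zero_iff.2 hx)
    have hB0 : 0 ≤ B := (norm_nonneg _).trans h1
    have h2 : (1 + 2 * R) ^ (-2 : ℝ) ≤ (1 + ‖x‖) ^ (-2 : ℝ) :=
      Real.rpow_le_rpow_of_nonpos hpos (by linarith) (by norm_num)
    calc |conv (fun z => ⟪gradient newton z, v⟫) g x| ≤ B := h1
      _ = B * (1 + 2 * R) ^ (2 : ℝ) * (1 + 2 * R) ^ (-2 : ℝ) := by
        rw [mul_assoc, ← Real.rpow_add (by linarith)]; simp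
      _ ≤ B * (1 + 2 * R) ^ (2 : ℝ) * (1 + ‖x‖) ^ (-2 : ℝ) := by gcongr
      _ ≤ _ := by gcongr; exact le_max_left _ _
  · push Not at hx
    have hb : ∀ y, ‖⟪gradient newton (x - y), v⟫ * g y‖
        ≤ (16 * ‖v‖ * (1 + ‖x‖) ^ (-2 : ℝ)) * ‖g y‖ := by
      intro y
      by_cases hy : g y = 0
      · simp [hy]
      have hy' := hR y hy
      rw [norm_mul]
      gcongr
      refine (norm_inner_le_norm _ _).trans ?_
      -- Since `‖y‖ ≤ R < ‖x‖ / 2`, the distance is at least `‖x‖ / 2`, and `‖x‖ ≥ 1` because `R ≥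
      -- 1`. The square of 4 is the constant 16.
      have h3 : (1 + ‖x‖) / 4 ≤ ‖x - y‖ := by
        have := norm_sub_norm_le x y
        linarith
      have h4 : ‖gradient newton (x - y)‖ ≤ 16 * (1 + ‖x‖) ^ (-2 : ℝ) := by
        refine (norm_gradient_newton_le _).trans ?_
        refine (Real.rpow_le_rpow_of_nonpos (by positivity) h3 (by norm_num)).trans_eq ?_
        rw [Real.div_rpow hpos.le (by norm_num), div_eq_mul_inv, mul_comm]
        congr 1
        rw [← Real.rpow_neg (by norm_num)]
        norm_num
      nlinarith [norm_nonneg v]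
    have hconv : conv (fun z => ⟪gradient newton z, v⟫) g x
        = ∫ y, ⟪gradient newton (x - y), v⟫ * g y := by
      rw [conv, ← integral_sub_left_eq_self _ _ x]
      simp
    rw [hconv]
    refine (norm_integral_le_of_norm_le (hgi.norm.const_mul _) (ae_of_all _ hb)).trans ?_
    rw [integral_const_mul]
    calc 16 * ‖v‖ * (1 + ‖x‖) ^ (-2 : ℝ) * ∫ y, ‖g y‖
        = (16 * ‖v‖ * ∫ y, ‖g y‖) * (1 + ‖x‖) ^ (-2 : ℝ) := by ring
      _ ≤ _ := by gcongr; exact le_max_right _ _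

lemma memLp_two_of_decay {F : Type*} [NormedAddCommGroup F] {f : E3 → F}
    (hf : AEStronglyMeasurable f)
    {C : ℝ} (hC : ∀ x, ‖f x‖ ≤ C * (1 + ‖x‖) ^ (-2 : ℝ)) : MemLp f 2 := by
  rw [memLp_two_iff_integrable_sq_norm hf]
  have h := (integrable_one_add_norm (E := E3) (μ := volume) (r := 4)
    (by rw [finrank_E3]; norm_num)).const_mul (C ^ 2)
  refine h.mono' (hf.norm.pow 2) (ae_of_all _ fun x => ?_)
  rw [Real.norm_of_nonneg (by positivity)]
  have hp : 0 < 1 + ‖x‖ := by positivity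
  calc ‖f x‖ ^ 2 ≤ (C * (1 + ‖x‖) ^ (-2 : ℝ)) ^ 2 := by gcongr; exact hC x
    _ = C ^ 2 * (1 + ‖x‖) ^ (-4 : ℝ) := by
      rw [mul_pow, ← Real.rpow_natCast ((1 + ‖x‖) ^ (-2 : ℝ)), ← Real.rpow_mul hp.le]
      norm_num

lemma memLp_conv {g : E3 → ℝ} (hg : Continuous g) (hc : HasCompactSupport g) (v : E3) :
    MemLp (conv (fun z => ⟪gradient newton z, v⟫) g) 2 := by
  obtain ⟨C, hC⟩ := exists_conv_decay hg hc v
  exact memLp_two_of_decay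
    (continuous_conv (locallyIntegrable_inner_gradient_newton v) hg hc).aestronglyMeasurable hC

/-! ### Potentials of compactly supported magnetizations. -/

lemma inner_gradient_left (u : E3 → ℝ) (x v : E3) : ⟪gradient u x, v⟫ = fderiv ℝ u x v := by
  simp [gradient]

lemma gradient_coord (u : E3 → ℝ) (x : E3) (i : Fin 3) :
    gradient u x i = fderiv ℝ u x (basisVec i) := by
  rw [← inner_gradient_left, inner_basisVec]

lemma fderiv_potential_univ {φ : E3 → E3} (hφ : ContDiff ℝ 2 φ) (hφc : HasCompactSupport φ)
    (x v : E3) : DifferentiableAt ℝ (potential univ φ) x ∧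
    fderiv ℝ (potential univ φ) x v = conv (fun z => ⟪gradient newton z, v⟫) (divergence φ) x := by
  rw [potential_univ_eq_conv_divergence hφ hφc]
  have h := hasFDerivAt_conv locallyIntegrable_newton (contDiff_divergence hφ)
    (hasCompactSupport_divergence hφc) x
  rw [h.2, conv_inner_gradient_newton (contDiff_divergence hφ) (hasCompactSupport_divergence hφc)]
  exact ⟨h.1, rfl⟩

/-- The derivative is kept on the kernel here: the bound on `∇N` gives decay of order 2, whereas the
bound on `N` would give order 1 only, which is not square integrable. -/
lemma memLp_potential_univ {φ : E3 → E3} (hφ : ContDiff ℝ 2 φ) (hφc : HasCompactSupport φ)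
    : MemLp (potential univ φ) 2 := by
  have : potential univ φ = fun x =>
      ∑ i, conv (fun z => ⟪gradient newton z, basisVec i⟫) (fun y => φ y i) x :=
    funext (potential_univ_eq_sum_conv hφ.continuous hφc)
  rw [this]
  exact memLp_finsetSum _ fun i _ =>
    memLp_conv (contDiff_coord hφ i).continuous (hasCompactSupport_coord hφc i) _

lemma memLp_fderiv_potential_univ {φ : E3 → E3} (hφ : ContDiff ℝ 2 φ) (hφc : HasCompactSupport φ)
    (v : E3) :
    MemLp (fun x => fderiv ℝ (potential univ φ) x v) 2 := by
  simp_rw [fun x => (fderiv_potential_univ hφ hφc x v).2]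
  exact memLp_conv (contDiff_divergence hφ).continuous (hasCompactSupport_divergence hφc) _

lemma memLp_gradient_potential_univ {φ : E3 → E3} (hφ : ContDiff ℝ 2 φ) (hφc : HasCompactSupport φ)
    : MemLp (gradient (potential univ φ)) 2 := by
  have : gradient (potential univ φ)
      = fun x => ∑ i, fderiv ℝ (potential univ φ) x (basisVec i) • basisVec i := by
    funext x
    conv_lhs => rw [eq_sum_basisVec (gradient _ x)]
    simp_rw [gradient_coord]
  rw [this]
  refine memLp_finsetSum _ fun i _ => ?_
  have := (memLp_fderiv_potential_univ hφ hφc (basisVec i)).norm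
  refine this.of_le ?_ (ae_of_all _ fun x => ?_)
  · exact (memLp_fderiv_potential_univ hφ hφc (basisVec i)).aestronglyMeasurable.smul_const _
  · simp [norm_smul, norm_basisVec]

/-- The energy identity for the stray fields of smooth magnetizations. -/
lemma integral_inner_gradient_potential_univ {φ ψ : E3 → E3} (hφ : ContDiff ℝ 2 φ) (hφc : HasCompactSupport φ)
    (hψ : ContDiff ℝ 2 ψ) (hψc : HasCompactSupport ψ) :
    ∫ x, ⟪gradient (potential univ φ) x, gradient (potential univ ψ) x⟫
      = ∫ x, ⟪gradient (potential univ φ) x, ψ x⟫ := by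
  set u := potential univ φ with hu
  set w := potential univ ψ with hw
  set g := divergence ψ with hg
  have hg1 := contDiff_divergence hψ
  have hgc := hasCompactSupport_divergence hψc
  have hud : Differentiable ℝ u := fun x => (fderiv_potential_univ hφ hφc x 0).1
  have hu2 : MemLp u 2 := memLp_potential_univ hφ hφc
  have huv : ∀ v, MemLp (fun x => fderiv ℝ u x v) 2 := memLp_fderiv_potential_univ hφ hφc
  have hwv : ∀ v, (fun x => fderiv ℝ w x v) = conv (fun z => ⟪gradient newton z, v⟫) g :=
    fun v => funext fun x => (fderiv_potential_univ hψ hψc x v).2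
  have hgv : ∀ v, Continuous fun y => fderiv ℝ g y v := fun v =>
    (hg1.continuous_fderiv (by simp)).clm_apply continuous_const
  -- first integration by parts
  have h1 : ∀ i, ∫ x, fderiv ℝ u x (basisVec i) * fderiv ℝ w x (basisVec i)
      = -∫ x, u x * conv (fun z => ⟪gradient newton z, basisVec i⟫)
          (fun y => fderiv ℝ g y (basisVec i)) x := by
    intro i
    have hd := fun x => hasFDerivAt_conv
      (locallyIntegrable_inner_gradient_newton (basisVec i)) hg1 hgc x
    have hdv : ∀ x, fderiv ℝ (conv (fun z => ⟪gradient newton z, basisVec i⟫) g) x (basisVec i)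
        = conv (fun z => ⟪gradient newton z, basisVec i⟫)
          (fun y => fderiv ℝ g y (basisVec i)) x := fun x => (hd x).2 _
    have hm := memLp_conv hg1.continuous hgc (basisVec i)
    have hm' := memLp_conv (hgv (basisVec i)) (hgc.fderiv_apply ℝ _) (basisVec i)
    have := integral_mul_fderiv_eq_neg_fderiv_mul_of_integrable (μ := (volume : Measure E3))
      (f := u) (g := conv (fun z => ⟪gradient newton z, basisVec i⟫) g) (v := basisVec i)
      ((huv _).integrable_mul hm)
      (by simp_rw [hdv]; exact hu2.integrable_mul hm') (hu2.integrable_mul hm)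
      (fun x _ => hud x) (fun x _ => (hd x).1)
    simp_rw [hdv] at this
    rw [this, neg_neg]
    congr 1 with x
    exact congrArg _ (congrFun (hwv _) x)
  -- second integration by parts
  have h2 : ∀ i, ∫ x, u x * fderiv ℝ ψ x (basisVec i) i
      = -∫ x, fderiv ℝ u x (basisVec i) * ψ x i := by
    intro i
    simp_rw [← fun x => fderiv_coord (hψ.differentiable (by norm_num) x) i (basisVec i)]
    have hc := hasCompactSupport_coord hψc i
    have hs := contDiff_coord hψ i
    have hs2 : MemLp (fun x => ψ x i) 2 := hs.continuous.memLp_of_hasCompactSupport hc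
    refine integral_mul_fderiv_eq_neg_fderiv_mul_of_integrable ((huv _).integrable_mul hs2) ?_
      (hu2.integrable_mul hs2) (fun x _ => hud x) (fun x _ => hs.differentiable (by norm_num) x)
    refine hu2.integrable_mul (q := 2) (Continuous.memLp_of_hasCompactSupport ?_ (hc.fderiv_apply ℝ _))
    exact (hs.continuous_fderiv (by norm_num)).clm_apply continuous_const
  have hin : ∀ a b : E3, ⟪a, b⟫ = ∑ i, a i * b i := by
    intro a b; simp [PiLp.inner_apply, mul_comm]
  have hψi : ∀ i, Integrable fun x => fderiv ℝ u x (basisVec i) * ψ x i := by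
    intro i
    have : MemLp (fun x => ψ x i) 2 :=
      (contDiff_coord hψ i).continuous.memLp_of_hasCompactSupport (hasCompactSupport_coord hψc i)
    exact (huv _).integrable_mul this
  simp_rw [hin, gradient_coord]
  have huw : ∀ i, Integrable fun x => fderiv ℝ u x (basisVec i) * fderiv ℝ w x (basisVec i) :=
    fun i => (huv _).integrable_mul (memLp_fderiv_potential_univ hψ hψc _)
  rw [integral_finsetSum _ fun i _ => huw i, integral_finsetSum _ fun i _ => hψi i]
  simp_rw [h1]
  have h3 : ∀ i, ∫ x, fderiv ℝ u x (basisVec i) * ψ x i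
      = -∫ x, u x * fderiv ℝ ψ x (basisVec i) i := fun i => by rw [h2 i, neg_neg]
  simp_rw [h3]
  rw [Finset.sum_neg_distrib, Finset.sum_neg_distrib, ← integral_finsetSum, ← integral_finsetSum]
  -- Summed over `i`, the convolutions give `ΔU[ψ] = div ψ`, so both sides are minus the integral of
  -- `U[φ] div ψ`.
  · congr 2 with x
    rw [← Finset.mul_sum, ← Finset.mul_sum, sum_conv_inner_gradient_newton hg1 hgc]
    rfl
  · intro i _
    refine hu2.integrable_mul (q := 2) (Continuous.memLp_of_hasCompactSupport ?_ ?_)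
    · exact (contDiff_coord ((hψ.fderiv_right (m := 1) (by norm_num)).clm_apply
        contDiff_const) i).continuous
    · exact (hψc.fderiv_apply ℝ (basisVec i)).comp_left (g := fun v : E3 => v i) rfl
  · intro i _
    exact hu2.integrable_mul (memLp_conv (hgv _) (hgc.fderiv_apply ℝ _) _)

/-- The energy identity with `ψ = φ` and Cauchy-Schwarz give `‖∇U‖² = ⟨∇U, φ⟩ ≤ ‖∇U‖ ‖φ‖`. -/
lemma eLpNorm_gradient_potential_univ_le {φ : E3 → E3} (hφ : ContDiff ℝ 2 φ)
    (hφc : HasCompactSupport φ) :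
    eLpNorm (gradient (potential univ φ)) 2 ≤ eLpNorm φ 2 := by
  have hu := memLp_gradient_potential_univ hφ hφc
  have hf : MemLp φ 2 := hφ.continuous.memLp_of_hasCompactSupport hφc
  have h1 : ⟪hu.toLp, hu.toLp⟫ = ⟪hu.toLp, hf.toLp⟫ := by
    rw [L2.inner_def, L2.inner_def]
    have h := integral_inner_gradient_potential_univ hφ hφc hφ hφc
    refine (integral_congr_ae ?_).trans (h.trans (integral_congr_ae ?_))
    · filter_upwards [hu.coeFn_toLp] with x hx
      rw [hx]
    · filter_upwards [hu.coeFn_toLp, hf.coeFn_toLp] with x hx hy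
      rw [hx, hy]
  have h2 : ‖hu.toLp‖ ≤ ‖hf.toLp‖ := by
    have h3 := real_inner_le_norm hu.toLp hf.toLp
    rw [← h1, real_inner_self_eq_norm_mul_norm] at h3
    by_contra! hlt
    have : 0 < ‖hu.toLp‖ := (norm_nonneg _).trans_lt hlt
    nlinarith
  rw [Lp.norm_toLp, Lp.norm_toLp] at h2
  exact (ENNReal.toReal_le_toReal hu.eLpNorm_ne_top hf.eLpNorm_ne_top).1 h2

/-! ### Magnetizations of a bounded open set -/

lemma tendsto_eLpNorm_two_zero {α F : Type*} [MeasurableSpace α] {μ : Measure α}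
    [NormedAddCommGroup F] {h : ℕ → α → F} {b : α → ℝ} (hm : ∀ k, AEStronglyMeasurable (h k) μ)
    (hb : MemLp b 2 μ) (hhb : ∀ k x, ‖h k x‖ ≤ ‖b x‖)
    (hl : ∀ x, Tendsto (fun k => h k x) atTop (𝓝 0)) :
    Tendsto (fun k => eLpNorm (h k) 2 μ) atTop (𝓝 0) := by
  simp_rw [eLpNorm_eq_lintegral_rpow_enorm_toReal (p := 2) (by norm_num) (by norm_num)]
  have h0 : (0 : ENNReal) = (∫⁻ _ : α, 0 ∂μ) ^ (1 / ENNReal.toReal 2) := by simp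
  rw [h0]
  refine (ENNReal.continuous_rpow_const.tendsto _).comp ?_
  refine tendsto_lintegral_of_dominated_convergence' (fun x => ‖b x‖ₑ ^ ENNReal.toReal 2)
    (fun k => (hm k).enorm.pow_const _) (fun k => ae_of_all _ fun x => ?_) ?_
    (ae_of_all _ fun x => ?_)
  · exact ENNReal.rpow_le_rpow (enorm_le_iff_norm_le.2 (hhb k x)) ENNReal.toReal_nonneg
  · have := lintegral_rpow_enorm_lt_top_of_eLpNorm_lt_top (p := 2) (by norm_num) (by norm_num)
      hb.eLpNorm_lt_top
    exact this.ne
  · have h1 : Tendsto (fun k => ‖h k x‖ₑ) atTop (𝓝 0) := by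
      have := (continuous_enorm.tendsto (0 : F)).comp (hl x)
      rwa [enorm_zero] at this
    have h2 := (ENNReal.continuous_rpow_const (y := ENNReal.toReal 2)).tendsto 0 |>.comp h1
    simpa [Function.comp_def] using h2

/-- Bounded measurable vector fields with bounded support. -/
structure IsBoundedField (f : E3 → E3) : Prop where
  measurable : AEStronglyMeasurable f
  bounded : ∃ C, ∀ x, ‖f x‖ ≤ C
  support : ∃ R, ∀ x, f x ≠ 0 → ‖x‖ ≤ R

namespace IsBoundedField

variable {f g : E3 → E3}

lemma exists_bound (hf : IsBoundedField f) : ∃ C R : ℝ, 0 ≤ C ∧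
    ∀ x, ‖f x‖ ≤ (Metric.closedBall (0 : E3) R).indicator (fun _ => C) x := by
  obtain ⟨C, hC⟩ := hf.bounded
  obtain ⟨R, hR⟩ := hf.support
  refine ⟨C, R, (norm_nonneg _).trans (hC 0), fun x => ?_⟩
  by_cases hx : f x = 0
  · rw [hx, norm_zero]
    exact indicator_nonneg (fun _ _ => (norm_nonneg _).trans (hC 0)) _
  · rw [indicator_of_mem (mem_closedBall_zero_iff.2 (hR x hx))]
    exact hC x

lemma sub (hf : IsBoundedField f) (hg : IsBoundedField g) : IsBoundedField (f - g) := by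
  obtain ⟨C, hC⟩ := hf.bounded
  obtain ⟨R, hR⟩ := hf.support
  obtain ⟨C', hC'⟩ := hg.bounded
  obtain ⟨R', hR'⟩ := hg.support
  refine ⟨hf.measurable.sub hg.measurable, ⟨C + C', fun x => ?_⟩, max R R', fun x hx => ?_⟩
  · exact (norm_sub_le _ _).trans (add_le_add (hC x) (hC' x))
  · by_cases h : f x = 0
    · refine (hR' x fun h' => hx ?_).trans (le_max_right _ _)
      simp [h, h']
    · exact (hR x h).trans (le_max_left _ _)

lemma memLp (hf : IsBoundedField f) (p : ENNReal) : MemLp f p := by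
  obtain ⟨C, R, hC, h⟩ := hf.exists_bound
  have h1 : MemLp ((Metric.closedBall (0 : E3) R).indicator fun _ => C) p :=
    memLp_indicator_const _ Metric.isClosed_closedBall.measurableSet C
      (Or.inr (isCompact_closedBall (0 : E3) R).measure_lt_top.ne)
  exact h1.mono' hf.measurable (ae_of_all _ h)

lemma integrable (hf : IsBoundedField f) : Integrable f := memLp_one_iff_integrable.1 (hf.memLp 1)

lemma integrable_potential (hf : IsBoundedField f) (x : E3) :
    Integrable fun y => ⟪gradient newton (x - y), f y⟫ := by
  obtain ⟨C, R, hC, h⟩ := hf.exists_bound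
  have h1 : IntegrableOn (fun t => ‖gradient newton t‖ * C) (Metric.closedBall x R) :=
    ((locallyIntegrable_gradient_newton.integrableOn_isCompact
      (isCompact_closedBall x R)).norm).mul_const C
  rw [← integrable_indicator_iff Metric.isClosed_closedBall.measurableSet] at h1
  refine (h1.comp_sub_left x).mono ?_ (ae_of_all _ fun y => ?_)
  · have : Measurable fun y => gradient newton (x - y) :=
      measurable_gradient_newton.comp (measurable_const.sub measurable_id)
    exact this.aestronglyMeasurable.inner hf.measurable
  · refine (norm_inner_le_norm _ _).trans ?_
    by_cases hy : y ∈ Metric.closedBall (0 : E3) R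
    · have hy' : x - y ∈ Metric.closedBall x R := by
        simpa [dist_eq_norm] using hy
      rw [indicator_of_mem hy', norm_mul, norm_norm, Real.norm_of_nonneg hC]
      gcongr
      have := h y
      rwa [indicator_of_mem hy] at this
    · have := h y
      rw [indicator_of_notMem hy] at this
      have h0 : ‖f y‖ = 0 := le_antisymm this (norm_nonneg _)
      rw [h0, mul_zero]
      exact norm_nonneg _

lemma potential_sub (hf : IsBoundedField f) (hg : IsBoundedField g) :
    potential univ (f - g) = potential univ f - potential univ g := by
  funext x
  simp only [potential, setIntegral_univ, Pi.sub_apply, inner_sub_right]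
  exact integral_sub (hf.integrable_potential x) (hg.integrable_potential x)

end IsBoundedField

lemma potential_eq_indicator {Ω : Set E3} (hΩ : MeasurableSet Ω) (m : E3 → E3) :
    potential Ω m = potential univ (Ω.indicator m) := by
  funext x
  rw [potential, potential, setIntegral_univ, ← integral_indicator hΩ]
  congr 1 with y
  by_cases hy : y ∈ Ω <;> simp [hy]

/-! ### The potential away from its sources. -/

/-- The product rule for `‖z‖⁻³ z` gives two terms, of size at most `‖z‖⁻³` and `3 ‖z‖⁻³`, both
decreasing in `‖z‖`. -/
lemma exists_norm_fderiv_gradient_newton_le {r : ℝ} (hr : 0 < r) :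
    ∃ C, ∀ z, r ≤ ‖z‖ → HasFDerivAt (gradient newton) (fderiv ℝ (gradient newton) z) z ∧
      ‖fderiv ℝ (gradient newton) z‖ ≤ C := by
  refine ⟨(4 * Real.pi)⁻¹ * ((r ^ 3)⁻¹ + 3 * (r ^ 3)⁻¹), fun z hz => ?_⟩
  have hz0 : z ≠ 0 := norm_pos_iff.1 (hr.trans_le hz)
  have hn : ‖z‖ ≠ 0 := norm_ne_zero_iff.2 hz0
  have h0 : HasFDerivAt (fun y : E3 => ‖y‖) (fderiv ℝ (fun y : E3 => ‖y‖) z) z :=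
    ((contDiffAt_norm ℝ hz0 (n := 1)).differentiableAt (by simp)).hasFDerivAt
  have h0n : ‖fderiv ℝ (fun y : E3 => ‖y‖) z‖ = 1 := norm_fderiv_norm h0.differentiableAt
  have hq : HasDerivAt (fun s : ℝ => (s ^ 3)⁻¹) (-(3 * ‖z‖ ^ 2) / (‖z‖ ^ 3) ^ 2) ‖z‖ := by
    simpa using (hasDerivAt_pow 3 ‖z‖).fun_inv (pow_ne_zero 3 hn)
  have h2 := ((hq.comp_hasFDerivAt z h0).smul (hasFDerivAt_id z)).const_smul (4 * Real.pi)⁻¹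
  have h3 : gradient newton
      = (4 * Real.pi)⁻¹ • ((fun s : ℝ => (s ^ 3)⁻¹) ∘ (fun y : E3 => ‖y‖)) • id :=
    funext fun z => gradient_newton z
  rw [← h3] at h2
  refine ⟨h2.differentiableAt.hasFDerivAt, ?_⟩
  rw [h2.fderiv, norm_smul, Real.norm_of_nonneg (by positivity)]
  gcongr
  refine (norm_add_le _ _).trans (add_le_add ?_ ?_)
  · rw [norm_smul, Function.comp_apply, norm_inv, norm_pow, norm_norm]
    refine (mul_le_of_le_one_right (by positivity) ContinuousLinearMap.norm_id_le).trans ?_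
    gcongr
  · rw [ContinuousLinearMap.norm_smulRight_apply, norm_smul, h0n, mul_one, norm_div, norm_neg,
      Real.norm_of_nonneg (by positivity), Real.norm_of_nonneg (by positivity), id]
    have : 3 * ‖z‖ ^ 2 / (‖z‖ ^ 3) ^ 2 * ‖z‖ = 3 * (‖z‖ ^ 3)⁻¹ := by field_simp
    rw [this]
    gcongr

/-- Away from its sources, the potential is differentiable, and its gradient is controlled by the
total mass of the sources. -/
lemma exists_norm_gradient_potential_le {r : ℝ} (hr : 0 < r) :
    ∃ C, ∀ (f : E3 → E3) (x : E3), IsBoundedField f → (∀ y ∈ Metric.ball x r, f y = 0) →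
      DifferentiableAt ℝ (potential univ f) x ∧
        ‖gradient (potential univ f) x‖ ≤ C * ∫ y, ‖f y‖ := by
  -- Differentiation under the integral needs a bound on a neighbourhood of `x`: points within `r /
  -- 2` of `x` stay at distance at least `r / 2` from the sources.
  obtain ⟨C, hC⟩ := exists_norm_fderiv_gradient_newton_le (half_pos hr)
  refine ⟨C, fun f x hf h0 => ?_⟩
  set F' : E3 → E3 → E3 →L[ℝ] ℝ :=
    fun x y => (innerSL ℝ (f y)).comp (fderiv ℝ (gradient newton) (x - y)) with hF'
  have hpot : potential univ f = fun x => ∫ y, ⟪gradient newton (x - y), f y⟫ := by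
    funext x; rw [potential, setIntegral_univ]
  have hfar : ∀ x' ∈ Metric.ball x (r / 2), ∀ y, f y ≠ 0 → r / 2 ≤ ‖x' - y‖ := by
    intro x' hx' y hy
    have h1 : r ≤ dist y x := by
      by_contra! h
      exact hy (h0 y h)
    have h2 : dist x' x < r / 2 := hx'
    rw [← dist_eq_norm]
    have := dist_triangle y x' x
    rw [dist_comm y x'] at this
    linarith
  have hbound : ∀ x' ∈ Metric.ball x (r / 2), ∀ y, ‖F' x' y‖ ≤ C * ‖f y‖ := by
    intro x' hx' y
    by_cases hy : f y = 0
    · simp [hF', hy]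
    refine (ContinuousLinearMap.opNorm_comp_le _ _).trans ?_
    rw [innerSL_apply_norm, mul_comm]
    gcongr
    exact (hC _ (hfar x' hx' y hy)).2
  have hmem : Metric.ball x (r / 2) ∈ 𝓝 x := Metric.ball_mem_nhds _ (half_pos hr)
  have hmain : HasFDerivAt (potential univ f) (∫ y, F' x y) x := by
    rw [hpot]
    refine hasFDerivAt_integral_of_dominated_of_fderiv_le (bound := fun y => C * ‖f y‖)
      hmem (Eventually.of_forall fun x' => (hf.integrable_potential x').aestronglyMeasurable)
      (hf.integrable_potential x) ?_ (ae_of_all _ fun y x' hx' => hbound x' hx' y)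
      (hf.integrable.norm.const_mul C) (ae_of_all _ fun y x' hx' => ?_)
    · have h1 : Measurable fun y => fderiv ℝ (gradient newton) (x - y) :=
        (measurable_fderiv ℝ (gradient newton)).comp (measurable_const.sub measurable_id)
      have h2 : AEStronglyMeasurable fun y => innerSL ℝ (f y) :=
        (innerSL ℝ (E := E3)).continuous.comp_aestronglyMeasurable hf.measurable
      exact (continuous_fst.clm_comp continuous_snd).comp_aestronglyMeasurable
        (h2.prodMk h1.aestronglyMeasurable)
    · by_cases hy : f y = 0
      · simp only [hF', hy, inner_zero_right, map_zero, ContinuousLinearMap.zero_comp]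
        exact hasFDerivAt_const _ _
      · have h1 := (hC _ (hfar x' hx' y hy)).1
        have h2 : HasFDerivAt (fun x' => gradient newton (x' - y))
            (fderiv ℝ (gradient newton) (x' - y)) x' :=
          h1.comp (f := fun z => z - y) x' ((hasFDerivAt_id x').sub_const y)
        have h3 := (innerSL ℝ (f y)).hasFDerivAt.comp x' h2
        refine h3.congr_of_eventuallyEq (Eventually.of_forall fun z => ?_)
        simp [real_inner_comm]
  refine ⟨hmain.differentiableAt, ?_⟩
  rw [gradient, LinearIsometryEquiv.norm_map, hmain.fderiv, ← integral_const_mul]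
  exact norm_integral_le_of_norm_le (hf.integrable.norm.const_mul C)
    (ae_of_all _ fun y => hbound x (mem_of_mem_nhds hmem) y)

/-- A smooth exhaustion of a bounded open set by cutoff functions. -/
lemma exists_cutoff {Ω : Set E3} (hΩ : IsOpen Ω) (hb : Bornology.IsBounded Ω) :
    ∃ η : ℕ → E3 → ℝ, (∀ k, ContDiff ℝ ∞ (η k) ∧ tsupport (η k) ⊆ Ω ∧
        HasCompactSupport (η k) ∧ ∀ x, η k x ∈ Icc 0 1) ∧
      ∀ x ∈ Ω, ∃ r > 0, ∀ᶠ k in atTop, ∀ y ∈ Metric.ball x r, η k y = 1 := by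
  -- The cutoffs are built from the distance to the complement, and `Metric.infDist` to the empty
  -- set would be the default value zero.
  have hne : (Ωᶜ).Nonempty := by
    by_contra! h
    rw [compl_empty_iff] at h
    exact NormedSpace.unbounded_univ ℝ E3 (h ▸ hb)
  set d : E3 → ℝ := fun x => Metric.infDist x Ωᶜ with hd
  have hdc : Continuous d := Metric.continuous_infDist_pt _
  have hpos : ∀ x, 0 < d x → x ∈ Ω := fun x hx => by
    by_contra h
    exact hx.ne' (Metric.infDist_zero_of_mem h)
  have hstep : ∀ k : ℕ, (1 : ℝ) / ((k : ℝ) + 1 + 1) < 1 / ((k : ℝ) + 1) := fun k =>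
    one_div_lt_one_div_of_lt (by positivity) (by linarith)
  have hex : ∀ k : ℕ, ∃ f : E3 → ℝ, ContDiff ℝ ∞ f ∧ (∀ x, d x ≤ 1 / ((k : ℝ) + 1 + 1) → f x = 0) ∧
      (∀ x, 1 / ((k : ℝ) + 1) ≤ d x → f x = 1) ∧ ∀ x, f x ∈ Icc 0 1 := by
    intro k
    obtain ⟨f, h0, h1, hf⟩ := exists_contMDiffMap_zero_one_of_isClosed (modelWithCornersSelf ℝ E3)
      (n := ⊤) (s := {x | d x ≤ 1 / ((k : ℝ) + 1 + 1)}) (t := {x | 1 / ((k : ℝ) + 1) ≤ d x})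
      (isClosed_le hdc continuous_const) (isClosed_le continuous_const hdc)
      (disjoint_left.2 fun x hx hx' => by
        have := hstep k
        simp only [mem_ofPred_eq] at hx hx'
        linarith)
    exact ⟨f, f.contMDiff.contDiff, fun x hx => h0 hx, fun x hx => h1 hx, hf⟩
  choose η hη h0 h1 h01 using hex
  have hts : ∀ k, tsupport (η k) ⊆ {x | 1 / ((k : ℝ) + 1 + 1) ≤ d x} := fun k =>
    closure_minimal (fun x hx => by
      by_contra h
      exact hx (h0 k x (not_le.1 h).le)) (isClosed_le continuous_const hdc)
  have hts' : ∀ k, tsupport (η k) ⊆ Ω := fun k x hx =>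
    hpos x (lt_of_lt_of_le (by positivity) (hts k hx))
  refine ⟨η, fun k => ⟨hη k, hts' k, ?_, h01 k⟩, fun x hx => ?_⟩
  · exact Metric.isCompact_of_isClosed_isBounded (isClosed_tsupport _) (hb.subset (hts' k))
  · have hdx : 0 < d x :=
      (hΩ.isClosed_compl.notMem_iff_infDist_pos hne).1 (fun h => h hx)
    refine ⟨d x / 2, half_pos hdx, ?_⟩
    filter_upwards [(tendsto_one_div_add_atTop_nhds_zero_nat (𝕜 := ℝ)).eventually_lt_const
      (half_pos hdx)] with k hk y hy
    refine h1 k y (hk.le.trans ?_)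
    have h2 := Metric.infDist_le_infDist_add_dist (s := Ωᶜ) (x := x) (y := y)
    have h3 : dist x y < d x / 2 := by rw [dist_comm]; exact hy
    simp only [hd] at *
    linarith

/-- Bounded vector fields on `Ω` of class `C²`. -/
structure IsRegularField (Ω : Set E3) (m : E3 → E3) : Prop where
  contDiffOn : ContDiffOn ℝ 2 m Ω
  bounded : ∃ C, ∀ x ∈ Ω, ‖m x‖ ≤ C

/-- Each point outside `Ω` has a neighbourhood on which `η` vanishes, so the values of `m` there do
not matter. -/
lemma contDiff_smul_of_tsupport_subset {F : Type*} [NormedAddCommGroup F] [NormedSpace ℝ F]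
    {Ω : Set E3} (hΩ : IsOpen Ω) {n : WithTop ℕ∞} {η : E3 → ℝ}
    {m : E3 → F} (hη : ContDiff ℝ n η) (hs : tsupport η ⊆ Ω) (hm : ContDiffOn ℝ n m Ω) :
    ContDiff ℝ n fun x => η x • m x := by
  rw [contDiff_iff_contDiffAt]
  intro x
  by_cases hx : x ∈ Ω
  · exact hη.contDiffAt.smul (hm.contDiffAt (hΩ.mem_nhds hx))
  · have h : (fun x => η x • m x) =ᶠ[𝓝 x] fun _ => 0 := by
      have hx' : x ∈ (tsupport η)ᶜ := fun h => hx (hs h)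
      filter_upwards [(isClosed_tsupport η).isOpen_compl.mem_nhds hx'] with y hy
      rw [image_eq_zero_of_notMem_tsupport hy, zero_smul]
    exact contDiffAt_const.congr_of_eventuallyEq h

namespace IsRegularField

variable {Ω : Set E3} {m n : E3 → E3}

lemma sub (hm : IsRegularField Ω m) (hn : IsRegularField Ω n) : IsRegularField Ω (m - n) := by
  obtain ⟨C, hC⟩ := hm.bounded
  obtain ⟨C', hC'⟩ := hn.bounded
  exact ⟨hm.contDiffOn.sub hn.contDiffOn, C + C', fun x hx =>
    (norm_sub_le _ _).trans (add_le_add (hC x hx) (hC' x hx))⟩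

lemma isBoundedField (hΩ : IsOpen Ω) (hb : Bornology.IsBounded Ω) (hm : IsRegularField Ω m) :
    IsBoundedField (Ω.indicator m) := by
  obtain ⟨C, hC⟩ := hm.bounded
  obtain ⟨R, hR⟩ := hb.subset_closedBall 0
  refine ⟨(aestronglyMeasurable_indicator_iff hΩ.measurableSet).2
    (hm.contDiffOn.continuousOn.aestronglyMeasurable hΩ.measurableSet), ⟨max C 0, fun x => ?_⟩,
    R, fun x hx => mem_closedBall_zero_iff.1 (hR (mem_of_indicator_ne_zero hx))⟩
  by_cases hx : x ∈ Ω
  · rw [indicator_of_mem hx]; exact (hC x hx).trans (le_max_left _ _)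
  · rw [indicator_of_notMem hx, norm_zero]; exact le_max_right _ _

end IsRegularField

/-- Approximation of a bounded `C²` field on `Ω` by fields of class `C²` with compact support. -/
structure IsApprox (Ω : Set E3) (m : E3 → E3) (φ : ℕ → E3 → E3) : Prop where
  contDiff : ∀ k, ContDiff ℝ 2 (φ k)
  hasCompactSupport : ∀ k, HasCompactSupport (φ k)
  norm_le : ∀ k x, ‖φ k x‖ ≤ ‖Ω.indicator m x‖
  norm_sub_le : ∀ k x, ‖Ω.indicator m x - φ k x‖ ≤ ‖Ω.indicator m x‖
  eventually_eq : ∀ x ∉ frontier Ω, ∃ r > 0, ∀ᶠ k in atTop,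
    ∀ y ∈ Metric.ball x r, (Ω.indicator m - φ k) y = 0
  tendsto : ∀ x, Tendsto (fun k => Ω.indicator m x - φ k x) atTop (𝓝 0)

/-- The witnesses are `η k • m` for the exhausting cutoffs. Near a point of `Ω` the factor is
eventually one; near a point outside the closure everything vanishes. At frontier points only the
values are compared, and they are zero. -/
lemma exists_isApprox {Ω : Set E3} (hΩ : IsOpen Ω) (hb : Bornology.IsBounded Ω) {m : E3 → E3}
    (hm : IsRegularField Ω m) : ∃ φ, IsApprox Ω m φ := by
  obtain ⟨η, hη, hη1⟩ := exists_cutoff hΩ hb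
  have hout : ∀ k, ∀ x ∉ Ω, η k x = 0 := fun k x hx =>
    image_eq_zero_of_notMem_tsupport fun h => hx ((hη k).2.1 h)
  have hloc : ∀ x ∉ frontier Ω, ∃ r > 0, ∀ᶠ k in atTop,
      ∀ y ∈ Metric.ball x r, (Ω.indicator m - fun x => η k x • m x) y = 0 := by
    intro x hx
    by_cases hxΩ : x ∈ Ω
    · obtain ⟨r, hr, h⟩ := hη1 x hxΩ
      refine ⟨r, hr, h.mono fun k hk y hy => ?_⟩
      have h1 := hk y hy
      have hy : y ∈ Ω := by
        by_contra hc
        rw [hout k y hc] at h1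
        exact zero_ne_one h1
      simp [h1, hy]
    · have hcl : x ∈ (closure Ω)ᶜ := fun hc => hx (by
        rw [hΩ.frontier_eq]; exact ⟨hc, hxΩ⟩)
      obtain ⟨r, hr, h⟩ := Metric.isOpen_iff.1 isClosed_closure.isOpen_compl x hcl
      refine ⟨r, hr, Eventually.of_forall fun k y hy => ?_⟩
      have hy : y ∉ Ω := fun hc => h hy (subset_closure hc)
      simp [hy, hout k y hy]
  refine ⟨fun k x => η k x • m x, fun k => ?_, fun k => (hη k).2.2.1.smul_right, fun k x => ?_,
    fun k x => ?_, hloc, fun x => ?_⟩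
  · exact contDiff_smul_of_tsupport_subset hΩ (contDiff_infty.1 (hη k).1 2) (hη k).2.1
      hm.contDiffOn
  · by_cases hx : x ∈ Ω
    · rw [indicator_of_mem hx, norm_smul, Real.norm_of_nonneg ((hη k).2.2.2 x).1]
      exact mul_le_of_le_one_left (norm_nonneg _) ((hη k).2.2.2 x).2
    · simp [hout k x hx]
  · by_cases hx : x ∈ Ω
    · have h1 := (hη k).2.2.2 x
      rw [indicator_of_mem hx]
      have : m x - η k x • m x = (1 - η k x) • m x := by rw [sub_smul, one_smul]
      rw [this, norm_smul, Real.norm_of_nonneg (by linarith [h1.2])]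
      exact mul_le_of_le_one_left (norm_nonneg _) (by linarith [h1.1])
    · simp [hout k x hx, hx]
  · by_cases hx : x ∈ Ω
    · have hx' : x ∉ frontier Ω := fun h => by
        rw [hΩ.frontier_eq] at h; exact h.2 hx
      obtain ⟨r, hr, h⟩ := hloc x hx'
      refine tendsto_const_nhds.congr' (h.mono fun k hk => ?_)
      exact (hk x (Metric.mem_ball_self hr)).symm
    · simp [hout _ x hx, hx]

variable {Ω : Set E3} {m n : E3 → E3} {φ ψ : ℕ → E3 → E3}

namespace IsApprox

lemma isBoundedField (h : IsApprox Ω m φ) (k : ℕ) : IsBoundedField (φ k) := by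
  obtain ⟨C, hC⟩ := (h.hasCompactSupport k).exists_bound_of_continuous (h.contDiff k).continuous
  obtain ⟨R, hR⟩ := (h.hasCompactSupport k).isCompact.isBounded.subset_closedBall 0
  exact ⟨(h.contDiff k).continuous.aestronglyMeasurable, ⟨C, hC⟩, R, fun x hx =>
    mem_closedBall_zero_iff.1 (hR (subset_tsupport _ hx))⟩

lemma tendsto_eLpNorm (h : IsApprox Ω m φ) (hf : IsBoundedField (Ω.indicator m)) :
    Tendsto (fun k => eLpNorm (Ω.indicator m - φ k) 2) atTop (𝓝 0) := by
  refine tendsto_eLpNorm_two_zero (b := fun x => ‖Ω.indicator m x‖)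
    (fun k => (hf.sub (h.isBoundedField k)).measurable) (hf.memLp 2).norm (fun k x => ?_)
    h.tendsto
  rw [norm_norm]
  exact h.norm_sub_le k x

/-- The error `m - φ k` eventually has no sources near `x`, so the gradient of its potential at `x`
is controlled by its `L¹` norm, which tends to zero by dominated convergence. -/
lemma gradient_potential (h : IsApprox Ω m φ) (hΩ : MeasurableSet Ω)
    (hf : IsBoundedField (Ω.indicator m)) {x : E3} (hx : x ∉ frontier Ω) :
    DifferentiableAt ℝ (potential Ω m) x ∧
      Tendsto (fun k => gradient (potential univ (φ k)) x) atTop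
        (𝓝 (gradient (potential Ω m) x)) := by
  obtain ⟨r, hr, hev⟩ := h.eventually_eq x hx
  obtain ⟨C, hC⟩ := exists_norm_gradient_potential_le hr
  have hφd : ∀ k, DifferentiableAt ℝ (potential univ (φ k)) x := fun k =>
    (fderiv_potential_univ (h.contDiff k) (h.hasCompactSupport k) x 0).1
  have hd : ∀ k, (∀ y ∈ Metric.ball x r, (Ω.indicator m - φ k) y = 0) →
      DifferentiableAt ℝ (potential Ω m) x ∧ ‖gradient (potential Ω m) x
        - gradient (potential univ (φ k)) x‖ ≤ C * ∫ y, ‖(Ω.indicator m - φ k) y‖ := by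
    intro k hk
    obtain ⟨h1, h2⟩ := hC _ x (hf.sub (h.isBoundedField k)) hk
    rw [hf.potential_sub (h.isBoundedField k), ← potential_eq_indicator hΩ] at h1 h2
    have h3 : DifferentiableAt ℝ (potential Ω m) x := by
      have := h1.add (hφd k)
      rwa [sub_add_cancel] at this
    refine ⟨h3, ?_⟩
    rwa [gradient, fderiv_sub h3 (hφd k), map_sub] at h2
  obtain ⟨k0, hk0⟩ := hev.exists
  refine ⟨(hd k0 hk0).1, ?_⟩
  rw [tendsto_iff_norm_sub_tendsto_zero]
  have hlim : Tendsto (fun k => C * ∫ y, ‖(Ω.indicator m - φ k) y‖) atTop (𝓝 0) := by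
    have h0 : (0 : ℝ) = C * ∫ _ : E3, (0 : ℝ) := by simp
    rw [h0]
    refine Tendsto.const_mul _ ?_
    refine tendsto_integral_of_dominated_convergence (fun y => ‖Ω.indicator m y‖)
      (fun k => (hf.sub (h.isBoundedField k)).measurable.norm) hf.integrable.norm
      (fun k => ae_of_all _ fun y => ?_) (ae_of_all _ fun y => ?_)
    · rw [norm_norm]; exact h.norm_sub_le k y
    · have := (h.tendsto y).norm
      rwa [norm_zero] at this
  refine tendsto_of_tendsto_of_tendsto_of_le_of_le' tendsto_const_nhds hlim
    (Eventually.of_forall fun _ => norm_nonneg _) (hev.mono fun k hk => ?_)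
  rw [norm_sub_rev]
  exact (hd k hk).2

end IsApprox

/-! ### Stray fields of magnetizations that need not vanish at the boundary. -/

lemma aestronglyMeasurable_gradient (u : E3 → ℝ) : AEStronglyMeasurable (gradient u) := by
  have : Measurable (gradient u) :=
    (InnerProductSpace.toDual ℝ E3).symm.continuous.measurable.comp (measurable_fderiv ℝ u)
  exact this.aestronglyMeasurable

lemma IsRegularField.differentiableAt_potential (hΩ : IsOpen Ω) (hb : Bornology.IsBounded Ω)
    (hm : IsRegularField Ω m) {x : E3} (hx : x ∉ frontier Ω) :
    DifferentiableAt ℝ (potential Ω m) x := by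
  obtain ⟨φ, hφ⟩ := exists_isApprox hΩ hb hm
  exact (hφ.gradient_potential hΩ.measurableSet (hm.isBoundedField hΩ hb) hx).1

lemma IsRegularField.gradient_potential_sub (hΩ : IsOpen Ω) (hb : Bornology.IsBounded Ω)
    (hm : IsRegularField Ω m) (hn : IsRegularField Ω n) {x : E3} (hx : x ∉ frontier Ω) :
    gradient (potential Ω (m - n)) x = gradient (potential Ω m) x - gradient (potential Ω n) x := by
  have h1 : potential Ω (m - n) = potential Ω m - potential Ω n := by
    simp_rw [potential_eq_indicator hΩ.measurableSet]
    rw [indicator_sub', (hm.isBoundedField hΩ hb).potential_sub (hn.isBoundedField hΩ hb)]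
  rw [h1, gradient, fderiv_sub (hm.differentiableAt_potential hΩ hb hx)
    (hn.differentiableAt_potential hΩ hb hx), map_sub]
  rfl

/-- Fatou's lemma: the gradients of the approximating potentials converge almost everywhere, and the
approximations are dominated by `m` in norm. -/
lemma IsRegularField.eLpNorm_gradient_potential_le (hΩ : IsOpen Ω) (hb : Bornology.IsBounded Ω)
    (h0 : volume (frontier Ω) = 0) (hm : IsRegularField Ω m) :
    eLpNorm (gradient (potential Ω m)) 2 ≤ eLpNorm (Ω.indicator m) 2 := by
  obtain ⟨φ, hφ⟩ := exists_isApprox hΩ hb hm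
  refine Lp.eLpNorm_le_of_ae_tendsto (u := atTop) (f := fun k => gradient (potential univ (φ k)))
    (Eventually.of_forall fun k => ?_) (fun k => aestronglyMeasurable_gradient _) ?_
  · exact (eLpNorm_gradient_potential_univ_le (hφ.contDiff k) (hφ.hasCompactSupport k)).trans
      (eLpNorm_mono (hφ.norm_le k))
  · have : ∀ᵐ x, x ∉ frontier Ω := measure_eq_zero_iff_ae_notMem.1 h0
    filter_upwards [this] with x hx
    exact (hφ.gradient_potential hΩ.measurableSet (hm.isBoundedField hΩ hb) hx).2

lemma IsRegularField.memLp_gradient_potential (hΩ : IsOpen Ω) (hb : Bornology.IsBounded Ω)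
    (h0 : volume (frontier Ω) = 0) (hm : IsRegularField Ω m) :
    MemLp (gradient (potential Ω m)) 2 :=
  ⟨aestronglyMeasurable_gradient _, (hm.eLpNorm_gradient_potential_le hΩ hb h0).trans_lt
    ((hm.isBoundedField hΩ hb).memLp 2).eLpNorm_lt_top⟩

/-- The error `m - φ k` is again a regular field, so the contraction estimate turns `L²` convergence
of the magnetizations into `L²` convergence of the gradients. -/
lemma IsApprox.tendsto_toLp (h : IsApprox Ω m φ) (hΩ : IsOpen Ω) (hb : Bornology.IsBounded Ω)
    (h0 : volume (frontier Ω) = 0) (hm : IsRegularField Ω m) :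
    Tendsto (fun k => (memLp_gradient_potential_univ (h.contDiff k) (h.hasCompactSupport k)).toLp)
        atTop (𝓝 (hm.memLp_gradient_potential hΩ hb h0).toLp) ∧
      Tendsto (fun k => ((h.isBoundedField k).memLp 2).toLp) atTop
        (𝓝 ((hm.isBoundedField hΩ hb).memLp 2).toLp) := by
  have hf := hm.isBoundedField hΩ hb
  have hlim := h.tendsto_eLpNorm hf
  rw [Lp.tendsto_Lp_iff_tendsto_eLpNorm'', Lp.tendsto_Lp_iff_tendsto_eLpNorm'']
  have hres : ∀ k, IsRegularField Ω (m - φ k) := fun k =>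
    hm.sub ⟨(h.contDiff k).contDiffOn, by
      obtain ⟨C, hC⟩ := (h.isBoundedField k).bounded
      exact ⟨C, fun x _ => hC x⟩⟩
  have hφΩ : ∀ k, Ω.indicator (φ k) = φ k := fun k => indicator_eq_self.2 fun x hx => by
    by_contra hxΩ
    have := h.norm_le k x
    rw [indicator_of_notMem hxΩ, norm_zero, norm_le_zero_iff] at this
    exact hx this
  have hpot : ∀ k, potential univ (φ k) = potential Ω (φ k) := fun k => by
    rw [potential_eq_indicator hΩ.measurableSet, hφΩ]
  have hreg : ∀ k, IsRegularField Ω (φ k) := fun k => ⟨(h.contDiff k).contDiffOn, by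
      obtain ⟨C, hC⟩ := (h.isBoundedField k).bounded
      exact ⟨C, fun x _ => hC x⟩⟩
  constructor
  · refine tendsto_of_tendsto_of_tendsto_of_le_of_le tendsto_const_nhds hlim
      (fun _ => zero_le) fun k => ?_
    have h1 : gradient (potential univ (φ k)) - gradient (potential Ω m)
        =ᵐ[volume] -gradient (potential Ω (m - φ k)) := by
      filter_upwards [measure_eq_zero_iff_ae_notMem.1 h0] with x hx
      rw [Pi.neg_apply, hm.gradient_potential_sub hΩ hb (hreg k) hx, hpot, Pi.sub_apply, neg_sub]
    dsimp only
    rw [eLpNorm_congr_ae h1, eLpNorm_neg]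
    refine ((hm.sub (hreg k)).eLpNorm_gradient_potential_le hΩ hb h0).trans_eq ?_
    rw [indicator_sub', hφΩ]
  · refine hlim.congr fun k => ?_
    rw [← eLpNorm_neg, neg_sub]

/-- The energy identity for stray fields. -/
lemma IsRegularField.inner_gradient_potential (hΩ : IsOpen Ω) (hb : Bornology.IsBounded Ω)
    (h0 : volume (frontier Ω) = 0) (hm : IsRegularField Ω m) (hn : IsRegularField Ω n) :
    ⟪(hm.memLp_gradient_potential hΩ hb h0).toLp, (hn.memLp_gradient_potential hΩ hb h0).toLp⟫
      = ⟪(hm.memLp_gradient_potential hΩ hb h0).toLp,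
          ((hn.isBoundedField hΩ hb).memLp 2).toLp⟫ := by
  obtain ⟨φ, hφ⟩ := exists_isApprox hΩ hb hm
  obtain ⟨ψ, hψ⟩ := exists_isApprox hΩ hb hn
  obtain ⟨h1, -⟩ := hφ.tendsto_toLp hΩ hb h0 hm
  obtain ⟨h2, h3⟩ := hψ.tendsto_toLp hΩ hb h0 hn
  refine tendsto_nhds_unique (h1.inner h2) ((h1.inner h3).congr fun k => ?_)
  have hu := memLp_gradient_potential_univ (hφ.contDiff k) (hφ.hasCompactSupport k)
  have hv := memLp_gradient_potential_univ (hψ.contDiff k) (hψ.hasCompactSupport k)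
  have hw := (hψ.isBoundedField k).memLp 2
  rw [L2.inner_def, L2.inner_def]
  have h := integral_inner_gradient_potential_univ (hφ.contDiff k) (hφ.hasCompactSupport k)
    (hψ.contDiff k) (hψ.hasCompactSupport k)
  refine ((integral_congr_ae ?_).trans (h.symm.trans (integral_congr_ae ?_)))
  · filter_upwards [hu.coeFn_toLp, hw.coeFn_toLp] with x hx hy
    rw [hx, hy]
  · filter_upwards [hu.coeFn_toLp, hv.coeFn_toLp] with x hx hy
    rw [hx, hy]

lemma IsRegularField.norm_gradient_potential_le (hΩ : IsOpen Ω) (hb : Bornology.IsBounded Ω)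
    (h0 : volume (frontier Ω) = 0) (hm : IsRegularField Ω m) :
    ‖(hm.memLp_gradient_potential hΩ hb h0).toLp‖
      ≤ ‖((hm.isBoundedField hΩ hb).memLp 2).toLp‖ := by
  rw [Lp.norm_toLp, Lp.norm_toLp]
  exact ENNReal.toReal_mono ((hm.isBoundedField hΩ hb).memLp 2).eLpNorm_ne_top
    (hm.eLpNorm_gradient_potential_le hΩ hb h0)

/-- The field energy is differentiable along a curve of magnetizations. -/
lemma hasDerivAt_field_energy (hΩ : IsOpen Ω) (hb : Bornology.IsBounded Ω)
    (h0 : volume (frontier Ω) = 0) {I : Set ℝ} (hI : IsOpen I) {M : ℝ → E3 → E3} {t : ℝ}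
    (ht : t ∈ I) (hM : ∀ s ∈ I, IsRegularField Ω (M s)) {M' : E3 → E3}
    (hM' : IsBoundedField (Ω.indicator M')) {C : ℝ}
    (hC : ∀ᶠ s in 𝓝 t, ∀ x ∈ Ω, ‖M s x - M t x - (s - t) • M' x‖ ≤ C * (s - t) ^ 2) :
    HasDerivAt (fun s => ∫ x, ‖gradient (potential Ω (M s)) x‖ ^ 2)
      (2 * ∫ x in Ω, ⟪gradient (potential Ω (M t)) x, M' x⟫) t := by
  classical
  set G : ℝ → Lp E3 2 (volume : Measure E3) := fun s =>
    if h : s ∈ I then ((hM s h).memLp_gradient_potential hΩ hb h0).toLp else 0 with hG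
  set J : ℝ → Lp E3 2 (volume : Measure E3) := fun s =>
    if h : s ∈ I then (((hM s h).isBoundedField hΩ hb).memLp 2).toLp else 0 with hJ
  set J' : Lp E3 2 (volume : Measure E3) := (hM'.memLp 2).toLp with hJ'
  have hGJ : ∀ s ∈ I, ∀ r ∈ I, ⟪G s, G r⟫ = ⟪G s, J r⟫ := fun s hs r hr => by
    simp only [hG, hJ, hs, hr, dif_pos]
    exact (hM s hs).inner_gradient_potential hΩ hb h0 (hM r hr)
  have hlip : ∀ s ∈ I, ‖G s - G t‖ ≤ ‖J s - J t‖ := fun s hs => by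
    have h1 := ((hM s hs).sub (hM t ht)).norm_gradient_potential_le hΩ hb h0
    have h2 : (((hM s hs).sub (hM t ht)).memLp_gradient_potential hΩ hb h0).toLp = G s - G t := by
      simp only [hG, hs, ht, dif_pos]
      rw [← MemLp.toLp_sub]
      refine MemLp.toLp_congr _ _ ?_
      filter_upwards [measure_eq_zero_iff_ae_notMem.1 h0] with x hx
      exact (hM s hs).gradient_potential_sub hΩ hb (hM t ht) hx
    have h3 : ((((hM s hs).sub (hM t ht)).isBoundedField hΩ hb).memLp 2).toLp = J s - J t := by
      simp only [hJ, hs, ht, dif_pos]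
      rw [← MemLp.toLp_sub]
      refine MemLp.toLp_congr _ _ (Eventually.of_forall fun x => ?_)
      simp only [indicator_sub']
    rwa [h2, h3] at h1
  -- The Taylor remainder is quadratic uniformly on `Ω`, which has finite measure, so the curve of
  -- magnetizations is differentiable in `L²`.
  have hJd : HasDerivAt J J' t := by
    have h1 : MemLp (Ω.indicator fun _ => (1 : ℝ)) 2 :=
      memLp_indicator_const _ hΩ.measurableSet 1 (Or.inr hb.measure_lt_top.ne)
    rw [hasDerivAt_iff_isLittleO]
    refine Asymptotics.IsBigO.trans_isLittleO ?_
      (Asymptotics.isLittleO_pow_sub_sub t one_lt_two)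
    refine Asymptotics.IsBigO.of_bound (C * ‖h1.toLp‖) ?_
    filter_upwards [hI.mem_nhds ht, hC] with s hs hsC
    have h2 : J s - J t - (s - t) • J' = ((((hM s hs).isBoundedField hΩ hb).memLp 2).sub
        (((hM t ht).isBoundedField hΩ hb).memLp 2) |>.sub
        ((hM'.memLp 2).const_smul (s - t))).toLp := by
      simp only [hJ, hs, ht, dif_pos]
      rfl
    have h3 : ‖J s - J t - (s - t) • J'‖ ≤ (C * (s - t) ^ 2) * ‖h1.toLp‖ := by
      rw [h2]
      refine Lp.norm_le_mul_norm_of_ae_le_mul ?_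
      filter_upwards [MemLp.coeFn_toLp ((((hM s hs).isBoundedField hΩ hb).memLp 2).sub
        (((hM t ht).isBoundedField hΩ hb).memLp 2) |>.sub
        ((hM'.memLp 2).const_smul (s - t))), h1.coeFn_toLp] with x hx hy
      rw [hx, hy]
      by_cases hxΩ : x ∈ Ω
      · simpa [hxΩ] using hsC x hxΩ
      · simp [hxΩ]
    refine h3.trans_eq ?_
    rw [norm_pow, norm_norm, Real.norm_eq_abs, sq_abs]
    ring
  have hGc : Tendsto G (𝓝 t) (𝓝 (G t)) := by
    rw [tendsto_iff_norm_sub_tendsto_zero]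
    have h1 := tendsto_iff_norm_sub_tendsto_zero.1 hJd.continuousAt.tendsto
    refine tendsto_of_tendsto_of_tendsto_of_le_of_le' tendsto_const_nhds h1
      (Eventually.of_forall fun _ => norm_nonneg _) ?_
    filter_upwards [hI.mem_nhds ht] with s hs using hlip s hs
  have hB : ∀ s ∈ I, ∫ x, ‖gradient (potential Ω (M s)) x‖ ^ 2 = ⟪G s, J s⟫ := fun s hs => by
    rw [← hGJ s hs s hs, L2.inner_def]
    simp only [hG, hs, dif_pos]
    refine integral_congr_ae ?_
    filter_upwards [((hM s hs).memLp_gradient_potential hΩ hb h0).coeFn_toLp] with x hx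
    rw [hx, real_inner_self_eq_norm_sq]
  have hval : 2 * ∫ x in Ω, ⟪gradient (potential Ω (M t)) x, M' x⟫ = ⟪G t + G t, J'⟫ := by
    rw [inner_add_left, ← two_mul, L2.inner_def, ← integral_indicator hΩ.measurableSet]
    congr 1
    simp only [hG, ht, dif_pos]
    refine integral_congr_ae ?_
    filter_upwards [((hM t ht).memLp_gradient_potential hΩ hb h0).coeFn_toLp,
      (hM'.memLp 2).coeFn_toLp] with x hx hy
    rw [hx, hy]
    by_cases hxΩ : x ∈ Ω <;> simp [hxΩ]
  rw [hval, hasDerivAt_iff_tendsto_slope]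
  -- The difference of energies at `s` and `t` is exactly `⟪G s + G t, J s - J t⟫`: the cross terms
  -- `⟪G t, J s⟫` and `⟪G s, J t⟫` cancel, both being `⟪G s, G t⟫`. Hence `G` need only be
  -- continuous.
  have hlim : Tendsto (fun s => ⟪G s + G t, slope J t s⟫) (𝓝[≠] t) (𝓝 ⟪G t + G t, J'⟫) :=
    ((hGc.mono_left nhdsWithin_le_nhds).add tendsto_const_nhds).inner
      (hasDerivAt_iff_tendsto_slope.1 hJd)
  refine hlim.congr' ?_
  filter_upwards [mem_nhdsWithin_of_mem_nhds (hI.mem_nhds ht)] with s hs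
  rw [slope_def_module, slope_def_module, hB s hs, hB t ht, inner_smul_right, smul_eq_mul,
    inner_sub_right, inner_add_left, inner_add_left, ← hGJ t ht s hs, ← hGJ s hs t ht,
    real_inner_comm (G s) (G t)]
  congr 1
  ring

/-! ### Lipschitz domains -/

/-- In the open set `U`, the set `Ω` is the region below the graph of the Lipschitz function `g`
of the coordinates orthogonal to `e`. -/
structure IsLocalGraph (Ω U : Set E3) (e : E3) (g : E3 → ℝ) (K : ℝ≥0) : Prop where
  norm_eq : ‖e‖ = 1
  lipschitz : LipschitzWith K g
  invariant : ∀ (x : E3) (s : ℝ), g (x + s • e) = g x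
  isOpen : IsOpen U
  mem_iff : ∀ x ∈ U, (x ∈ Ω ↔ ⟪e, x⟫ < g x)

lemma HasLipschitzBoundary.exists_isLocalGraph {Ω : Set E3} (h : HasLipschitzBoundary Ω)
    {p : E3} (hp : p ∈ frontier Ω) :
    ∃ U e g K, IsLocalGraph Ω U e g K ∧ p ∈ U ∧ Bornology.IsBounded U := by
  obtain ⟨e, g, K, he, hg, hi, hev⟩ := h p hp
  obtain ⟨U, hU, hUo, hpU⟩ := eventually_nhds_iff.1 hev
  exact ⟨U ∩ Metric.ball p 1, e, g, K, ⟨he, hg, hi, hUo.inter Metric.isOpen_ball,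
    fun x hx => hU x hx.1⟩, ⟨hpU, Metric.mem_ball_self one_pos⟩,
    Metric.isBounded_ball.subset inter_subset_right⟩

namespace IsLocalGraph

variable {Ω U : Set E3} {e : E3} {g : E3 → ℝ} {K : ℝ≥0}

lemma inner_self_eq (h : IsLocalGraph Ω U e g K) : ⟪e, e⟫ = 1 := by
  rw [real_inner_self_eq_norm_sq, h.norm_eq, one_pow]

/-- A strict inequality either way persists near `x` and would keep a neighbourhood inside `Ω` or
inside its complement. -/
lemma inner_eq_of_mem_frontier (h : IsLocalGraph Ω U e g K) {x : E3} (hx : x ∈ U)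
    (hxf : x ∈ frontier Ω) : ⟪e, x⟫ = g x := by
  have hgc := h.lipschitz.continuous
  have hic : Continuous fun y : E3 => ⟪e, y⟫ := by fun_prop
  have hev : ∀ᶠ y in 𝓝 x, y ∈ U := h.isOpen.mem_nhds hx
  rw [frontier_eq_closure_inter_closure] at hxf
  apply le_antisymm
  · by_contra! hlt
    have h1 : ∀ᶠ y in 𝓝 x, g y < ⟪e, y⟫ := hgc.continuousAt.eventually_lt hic.continuousAt hlt
    obtain ⟨y, hy, hy1, hy2⟩ :=
      ((mem_closure_iff_frequently.1 hxf.1).and_eventually (h1.and hev)).exists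
    exact absurd ((h.mem_iff y hy2).1 hy) (not_lt.2 hy1.le)
  · by_contra! hlt
    have h1 : ∀ᶠ y in 𝓝 x, ⟪e, y⟫ < g y := hic.continuousAt.eventually_lt hgc.continuousAt hlt
    obtain ⟨y, hy, hy1, hy2⟩ :=
      ((mem_closure_iff_frequently.1 hxf.2).and_eventually (h1.and hev)).exists
    exact hy ((h.mem_iff y hy2).2 hy1)

/-- Every line parallel to `e` meets the graph in a single point, because `g` is constant along `e`;
Fubini does the rest. -/
lemma measure_graph (h : IsLocalGraph Ω U e g K) : volume {x : E3 | ⟪e, x⟫ = g x} = 0 := by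
  have hs : MeasurableSet {x : E3 | ⟪e, x⟫ = g x}ᶜ :=
    (isClosed_eq (by fun_prop) h.lipschitz.continuous).measurableSet.compl
  rw [measure_eq_zero_iff_ae_notMem]
  refine ae_mem_of_ae_add_linearMap_mem (LinearMap.toSpanSingleton ℝ E3 e) volume volume hs
    fun y => ?_
  have : ∀ᵐ s : ℝ, s ≠ g y - ⟪e, y⟫ := by simp [ae_iff]
  filter_upwards [this] with s hs hc
  refine hs ?_
  simp only [LinearMap.toSpanSingleton_apply, h.invariant, inner_add_right,
    inner_smul_right, h.inner_self_eq] at hc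
  linarith

lemma fderiv_add_smul (h : IsLocalGraph Ω U e g K) (x : E3) (s : ℝ) :
    fderiv ℝ g (x + s • e) = fderiv ℝ g x := by
  have : (fun y => g (y + s • e)) = g := funext fun y => h.invariant y s
  rw [← fderiv_comp_add_right, this]

lemma fderiv_apply_self (h : IsLocalGraph Ω U e g K) {x : E3} (hx : DifferentiableAt ℝ g x) :
    fderiv ℝ g x e = 0 := by
  have h1 := hx.hasFDerivAt.hasLineDerivAt e
  have h2 : HasLineDerivAt ℝ g 0 x e := by
    unfold HasLineDerivAt
    simp_rw [h.invariant]
    exact hasDerivAt_const _ _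
  exact h1.unique h2

lemma differentiableAt_add_smul (h : IsLocalGraph Ω U e g K) {x : E3} (s : ℝ)
    (hx : DifferentiableAt ℝ g x) : DifferentiableAt ℝ g (x + s • e) := by
  have h1 : g = (fun y => g (y + (-s) • e)) := funext fun y => (h.invariant y (-s)).symm
  rw [h1]
  refine DifferentiableAt.comp (f := fun y => y + (-s) • e) (x + s • e) ?_ (by fun_prop)
  simpa using hx

/-- The outward normal at a boundary point at which the graph has a tangent plane. -/
lemma isOutwardUnitNormal (h : IsLocalGraph Ω U e g K) {p : E3} (hpU : p ∈ U)
    (hp : ⟪e, p⟫ = g p) (hd : DifferentiableAt ℝ g p) :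
    IsOutwardUnitNormal Ω p (‖e - gradient g p‖⁻¹ • (e - gradient g p)) ∧ e - gradient g p ≠ 0 := by
  -- This is the gradient of the defining function `⟪e, x⟫ - g x`. It is nonzero because its
  -- component along `e` is one.
  set n := e - gradient g p with hn
  have hen : ⟪e, n⟫ = 1 := by
    rw [hn, inner_sub_right, h.inner_self_eq, real_inner_comm, inner_gradient_left,
      h.fderiv_apply_self hd, sub_zero]
  have hn0 : n ≠ 0 := by
    intro h0
    rw [h0, inner_zero_right] at hen
    exact zero_ne_one hen
  have hnpos : 0 < ‖n‖ := norm_pos_iff.2 hn0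
  refine ⟨⟨?_, fun ε hε => ?_⟩, hn0⟩
  · rw [norm_smul, norm_inv, norm_norm, inv_mul_cancel₀ hnpos.ne']
  · have hlit := hd.hasFDerivAt.isLittleO.def (mul_pos hε hnpos)
    filter_upwards [hlit, h.isOpen.mem_nhds hpU] with x hx hxU
    have h1 : ⟪x - p, ‖n‖⁻¹ • n⟫ = ‖n‖⁻¹ * (⟪e, x - p⟫ - fderiv ℝ g p (x - p)) := by
      rw [inner_smul_right, hn, inner_sub_right, real_inner_comm e, real_inner_comm (gradient g p),
        inner_gradient_left]
    have h2 : ⟪e, x⟫ - g x = (⟪e, x - p⟫ - fderiv ℝ g p (x - p))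
        - (g x - g p - fderiv ℝ g p (x - p)) := by
      rw [inner_sub_right, hp]; ring
    rw [Real.norm_eq_abs, abs_le] at hx
    rw [h.mem_iff x hxU, h1]
    set a := ⟪e, x - p⟫ - fderiv ℝ g p (x - p)
    constructor
    · intro hlt
      have : a < -(ε * ‖x - p‖) * ‖n‖ := by
        rw [← inv_mul_lt_iff₀' hnpos]; linarith
      nlinarith
    · intro hlt
      have : (ε * ‖x - p‖) * ‖n‖ < a := by
        rwa [← lt_inv_mul_iff₀' hnpos]
      rw [not_lt]
      nlinarith

/-- Below a `K`-Lipschitz graph lies a truncated open convex cone with vertex `p`, axis `-e` and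
slope `K`. Uniqueness makes derivatives within the closure of `Ω` meaningful at boundary points. -/
lemma uniqueDiffWithinAt (h : IsLocalGraph Ω U e g K) {p : E3} (hpU : p ∈ U) (hp : ⟪e, p⟫ = g p) :
    UniqueDiffWithinAt ℝ Ω p := by
  obtain ⟨r, hr, hrU⟩ := Metric.isOpen_iff.1 h.isOpen p hpU
  set c : E3 → ℝ := fun x => ⟪e, x - p⟫ + K * ‖(x - p) - ⟪e, x - p⟫ • e‖ with hc
  set S := {x | c x < 0} ∩ Metric.ball p r with hS
  have hcc : Continuous c := by fun_prop
  have hSo : IsOpen S := (isOpen_lt hcc continuous_const).inter Metric.isOpen_ball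
  have hSΩ : S ⊆ Ω := by
    rintro x ⟨hx1, hx2⟩
    rw [h.mem_iff x (hrU hx2)]
    have h1 : g (p + ((x - p) - ⟪e, x - p⟫ • e)) = g x := by
      have := h.invariant x (-⟪e, x - p⟫)
      rw [← this]
      congr 1
      module
    have h2 := h.lipschitz.dist_le_mul (p + ((x - p) - ⟪e, x - p⟫ • e)) p
    rw [h1, dist_eq_norm, dist_eq_norm, add_sub_cancel_left, Real.norm_eq_abs, abs_le] at h2
    have h3 : c x < 0 := hx1
    have h4 : ⟪e, x⟫ = ⟪e, x - p⟫ + g p := by rw [← hp, inner_sub_right]; ring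
    simp only [hc] at h3
    linarith [h2.1]
  have hconv : Convex ℝ S := by
    refine Convex.inter ?_ (convex_ball p r)
    have h1 : ConvexOn ℝ univ c := by
      have hl : ConvexOn ℝ univ (fun x : E3 => ⟪e, x - p⟫) := by
        refine ⟨convex_univ, fun x _ y _ a b _ _ hab => le_of_eq ?_⟩
        have : a • x + b • y - p = a • (x - p) + b • (y - p) := by
          rw [smul_sub, smul_sub]
          have : p = a • p + b • p := by rw [← add_smul, hab, one_smul]
          nth_rewrite 1 [this]
          abel
        simp only [this, inner_add_right, inner_smul_right, smul_eq_mul]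
      refine hl.add (ConvexOn.smul K.2 ⟨convex_univ, fun x _ y _ a b ha hb hab => ?_⟩)
      have : a • x + b • y - p - ⟪e, a • x + b • y - p⟫ • e
          = a • (x - p - ⟪e, x - p⟫ • e) + b • (y - p - ⟪e, y - p⟫ • e) := by
        have h2 : a • x + b • y - p = a • (x - p) + b • (y - p) := by
          rw [smul_sub, smul_sub]
          have : p = a • p + b • p := by rw [← add_smul, hab, one_smul]
          nth_rewrite 1 [this]
          abel
        rw [h2, inner_add_right, inner_smul_right, inner_smul_right]
        module
      dsimp only
      rw [this]
      refine (norm_add_le _ _).trans_eq ?_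
      rw [norm_smul, norm_smul, Real.norm_of_nonneg ha, Real.norm_of_nonneg hb]
      rfl
    simpa using h1.convex_lt 0
  have hmem : ∀ t : ℝ, 0 < t → t < r → p + (-t) • e ∈ S := by
    intro t ht htr
    constructor
    · simp only [hc, mem_ofPred_eq, add_sub_cancel_left, inner_smul_right, h.inner_self_eq, mul_one,
        sub_self, norm_zero, mul_zero, add_zero]
      linarith
    · rw [Metric.mem_ball, dist_eq_norm, add_sub_cancel_left, norm_smul, h.norm_eq, mul_one,
        norm_neg, Real.norm_of_nonneg ht.le]
      exact htr
  have hcl : p ∈ closure S := by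
    refine mem_closure_of_tendsto (b := 𝓝[>] (0 : ℝ)) (f := fun t : ℝ => p + (-t) • e) ?_ ?_
    · have : Continuous fun t : ℝ => p + (-t) • e := by fun_prop
      have h1 := (this.tendsto 0).mono_left (nhdsWithin_le_nhds (s := Ioi 0))
      simpa using h1
    · filter_upwards [Ioo_mem_nhdsGT hr] with t ht using hmem t ht.1 ht.2
  refine UniqueDiffWithinAt.mono (uniqueDiffWithinAt_convex hconv ?_ hcl) hSΩ
  rw [hSo.interior_eq]
  exact ⟨_, hmem (r / 2) (by linarith) (by linarith)⟩

end IsLocalGraph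

lemma HasLipschitzBoundary.measure_frontier {Ω : Set E3} (h : HasLipschitzBoundary Ω) :
    volume (frontier Ω) = 0 := by
  refine measure_null_of_locally_null _ fun p hp => ?_
  obtain ⟨U, e, g, K, hg, hpU, -⟩ := h.exists_isLocalGraph hp
  refine ⟨frontier Ω ∩ U, inter_mem_nhdsWithin _ (hg.isOpen.mem_nhds hpU), ?_⟩
  exact measure_mono_null (fun x hx => hg.inner_eq_of_mem_frontier hx.2 hx.1) hg.measure_graph

lemma HasLipschitzBoundary.uniqueDiffOn_closure {Ω : Set E3} (hΩ : IsOpen Ω)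
    (h : HasLipschitzBoundary Ω) : UniqueDiffOn ℝ (closure Ω) := by
  intro p hp
  by_cases hpΩ : p ∈ Ω
  · exact (hΩ.uniqueDiffWithinAt hpΩ).mono subset_closure
  · have hpf : p ∈ frontier Ω := by rw [hΩ.frontier_eq]; exact ⟨hp, hpΩ⟩
    obtain ⟨U, e, g, K, hg, hpU, -⟩ := h.exists_isLocalGraph hpf
    exact (hg.uniqueDiffWithinAt hpU (hg.inner_eq_of_mem_frontier hpU hpf)).mono subset_closure

/-! ### Integration along lines -/

/-- Any linear isomorphism taking `e` to `(0, 1)` serves: it carries volume to a Haar measure, hence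
to a multiple of volume. The factor is left unspecified, since the limit computed with it is zero.
-/
lemma exists_coordinates {e : E3} (he : e ≠ 0) :
    ∃ (L : E3 ≃L[ℝ] ((Fin 2 → ℝ) × ℝ)) (c : ℝ), L e = (0, 1) ∧
      (∀ f : E3 → ℝ, ∫ x, f x = c * ∫ q, f (L.symm q)) ∧
      (∀ f : E3 → ℝ, Integrable f → Integrable fun q => f (L.symm q)) ∧
      ∀ P : E3 → Prop, (∀ᵐ x, P x) → ∀ᵐ q, P (L.symm q) := by
  obtain ⟨L, hL⟩ : ∃ L : E3 ≃L[ℝ] ((Fin 2 → ℝ) × ℝ), L e = (0, 1) := by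
    have : Module.finrank ℝ ((Fin 2 → ℝ) × ℝ) = Module.finrank ℝ E3 := by simp
    have L₀ : E3 ≃L[ℝ] ((Fin 2 → ℝ) × ℝ) := (ContinuousLinearEquiv.ofFinrankEq this).symm
    obtain ⟨M, hM⟩ : ∃ M : ((Fin 2 → ℝ) × ℝ) ≃L[ℝ] ((Fin 2 → ℝ) × ℝ), M (L₀ e) = (0, 1) := by
      apply SeparatingDual.exists_continuousLinearEquiv_apply_eq
      · simpa using he
      · simp
    exact ⟨L₀.trans M, by simp [hM]⟩
  set ν : Measure ((Fin 2 → ℝ) × ℝ) := Measure.map L volume with hν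
  have hνh : ν.IsAddHaarMeasure := L.isAddHaarMeasure_map volume
  have hvh : (volume : Measure ((Fin 2 → ℝ) × ℝ)).IsAddHaarMeasure :=
    inferInstanceAs (((volume : Measure (Fin 2 → ℝ)).prod (volume : Measure ℝ)).IsAddHaarMeasure)
  obtain ⟨c, h1⟩ : ∃ c : ℝ≥0, ν = c • (volume : Measure ((Fin 2 → ℝ) × ℝ)) :=
    ⟨_, Measure.isAddLeftInvariant_eq_smul _ _⟩
  obtain ⟨c', h2⟩ : ∃ c : ℝ≥0, (volume : Measure ((Fin 2 → ℝ) × ℝ)) = c • ν :=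
    ⟨_, Measure.isAddLeftInvariant_eq_smul _ _⟩
  have hemb : MeasurableEmbedding L := L.toHomeomorph.measurableEmbedding
  refine ⟨L, c, hL, fun f => ?_, fun f hf => ?_, fun P hP => ?_⟩
  · have h3 : ∫ x, f x = ∫ q, f (L.symm q) ∂ν := by
      rw [hν, hemb.integral_map]
      simp
    rw [h3, h1, integral_smul_nnreal_measure]
    rfl
  · have h3 : Integrable (fun q => f (L.symm q)) ν := by
      rw [hν, hemb.integrable_map_iff]
      simpa [Function.comp_def] using hf
    rw [h2]
    exact h3.smul_measure_nnreal
  · have h3 : ∀ᵐ q ∂ν, P (L.symm q) := by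
      rw [hν, hemb.ae_map_iff]
      simpa using hP
    rw [h2]
    exact Measure.ae_smul_measure h3 _

/-- Averages over thin strips below a Lipschitz graph converge to zero when the integrand has zero
trace on the graph. -/
lemma IsLocalGraph.tendsto_integral_strip {Ω U : Set E3} {e : E3} {g : E3 → ℝ} {K : ℝ≥0}
    (h : IsLocalGraph Ω U e g K) {κ : ℝ → ℝ} (hκ : Continuous κ)
    (hκs : ∀ r, r ∉ Icc (1 : ℝ) 2 → κ r = 0) {H : E3 → ℝ} (hm : Measurable H) {C R : ℝ}
    (hC : ∀ x, |H x| ≤ C) (hR : ∀ x, H x ≠ 0 → ‖x‖ ≤ R)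
    (hl : ∀ᵐ x, Tendsto (fun δ : ℝ => H (x + (g x - ⟪e, x⟫ - δ) • e)) (𝓝[>] 0) (𝓝 0)) :
    Tendsto (fun ε : ℝ => ∫ x, ε⁻¹ * κ ((g x - ⟪e, x⟫) / ε) * H x) (𝓝[>] 0) (𝓝 0) := by
  have he : e ≠ 0 := norm_ne_zero_iff.1 (by rw [h.norm_eq]; exact one_ne_zero)
  obtain ⟨L, c, hL, hint, hintb, hae⟩ := exists_coordinates he
  have hgc := h.lipschitz.continuous
  obtain ⟨B, hB⟩ : ∃ B, ∀ r, |κ r| ≤ B := by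
    obtain ⟨B, hB⟩ := (isCompact_Icc (a := (1 : ℝ)) (b := 2)).exists_bound_of_continuousOn
      hκ.continuousOn
    refine ⟨max B 0, fun r => ?_⟩
    by_cases hr : r ∈ Icc (1 : ℝ) 2
    · exact (hB r hr).trans (le_max_left _ _)
    · rw [hκs r hr, abs_zero]; exact le_max_right _ _
  have hB0 : 0 ≤ B := (abs_nonneg _).trans (hB 0)
  have hC0 : 0 ≤ C := (abs_nonneg _).trans (hC 0)
  set a : (Fin 2 → ℝ) → E3 := fun y => L.symm (y, 0) with ha
  set ρ : E3 → ℝ := fun x => g x - ⟪e, x⟫ with hρ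
  have hLs : ∀ y s, L.symm (y, s) = a y + s • e := by
    intro y s
    rw [ha, L.symm_apply_eq, map_add, map_smul, L.apply_symm_apply, hL]
    simp
  have hρs : ∀ x s, ρ (x + s • e) = ρ x - s := by
    intro x s
    simp only [hρ, h.invariant, inner_add_right, inner_smul_right, h.inner_self_eq]
    ring
  have hac : Continuous a := by fun_prop
  have hρc : Continuous ρ := hgc.sub (by fun_prop)
  -- The integrand after rescaling the depth below the graph to `ε * r`. The factor `ε⁻¹` is
  -- absorbed, and the support lies in a compact set independent of `ε`, so dominated convergence
  -- applies.
  set Φ : ℝ → (Fin 2 → ℝ) × ℝ → ℝ :=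
    fun ε q => κ q.2 * H (a q.1 + (ρ (a q.1) - ε * q.2) • e) with hΦ
  set S : Set ((Fin 2 → ℝ) × ℝ) :=
    Metric.closedBall 0 (‖(L : E3 →L[ℝ] ((Fin 2 → ℝ) × ℝ))‖ * R) ×ˢ Icc (1 : ℝ) 2 with hS
  have hSc : IsCompact S := (isCompact_closedBall _ _).prod isCompact_Icc
  have hΦm : ∀ ε, Measurable (Φ ε) := by
    intro ε
    have h1 : Continuous fun q : (Fin 2 → ℝ) × ℝ => a q.1 + (ρ (a q.1) - ε * q.2) • e := by
      fun_prop
    exact (hκ.measurable.comp measurable_snd).mul (hm.comp h1.measurable)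
  have hΦb : ∀ ε q, ‖Φ ε q‖ ≤ S.indicator (fun _ => B * C) q := by
    intro ε q
    by_cases hq : q ∈ S
    · rw [indicator_of_mem hq, norm_mul]
      exact mul_le_mul (hB _) (hC _) (norm_nonneg _) hB0
    · rw [indicator_of_notMem hq, norm_le_zero_iff]
      by_contra hne
      have h1 := left_ne_zero_of_mul hne
      have h2 := hR _ (right_ne_zero_of_mul hne)
      refine hq ⟨?_, not_imp_comm.1 (hκs q.2) h1⟩
      rw [mem_closedBall_zero_iff]
      set z := a q.1 + (ρ (a q.1) - ε * q.2) • e with hz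
      have h3 : L z = (q.1, ρ (a q.1) - ε * q.2) := by
        rw [hz, ← hLs, L.apply_symm_apply]
      calc ‖q.1‖ = ‖(L z).1‖ := by rw [h3]
        _ ≤ ‖L z‖ := norm_fst_le _
        _ ≤ ‖(L : E3 →L[ℝ] ((Fin 2 → ℝ) × ℝ))‖ * ‖z‖ :=
          (L : E3 →L[ℝ] ((Fin 2 → ℝ) × ℝ)).le_opNorm z
        _ ≤ _ := by gcongr
  have hSi : Integrable (S.indicator fun _ => B * C) := by
    rw [integrable_indicator_iff hSc.isClosed.measurableSet]
    exact integrableOn_const hSc.measure_lt_top.ne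
  have hΦi : ∀ ε, Integrable (Φ ε) := fun ε =>
    hSi.mono' (hΦm ε).aestronglyMeasurable (ae_of_all _ (hΦb ε))
  have hlim : Tendsto (fun ε => ∫ q, Φ ε q) (𝓝[>] 0) (𝓝 0) := by
    have h0 : 𝓝 (0 : ℝ) = 𝓝 (∫ _ : (Fin 2 → ℝ) × ℝ, (0 : ℝ)) := by simp
    rw [h0]
    refine tendsto_integral_filter_of_dominated_convergence _
      (Eventually.of_forall fun ε => (hΦm ε).aestronglyMeasurable)
      (Eventually.of_forall fun ε => ae_of_all _ (hΦb ε)) hSi ?_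
    filter_upwards [hae _ hl] with q hq
    by_cases hq2 : q.2 ∈ Icc (1 : ℝ) 2
    · have hq20 : 0 < q.2 := by linarith [hq2.1]
      have h1 : Tendsto (fun ε : ℝ => ε * q.2) (𝓝[>] 0) (𝓝[>] 0) := by
        refine tendsto_nhdsWithin_iff.2 ⟨?_, ?_⟩
        · have : Continuous fun ε : ℝ => ε * q.2 := by fun_prop
          have h2 := (this.tendsto 0).mono_left (nhdsWithin_le_nhds (s := Ioi 0))
          rwa [zero_mul] at h2
        · filter_upwards [self_mem_nhdsWithin] with ε hε using mul_pos hε hq20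
      have h2 := (hq.comp h1).const_mul (κ q.2)
      rw [mul_zero] at h2
      refine h2.congr fun ε => ?_
      have h3 : L.symm q + (ρ (L.symm q) - ε * q.2) • e
          = a q.1 + (ρ (a q.1) - ε * q.2) • e := by
        rw [← Prod.mk.eta (p := q), hLs, hρs]
        module
      simp only [hΦ, ← h3]
      rfl
    · simp only [hΦ, hκs _ hq2, zero_mul]
      exact tendsto_const_nhds
  have hlim2 := hlim.const_mul c
  rw [mul_zero] at hlim2
  refine hlim2.congr' ?_
  filter_upwards [self_mem_nhdsWithin] with ε hε
  have hε0 : (0 : ℝ) < ε := hε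
  rw [hint]
  congr 1
  have hfi : Integrable fun x => ε⁻¹ * κ (ρ x / ε) * H x := by
    have h1 : Integrable ((Metric.closedBall (0 : E3) R).indicator fun _ => ε⁻¹ * B * C) := by
      rw [integrable_indicator_iff Metric.isClosed_closedBall.measurableSet]
      exact integrableOn_const (isCompact_closedBall _ _).measure_lt_top.ne
    refine h1.mono' ?_ (ae_of_all _ fun x => ?_)
    · have h2 : Continuous fun x => ε⁻¹ * κ (ρ x / ε) := by fun_prop
      exact (h2.measurable.mul hm).aestronglyMeasurable
    · by_cases hx : H x = 0
      · rw [hx, mul_zero, norm_zero]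
        exact indicator_nonneg (fun _ _ => by positivity) _
      · rw [indicator_of_mem (mem_closedBall_zero_iff.2 (hR x hx)), norm_mul, norm_mul, norm_inv,
          Real.norm_of_nonneg hε0.le]
        have := hB (ρ x / ε)
        have := hC x
        simp only [Real.norm_eq_abs]
        gcongr
  have e1 : ∫ q, Φ ε q = ∫ y, ∫ r, Φ ε (y, r) := integral_prod _ (hΦi ε)
  have e2 : ∫ q, ε⁻¹ * κ (ρ (L.symm q) / ε) * H (L.symm q)
      = ∫ y, ∫ s, ε⁻¹ * κ (ρ (L.symm (y, s)) / ε) * H (L.symm (y, s)) :=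
    integral_prod _ (hintb _ hfi)
  rw [e1]
  refine Eq.trans ?_ e2.symm
  congr 1 with y
  simp only [hLs, hρs, mul_assoc, hΦ]
  rw [integral_const_mul]
  set F : ℝ → ℝ := fun s => κ ((ρ (a y) - s) / ε) * H (a y + s • e) with hF
  have h1 : ∀ r, κ r * H (a y + (ρ (a y) - ε * r) • e) = F (ρ (a y) - ε * r) := by
    intro r
    simp only [hF]
    congr 2
    field_simp
    ring
  simp_rw [h1]
  -- The substitution `s = ρ (a y) - ε r` on each vertical line.
  rw [Measure.integral_comp_mul_left (fun u => F (ρ (a y) - u)) ε,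
    integral_sub_left_eq_self F volume (ρ (a y)), abs_of_pos (inv_pos.2 hε0), smul_eq_mul]

/-! ### The divergence theorem -/

lemma divergence_smul {ζ : E3 → ℝ} {F : E3 → E3} {x : E3} (hζ : DifferentiableAt ℝ ζ x)
    (hF : DifferentiableAt ℝ F x) : divergence (fun x => ζ x • F x) x
      = ζ x * divergence F x + fderiv ℝ ζ x (F x) := by
  have h : fderiv ℝ (fun x => ζ x • F x) x = _ := fderiv_fun_smul hζ hF
  have h2 : fderiv ℝ ζ x (F x) = ∑ i, fderiv ℝ ζ x (basisVec i) * F x i := by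
    conv_lhs => rw [eq_sum_basisVec (F x), map_sum]
    simp [mul_comm]
  rw [h2, divergence, divergence, h, Finset.mul_sum, ← Finset.sum_add_distrib]
  rfl

lemma divergence_congr {F G : E3 → E3} {x : E3} (h : F =ᶠ[𝓝 x] G) :
    divergence F x = divergence G x := by
  simp only [divergence, h.fderiv_eq]

lemma divergence_zero_of_eventually {F : E3 → E3} {x : E3} (h : ∀ᶠ y in 𝓝 x, F y = 0) :
    divergence F x = 0 := by
  have h1 : F =ᶠ[𝓝 x] fun _ => 0 := h
  rw [divergence_congr h1]
  simp [divergence]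

lemma integral_divergence_of_hasCompactSupport {V : E3 → E3} (hV : ContDiff ℝ 1 V)
    (hc : HasCompactSupport V) : ∫ x, divergence V x = 0 := by
  unfold divergence
  have h : ∀ i, Continuous fun x => fderiv ℝ (fun y => V y i) x (basisVec i) := fun i =>
    ((contDiff_coord hV i).continuous_fderiv (by simp)).clm_apply continuous_const
  have hi := fun i => (hasCompactSupport_coord hc i)
  simp_rw [← fun x i => fderiv_coord (hV.differentiable (by simp) x) i (basisVec i)]
  rw [integral_finsetSum _ fun i _ =>
    (h i).integrable_of_hasCompactSupport ((hi i).fderiv_apply ℝ _)]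
  refine Finset.sum_eq_zero fun i _ => ?_
  have := integral_mul_fderiv_eq_neg_fderiv_mul_of_integrable (μ := (volume : Measure E3))
    (f := fun _ => (1 : ℝ)) (g := fun x => V x i) (v := basisVec i)
    (by simp)
    (by simpa using (h i).integrable_of_hasCompactSupport ((hi i).fderiv_apply ℝ _))
    (by simpa using (contDiff_coord hV i).continuous.integrable_of_hasCompactSupport (hi i))
    (fun x _ => differentiableAt_const _)
    (fun x _ => (contDiff_coord hV i).differentiable (by simp) x)
  simpa using this

/-- A smooth step function: it vanishes below `1` and equals one above `2`. -/
def step (s : ℝ) : ℝ := Real.smoothTransition (s - 1)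

lemma contDiff_step : ContDiff ℝ 1 step :=
  Real.smoothTransition.contDiff.comp (contDiff_id.sub contDiff_const)

lemma step_of_le {s : ℝ} (h : s ≤ 1) : step s = 0 :=
  Real.smoothTransition.zero_of_nonpos (by linarith)

lemma step_of_ge {s : ℝ} (h : 2 ≤ s) : step s = 1 :=
  Real.smoothTransition.one_of_one_le (by linarith)

lemma abs_step_le (s : ℝ) : |step s| ≤ 1 := by
  rw [step, abs_of_nonneg (Real.smoothTransition.nonneg _)]
  exact Real.smoothTransition.le_one _

lemma continuous_deriv_step : Continuous (deriv step) := contDiff_step.continuous_deriv le_rfl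

lemma deriv_step_of_notMem {s : ℝ} (h : s ∉ Icc (1 : ℝ) 2) : deriv step s = 0 := by
  rw [mem_Icc, not_and_or, not_le, not_le] at h
  rcases h with h | h
  · have : step =ᶠ[𝓝 s] fun _ => 0 := by
      filter_upwards [Iio_mem_nhds h] with y hy using step_of_le hy.le
    rw [this.deriv_eq, deriv_const]
  · have : step =ᶠ[𝓝 s] fun _ => 1 := by
      filter_upwards [Ioi_mem_nhds h] with y hy using step_of_ge hy.le
    rw [this.deriv_eq, deriv_const]

lemma exists_lipschitzWith_step : ∃ B, LipschitzWith B step := by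
  obtain ⟨B, hB⟩ := (isCompact_Icc (a := (1 : ℝ)) (b := 2)).exists_bound_of_continuousOn
    continuous_deriv_step.continuousOn
  refine ⟨(max B 0).toNNReal, lipschitzWith_of_nnnorm_deriv_le
    (contDiff_step.differentiable (by simp)) fun s => ?_⟩
  rw [← NNReal.coe_le_coe, coe_nnnorm, Real.coe_toNNReal _ (le_max_right _ _)]
  by_cases hs : s ∈ Icc (1 : ℝ) 2
  · exact (hB s hs).trans (le_max_left _ _)
  · rw [deriv_step_of_notMem hs, norm_zero]; exact le_max_right _ _

/-- A smooth cutoff function of a compact subset of an open set. -/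
lemma exists_cutoff_of_isCompact {S Ω : Set E3} (hS : IsCompact S) (hΩ : IsOpen Ω) (h : S ⊆ Ω) :
    ∃ η : E3 → ℝ, ContDiff ℝ 1 η ∧ HasCompactSupport η ∧ tsupport η ⊆ Ω ∧
      ∀ x ∈ S, ∀ᶠ y in 𝓝 x, η y = 1 := by
  obtain ⟨T, hT, hST, hTΩ⟩ := exists_compact_between hS hΩ h
  obtain ⟨f, h1, h0, -⟩ := exists_contMDiffMap_one_nhds_of_subset_interior
    (modelWithCornersSelf ℝ E3) (n := 1) hS.isClosed hST
  have hts : tsupport f ⊆ T := closure_minimal (fun x hx => by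
    by_contra hc
    exact hx (h0 x hc)) hT.isClosed
  refine ⟨f, f.contMDiff.contDiff, hT.of_isClosed_subset (isClosed_tsupport _) hts,
    hts.trans hTΩ, fun x hx => ?_⟩
  exact (eventually_nhdsSet_iff_forall.1 h1) x hx

section

variable {Ω U : Set E3} {e : E3} {g : E3 → ℝ} {K : ℝ≥0} {F : E3 → E3} {ζ : E3 → ℝ}

/-- Integration by parts against a cutoff function that vanishes near a Lipschitz graph. -/
lemma IsLocalGraph.integral_step_mul_divergence (h : IsLocalGraph Ω U e g K) (hΩ : IsOpen Ω)
    (hF : ContDiffOn ℝ 1 F Ω) (hζ : ContDiff ℝ 1 ζ) (hζc : HasCompactSupport ζ)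
    (hζU : tsupport ζ ⊆ U) {ε : ℝ} (hε : 0 < ε) :
    ∫ x in Ω, step ((g x - ⟪e, x⟫) / ε) * divergence (fun x => ζ x • F x) x
      = -∫ x, ε⁻¹ * deriv step ((g x - ⟪e, x⟫) / ε)
          * (fderiv ℝ g x (ζ x • Ω.indicator F x) - ⟪e, ζ x • Ω.indicator F x⟫) := by
  have hgc := h.lipschitz.continuous
  have hρc : Continuous fun x => g x - ⟪e, x⟫ := hgc.sub (by fun_prop)
  -- The cutoff and `ζ` are both nonzero only on this compact subset of `Ω`. Multiplying by `η`
  -- therefore replaces `ζ F` by a globally `C¹` field without changing the integrals.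
  set S : Set E3 := tsupport ζ ∩ {x | ε ≤ g x - ⟪e, x⟫} with hS
  have hSc : IsCompact S := hζc.isCompact.inter_right (isClosed_le continuous_const hρc)
  have hSΩ : S ⊆ Ω := fun x hx => (h.mem_iff x (hζU hx.1)).2 (by
    have : ε ≤ g x - ⟪e, x⟫ := hx.2
    linarith)
  obtain ⟨η, hη, hηc, hηΩ, hη1⟩ := exists_cutoff_of_isCompact hSc hΩ hSΩ
  set V : E3 → E3 := fun x => η x • (ζ x • F x) with hV
  have hV1 : ContDiff ℝ 1 V :=
    contDiff_smul_of_tsupport_subset hΩ hη hηΩ (hζ.contDiffOn.smul hF)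
  have hVc : HasCompactSupport V := hηc.smul_right
  set χ : E3 → ℝ := fun x => step ((g x - ⟪e, x⟫) / ε) with hχ
  obtain ⟨D, hD⟩ : ∃ D, LipschitzWith D χ := by
    obtain ⟨B, hB⟩ := exists_lipschitzWith_step
    have h1 : LipschitzWith (K + ‖innerSL ℝ e‖₊) fun x => g x - ⟪e, x⟫ :=
      h.lipschitz.sub (innerSL ℝ e).lipschitz
    have h2 : LipschitzWith ‖ε⁻¹‖₊ fun s : ℝ => s / ε := by
      refine LipschitzWith.of_dist_le_mul fun s r => le_of_eq ?_
      rw [dist_eq_norm, dist_eq_norm, coe_nnnorm, ← norm_mul]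
      congr 1
      field_simp
    exact ⟨_, hB.comp (h2.comp h1)⟩
  have hVi := fun i => contDiff_coord hV1 i
  have hVic := fun i => hasCompactSupport_coord hVc i
  -- The cutoff `χ` is no better than Lipschitz, since `g` is; hence the version of integration by
  -- parts for Lipschitz functions with line derivatives.
  have hparts : ∀ i, ∫ x, lineDeriv ℝ χ x (basisVec i) * V x i
      = -∫ x, fderiv ℝ V x (basisVec i) i * χ x := by
    intro i
    obtain ⟨D', hD'⟩ := (hVi i).lipschitzWith_of_hasCompactSupport (hVic i) (by simp)
    rw [hD.integral_lineDeriv_mul_eq hD' (hVic i), ← integral_neg]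
    congr 1 with x
    rw [((hVi i).differentiable (by simp) x).lineDeriv_eq_fderiv, map_neg,
      fderiv_coord (hV1.differentiable (by simp) x), neg_mul]
  have hsum := Finset.sum_congr (rfl : (Finset.univ : Finset (Fin 3)) = Finset.univ)
    fun i _ => hparts i
  have hdc : ∀ i, Continuous fun x => fderiv ℝ V x (basisVec i) i := fun i => by
    simp_rw [← fun x => fderiv_coord (hV1.differentiable (by simp) x) i (basisVec i)]
    exact ((hVi i).continuous_fderiv (by simp)).clm_apply continuous_const
  have hdcs : ∀ i, HasCompactSupport fun x => fderiv ℝ V x (basisVec i) i := fun i => by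
    simp_rw [← fun x => fderiv_coord (hV1.differentiable (by simp) x) i (basisVec i)]
    exact (hVic i).fderiv_apply ℝ _
  have hi1 : ∀ i, Integrable fun x => lineDeriv ℝ χ x (basisVec i) * V x i := fun i =>
    (hD.locallyIntegrable_lineDeriv (basisVec i)).integrable_smul_right_of_hasCompactSupport
      (hVi i).continuous (hVic i)
  have hi2 : ∀ i, Integrable fun x => fderiv ℝ V x (basisVec i) i * χ x := fun i =>
    ((hdc i).mul hD.continuous).integrable_of_hasCompactSupport (hdcs i).mul_right
  rw [Finset.sum_neg_distrib, ← integral_finsetSum _ fun i _ => hi1 i,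
    ← integral_finsetSum _ fun i _ => hi2 i] at hsum
  have hleft : ∫ x, ∑ i, fderiv ℝ V x (basisVec i) i * χ x
      = ∫ x in Ω, χ x * divergence (fun x => ζ x • F x) x := by
    rw [← integral_indicator hΩ.measurableSet]
    congr 1 with x
    rw [← Finset.sum_mul, mul_comm]
    change χ x * divergence V x = _
    by_cases hx : ε < g x - ⟪e, x⟫
    · by_cases hxζ : x ∈ tsupport ζ
      · have hxS : x ∈ S := ⟨hxζ, hx.le⟩
        rw [indicator_of_mem (hSΩ hxS)]
        congr 1
        refine divergence_congr ((hη1 x hxS).mono fun y hy => ?_)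
        simp only [hV, hy, one_smul]
      · have h0 : ∀ᶠ y in 𝓝 x, ζ y = 0 := by
          filter_upwards [(isClosed_tsupport ζ).isOpen_compl.mem_nhds hxζ] with y hy
            using image_eq_zero_of_notMem_tsupport hy
        have h1 : divergence V x = 0 := divergence_zero_of_eventually (h0.mono fun y hy => by
          simp only [hV, hy, zero_smul, smul_zero])
        have h2 : divergence (fun x => ζ x • F x) x = 0 :=
          divergence_zero_of_eventually (h0.mono fun y hy => by rw [hy, zero_smul])
        by_cases hxΩ : x ∈ Ω <;> simp [hxΩ, h1, h2]
    · have h1 : χ x = 0 := step_of_le (by rw [div_le_one hε]; linarith)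
      by_cases hxΩ : x ∈ Ω <;> simp [hxΩ, h1]
  have hright : ∫ x, ∑ i, lineDeriv ℝ χ x (basisVec i) * V x i
      = ∫ x, ε⁻¹ * deriv step ((g x - ⟪e, x⟫) / ε)
          * (fderiv ℝ g x (ζ x • Ω.indicator F x) - ⟪e, ζ x • Ω.indicator F x⟫) := by
    refine integral_congr_ae ?_
    filter_upwards [h.lipschitz.ae_differentiableAt] with x hx
    have h1 : HasFDerivAt (fun x => (g x - ⟪e, x⟫) / ε)
        (ε⁻¹ • (fderiv ℝ g x - innerSL ℝ e)) x := by
      have := (hx.hasFDerivAt.sub (innerSL ℝ e).hasFDerivAt).const_mul ε⁻¹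
      refine this.congr_of_eventuallyEq (Eventually.of_forall fun y => ?_)
      simp [div_eq_inv_mul]
    have h2 : HasFDerivAt χ (deriv step ((g x - ⟪e, x⟫) / ε) •
        (ε⁻¹ • (fderiv ℝ g x - innerSL ℝ e))) x :=
      ((contDiff_step.differentiable (by simp) _).hasDerivAt).comp_hasFDerivAt x h1
    have h3 : ∑ i, lineDeriv ℝ χ x (basisVec i) * V x i = fderiv ℝ χ x (V x) := by
      conv_rhs => rw [eq_sum_basisVec (V x), map_sum]
      refine Finset.sum_congr rfl fun i _ => ?_
      rw [h2.differentiableAt.lineDeriv_eq_fderiv, map_smul, smul_eq_mul, mul_comm]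
    rw [h3, h2.fderiv]
    by_cases h0 : deriv step ((g x - ⟪e, x⟫) / ε) = 0
    · simp [h0]
    have hge : ε ≤ g x - ⟪e, x⟫ := by
      have := not_imp_comm.1 (deriv_step_of_notMem (s := (g x - ⟪e, x⟫) / ε)) h0
      have := this.1
      rwa [le_div_iff₀ hε, one_mul] at this
    have hVx : V x = ζ x • Ω.indicator F x := by
      by_cases hζx : ζ x = 0
      · simp [hV, hζx]
      · have hxS : x ∈ S := ⟨subset_tsupport _ hζx, hge⟩
        rw [indicator_of_mem (hSΩ hxS)]
        simp only [hV, (hη1 x hxS).self_of_nhds, one_smul]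
    rw [hVx]
    simp only [_root_.smul_apply, _root_.sub_apply, innerSL_apply_apply,
      smul_eq_mul]
    ring
  rw [hleft, hright] at hsum
  rw [hsum, neg_neg]

lemma integrableOn_divergence_smul (hΩ : IsOpen Ω) (hb : Bornology.IsBounded Ω)
    (hFc : ContinuousOn F (closure Ω)) (hF : ContDiffOn ℝ 1 F Ω)
    (hdiv : IntegrableOn (divergence F) Ω) (hζ : ContDiff ℝ 1 ζ) :
    IntegrableOn (divergence fun x => ζ x • F x) Ω := by
  have hcl : IsCompact (closure Ω) := hb.isCompact_closure
  have h1 : IntegrableOn (fun x => ζ x * divergence F x) Ω := by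
    obtain ⟨B, hB⟩ := hcl.exists_bound_of_continuousOn hζ.continuous.continuousOn
    refine hdiv.bdd_mul (c := B) hζ.continuous.aestronglyMeasurable ?_
    exact (ae_restrict_mem hΩ.measurableSet).mono fun x hx => hB x (subset_closure hx)
  have h2 : IntegrableOn (fun x => fderiv ℝ ζ x (F x)) Ω := by
    have hc : ContinuousOn (fun x => fderiv ℝ ζ x (F x)) (closure Ω) :=
      (hζ.continuous_fderiv (by simp)).continuousOn.clm_apply hFc
    exact (hc.integrableOn_compact hcl).mono_set subset_closure
  refine (h1.add h2).congr ?_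
  filter_upwards [ae_restrict_mem hΩ.measurableSet] with x hx
  exact (divergence_smul (hζ.differentiable (by simp) x)
    ((hF.contDiffAt (hΩ.mem_nhds hx)).differentiableAt (by simp))).symm

/-- Inserting the step cutoff at depth `ε` turns the integral into an average over the strip of
depth between `ε` and `2ε`. Its integrand tends, along almost every vertical line, to `ζ (∇g - e) ·
F` on the graph. That is a multiple of the normal component of `F`, hence zero. -/
lemma IsLocalGraph.integral_divergence_smul (h : IsLocalGraph Ω U e g K) (hΩ : IsOpen Ω)
    (hb : Bornology.IsBounded Ω) (hFc : ContinuousOn F (closure Ω)) (hF : ContDiffOn ℝ 1 F Ω)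
    (hdiv : IntegrableOn (divergence F) Ω)
    (hN : ∀ p ∈ frontier Ω, ∀ ν, IsOutwardUnitNormal Ω p ν → ⟪F p, ν⟫ = 0)
    (hζ : ContDiff ℝ 1 ζ) (hζc : HasCompactSupport ζ) (hζU : tsupport ζ ⊆ U) :
    ∫ x in Ω, divergence (fun x => ζ x • F x) x = 0 := by
  have hgc := h.lipschitz.continuous
  have hcl : IsCompact (closure Ω) := hb.isCompact_closure
  set W : E3 → E3 := fun x => ζ x • Ω.indicator F x with hW
  set H : E3 → ℝ := fun x => fderiv ℝ g x (W x) - ⟪e, W x⟫ with hH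
  obtain ⟨B, hB⟩ := hcl.exists_bound_of_continuousOn hFc
  obtain ⟨B', hB'⟩ := hζc.exists_bound_of_continuous hζ.continuous
  obtain ⟨R, hR⟩ := hζc.isCompact.isBounded.subset_closedBall 0
  have hB'0 : 0 ≤ B' := (norm_nonneg _).trans (hB' 0)
  have hWm : Measurable W := by
    have h1 : Measurable (Ω.indicator F) := by
      classical
      rw [← piecewise_eq_indicator]
      exact (hF.continuousOn).measurable_piecewise continuousOn_const hΩ.measurableSet
    exact hζ.continuous.measurable.smul h1
  have hWb : ∀ x, ‖W x‖ ≤ B' * max B 0 := by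
    intro x
    rw [hW, norm_smul]
    refine mul_le_mul (hB' x) ?_ (norm_nonneg _) hB'0
    by_cases hx : x ∈ Ω
    · rw [indicator_of_mem hx]; exact (hB x (subset_closure hx)).trans (le_max_left _ _)
    · rw [indicator_of_notMem hx, norm_zero]; exact le_max_right _ _
  have hHm : Measurable H := by
    refine Measurable.sub ?_ (measurable_const.inner hWm)
    exact (continuous_fst.clm_apply continuous_snd).measurable.comp
      ((measurable_fderiv ℝ g).prodMk hWm)
  have hHb : ∀ x, |H x| ≤ (K + 1) * (B' * max B 0) := by
    intro x
    refine (abs_sub _ _).trans ?_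
    rw [add_mul, one_mul]
    refine add_le_add ?_ ?_
    · refine ((fderiv ℝ g x).le_opNorm _).trans ?_
      exact mul_le_mul (norm_fderiv_le_of_lipschitz ℝ h.lipschitz) (hWb x) (norm_nonneg _) K.2
    · refine (abs_real_inner_le_norm _ _).trans ?_
      rw [h.norm_eq, one_mul]
      exact hWb x
  have hHR : ∀ x, H x ≠ 0 → ‖x‖ ≤ R := fun x hx => by
    refine mem_closedBall_zero_iff.1 (hR (subset_tsupport _ fun h0 => hx ?_))
    simp [hH, hW, h0]
  have hstrip := h.tendsto_integral_strip continuous_deriv_step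
    (fun r hr => deriv_step_of_notMem hr) hHm hHb hHR ?_
  swap
  · filter_upwards [h.lipschitz.ae_differentiableAt] with x hx
    -- The vertical projection of `x` to the graph. Differentiability of `g` at almost every `x`
    -- passes to `p`, as `g` is invariant along `e`; so the graph has a normal there.
    set p := x + (g x - ⟪e, x⟫) • e with hp
    have hpp : ∀ δ : ℝ, x + (g x - ⟪e, x⟫ - δ) • e = p + (-δ) • e := fun δ => by
      rw [hp]; module
    simp_rw [hpp]
    have hpg : ⟪e, p⟫ = g p := by
      rw [hp, h.invariant, inner_add_right, inner_smul_right, h.inner_self_eq]; ring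
    have hpt : Tendsto (fun δ : ℝ => p + (-δ) • e) (𝓝[>] 0) (𝓝 p) := by
      have : Continuous fun δ : ℝ => p + (-δ) • e := by fun_prop
      have h1 := (this.tendsto 0).mono_left (nhdsWithin_le_nhds (s := Ioi 0))
      simpa using h1
    by_cases hpζ : p ∈ tsupport ζ
    · have hpU := hζU hpζ
      have hin : ∀ᶠ δ : ℝ in 𝓝[>] 0, p + (-δ) • e ∈ Ω := by
        filter_upwards [hpt (h.isOpen.mem_nhds hpU), self_mem_nhdsWithin] with δ hδ hδ0
        have hδ0 : 0 < δ := hδ0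
        rw [h.mem_iff _ hδ, h.invariant, inner_add_right, inner_smul_right, h.inner_self_eq, hpg]
        linarith
      have hpcl : p ∈ closure Ω := mem_closure_of_tendsto hpt hin
      have hpf : p ∈ frontier Ω := by
        rw [hΩ.frontier_eq]
        refine ⟨hpcl, fun hc => ?_⟩
        have := (h.mem_iff p hpU).1 hc
        linarith
      have hgp : DifferentiableAt ℝ g p := h.differentiableAt_add_smul _ hx
      obtain ⟨hν, hn0⟩ := h.isOutwardUnitNormal hpU hpg hgp
      have hzero : fderiv ℝ g p (F p) - ⟪e, F p⟫ = 0 := by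
        have h1 := hN p hpf _ hν
        rw [inner_smul_right, mul_eq_zero] at h1
        have h2 := h1.resolve_left (inv_ne_zero (norm_ne_zero_iff.2 hn0))
        rw [inner_sub_right, real_inner_comm, real_inner_comm (gradient g p),
          inner_gradient_left] at h2
        linarith
      have hFt : Tendsto (fun δ : ℝ => F (p + (-δ) • e)) (𝓝[>] 0) (𝓝 (F p)) :=
        (hFc p hpcl).tendsto.comp (tendsto_nhdsWithin_iff.2
          ⟨hpt, hin.mono fun δ hδ => subset_closure hδ⟩)
      have hWt : Tendsto (fun δ : ℝ => ζ (p + (-δ) • e) • F (p + (-δ) • e)) (𝓝[>] 0)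
          (𝓝 (ζ p • F p)) := ((hζ.continuous.tendsto p).comp hpt).smul hFt
      have hlim := (((fderiv ℝ g p).continuous.tendsto _).comp hWt).sub
        ((tendsto_const_nhds (x := e)).inner hWt)
      have h0 : fderiv ℝ g p (ζ p • F p) - ⟪e, ζ p • F p⟫ = 0 := by
        rw [map_smul, inner_smul_right, smul_eq_mul, ← mul_sub, hzero, mul_zero]
      rw [h0] at hlim
      refine hlim.congr' (hin.mono fun δ hδ => ?_)
      simp only [hH, hW, indicator_of_mem hδ, h.fderiv_add_smul, Function.comp_apply]
    · refine tendsto_const_nhds.congr' ?_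
      filter_upwards [hpt ((isClosed_tsupport ζ).isOpen_compl.mem_nhds hpζ)] with δ hδ
      have h0 : ζ (p + (-δ) • e) = 0 := image_eq_zero_of_notMem_tsupport hδ
      simp only [hH, hW, h0, zero_smul, map_zero, inner_zero_right, sub_zero]
  have hint := integrableOn_divergence_smul hΩ hb hFc hF hdiv hζ
  have hlim : Tendsto (fun ε : ℝ => ∫ x in Ω, step ((g x - ⟪e, x⟫) / ε)
      * divergence (fun x => ζ x • F x) x) (𝓝[>] 0)
      (𝓝 (∫ x in Ω, divergence (fun x => ζ x • F x) x)) := by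
    have hsm : ∀ ε : ℝ, Continuous fun x => step ((g x - ⟪e, x⟫) / ε) := fun ε =>
      contDiff_step.continuous.comp ((hgc.sub (by fun_prop)).div_const ε)
    refine tendsto_integral_filter_of_dominated_convergence
      (fun x => ‖divergence (fun x => ζ x • F x) x‖) (Eventually.of_forall fun ε => ?_)
      (Eventually.of_forall fun ε => ae_of_all _ fun x => ?_) hint.norm ?_
    · exact (hsm ε).aestronglyMeasurable.mul hint.aestronglyMeasurable
    · rw [norm_mul]
      exact mul_le_of_le_one_left (norm_nonneg _) (abs_step_le _)
    · filter_upwards [ae_restrict_mem hΩ.measurableSet] with x hx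
      by_cases hxζ : x ∈ tsupport ζ
      · have hρ : 0 < g x - ⟪e, x⟫ := sub_pos.2 ((h.mem_iff x (hζU hxζ)).1 hx)
        refine tendsto_const_nhds.congr' ?_
        filter_upwards [Ioo_mem_nhdsGT (half_pos hρ)] with ε hε
        rw [step_of_ge, one_mul]
        rw [le_div_iff₀ hε.1]
        linarith [hε.2]
      · have h2 : divergence (fun x => ζ x • F x) x = 0 :=
          divergence_zero_of_eventually (by
            filter_upwards [(isClosed_tsupport ζ).isOpen_compl.mem_nhds hxζ] with y hy
            rw [image_eq_zero_of_notMem_tsupport hy, zero_smul])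
        simp only [h2, mul_zero]
        exact tendsto_const_nhds
  have hlim2 := hstrip.neg
  rw [neg_zero] at hlim2
  refine tendsto_nhds_unique hlim (hlim2.congr' ?_)
  filter_upwards [self_mem_nhdsWithin] with ε hε
  exact (h.integral_step_mul_divergence hΩ hF hζ hζc hζU hε).symm

/-- The divergence theorem on a bounded Lipschitz domain, for fields with zero normal component on
the boundary. -/
theorem integral_divergence_eq_zero (hΩ : IsOpen Ω) (hb : Bornology.IsBounded Ω)
    (hLip : HasLipschitzBoundary Ω) (hFc : ContinuousOn F (closure Ω)) (hF : ContDiffOn ℝ 1 F Ω)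
    (hdiv : IntegrableOn (divergence F) Ω)
    (hN : ∀ p ∈ frontier Ω, ∀ ν, IsOutwardUnitNormal Ω p ν → ⟪F p, ν⟫ = 0) :
    ∫ x in Ω, divergence F x = 0 := by
  have hcl : IsCompact (closure Ω) := hb.isCompact_closure
  -- The statement is local: in the interior `ζ F` has compact support in `Ω`, and at the boundary
  -- the graph lemma applies. A partition of unity assembles finitely many pieces.
  have hloc : ∀ p ∈ closure Ω, ∃ U : Set E3, IsOpen U ∧ p ∈ U ∧ ∀ ζ : E3 → ℝ, ContDiff ℝ 1 ζ →
      tsupport ζ ⊆ U → ∫ x in Ω, divergence (fun x => ζ x • F x) x = 0 := by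
    intro p hp
    by_cases hpΩ : p ∈ Ω
    · refine ⟨Ω, hΩ, hpΩ, fun ζ hζ hζΩ => ?_⟩
      have hζc : HasCompactSupport ζ :=
        hcl.of_isClosed_subset (isClosed_tsupport ζ) (hζΩ.trans subset_closure)
      have h1 := integral_divergence_of_hasCompactSupport
        (contDiff_smul_of_tsupport_subset hΩ hζ hζΩ hF) hζc.smul_right
      rw [← h1]
      refine setIntegral_eq_integral_of_forall_compl_eq_zero fun x hx => ?_
      refine divergence_zero_of_eventually ?_
      filter_upwards [(isClosed_tsupport ζ).isOpen_compl.mem_nhds fun hc => hx (hζΩ hc)] with y hy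
      rw [image_eq_zero_of_notMem_tsupport hy, zero_smul]
    · have hpf : p ∈ frontier Ω := by rw [hΩ.frontier_eq]; exact ⟨hp, hpΩ⟩
      obtain ⟨U, e, g, K, hg, hpU, hUb⟩ := hLip.exists_isLocalGraph hpf
      refine ⟨U, hg.isOpen, hpU, fun ζ hζ hζU => ?_⟩
      have hζc : HasCompactSupport ζ :=
        Metric.isCompact_of_isClosed_isBounded (isClosed_tsupport ζ) (hUb.subset hζU)
      exact hg.integral_divergence_smul hΩ hb hFc hF hdiv hN hζ hζc hζU
  choose! U hUo hpU hU using hloc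
  obtain ⟨t, htc, ht⟩ := hcl.elim_nhds_subcover U fun p hp => (hUo p hp).mem_nhds (hpU p hp)
  obtain ⟨f, hf⟩ := SmoothPartitionOfUnity.exists_isSubordinate (modelWithCornersSelf ℝ E3)
    isClosed_closure (fun p : t => U p) (fun p => hUo p (htc p p.2))
    (by simpa [iUnion_subtype] using ht)
  have hfs : ∀ p : t, ContDiff ℝ 1 (f p) := fun p =>
    ((f p).contMDiff.contDiff).of_le (by exact_mod_cast le_top)
  have hsum : ∀ x ∈ closure Ω, ∑ p : t, f p x = 1 := fun x hx => by
    rw [← finsum_eq_sum_of_fintype]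
    exact f.sum_eq_one hx
  have hterm : ∀ p : t, ∫ x in Ω, divergence (fun x => f p x • F x) x = 0 := fun p =>
    hU p (htc p p.2) (f p) (hfs p) (hf p)
  have hcongr : ∀ x ∈ Ω, divergence F x = ∑ p : t, divergence (fun x => f p x • F x) x := by
    intro x hx
    have h1 : F =ᶠ[𝓝 x] fun y => ∑ p : t, f p y • F y := by
      filter_upwards [hΩ.mem_nhds hx] with y hy
      rw [← Finset.sum_smul, hsum y (subset_closure hy), one_smul]
    have hd : ∀ p : t, DifferentiableAt ℝ (fun y => f p y • F y) x := fun p =>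
      ((hfs p).differentiable (by simp) x).smul
        ((hF.contDiffAt (hΩ.mem_nhds hx)).differentiableAt (by simp))
    rw [divergence_congr h1]
    simp only [divergence]
    rw [Finset.sum_comm]
    refine Finset.sum_congr rfl fun i _ => ?_
    rw [fderiv_fun_sum fun p _ => hd p]
    simp
  rw [setIntegral_congr_fun hΩ.measurableSet hcongr, integral_finsetSum _ fun p _ =>
    integrableOn_divergence_smul hΩ hb hFc hF hdiv (hfs p)]
  exact Finset.sum_eq_zero fun p _ => hterm p

end

/-! ### Time-dependent fields -/

section

variable {G : Type*} [NormedAddCommGroup G] {Φ : ℝ × E3 → G} {I : Set ℝ}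
  {C : Set E3} {t : ℝ} {x : E3}

/-- Since `I` is open, time derivatives are two-sided even at boundary points of the space domain.
-/
lemma hasDerivAt_time [NormedSpace ℝ G] (hI : IsOpen I) (hΦ : ContDiffOn ℝ 1 Φ (I ×ˢ C)) (ht : t ∈ I)
    (hx : x ∈ C) :
    HasDerivAt (fun s => Φ (s, x)) (fderivWithin ℝ Φ (I ×ˢ C) (t, x) (1, 0)) t := by
  have h1 : HasFDerivWithinAt Φ (fderivWithin ℝ Φ (I ×ˢ C) (t, x)) (I ×ˢ C) (t, x) :=
    (hΦ.differentiableOn (by simp) (t, x) ⟨ht, hx⟩).hasFDerivWithinAt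
  have h2 : HasDerivWithinAt (fun s : ℝ => (s, x)) (1, 0) I t :=
    ((hasDerivAt_id t).prodMk (hasDerivAt_const t x)).hasDerivWithinAt
  have h3 : MapsTo (fun s : ℝ => (s, x)) I (I ×ˢ C) := fun s hs => ⟨hs, hx⟩
  exact (h1.comp_hasDerivWithinAt t h2 h3).hasDerivAt (hI.mem_nhds ht)

lemma hasFDerivWithinAt_space [NormedSpace ℝ G] (hΦ : ContDiffOn ℝ 1 Φ (I ×ˢ C)) (ht : t ∈ I) (hx : x ∈ C) :
    HasFDerivWithinAt (fun y => Φ (t, y))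
      ((fderivWithin ℝ Φ (I ×ˢ C) (t, x)).comp (ContinuousLinearMap.inr ℝ ℝ E3)) C x := by
  have h1 : HasFDerivWithinAt Φ (fderivWithin ℝ Φ (I ×ˢ C) (t, x)) (I ×ˢ C) (t, x) :=
    (hΦ.differentiableOn (by simp) (t, x) ⟨ht, hx⟩).hasFDerivWithinAt
  exact h1.comp x (hasFDerivAt_prodMk_right t x).hasFDerivWithinAt fun y hy => ⟨ht, hy⟩

lemma exists_bound_near {Ω : Set E3} (hb : Bornology.IsBounded Ω) (hI : IsOpen I) (ht : t ∈ I)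
    (hΦ : ContinuousOn Φ (I ×ˢ closure Ω)) :
    ∃ δ > 0, Metric.ball t δ ⊆ I ∧ ∃ B, ∀ s ∈ Metric.ball t δ, ∀ x ∈ closure Ω, ‖Φ (s, x)‖ ≤ B := by
  obtain ⟨δ, hδ, hδI⟩ := Metric.nhds_basis_closedBall.mem_iff.1 (hI.mem_nhds ht)
  obtain ⟨B, hB⟩ := ((isCompact_closedBall t δ).prod hb.isCompact_closure).exists_bound_of_continuousOn
    (hΦ.mono (prod_mono hδI Subset.rfl))
  exact ⟨δ, hδ, Metric.ball_subset_closedBall.trans hδI, B,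
    fun s hs x hx => hB (s, x) ⟨Metric.ball_subset_closedBall hs, hx⟩⟩

lemma continuousOn_slice (hΦ : ContinuousOn Φ (I ×ˢ C)) (ht : t ∈ I) :
    ContinuousOn (fun y => Φ (t, y)) C :=
  hΦ.comp (by fun_prop) fun y hy => ⟨ht, hy⟩

lemma integrableOn_of_continuousOn_closure {Ω : Set E3} (hb : Bornology.IsBounded Ω) {f : E3 → ℝ}
    (hf : ContinuousOn f (closure Ω)) : IntegrableOn f Ω :=
  (hf.integrableOn_compact hb.isCompact_closure).mono_set subset_closure

/-- Differentiation under the integral sign over a bounded open set. -/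
lemma hasDerivAt_setIntegral {Ω : Set E3} (hΩ : IsOpen Ω) (hb : Bornology.IsBounded Ω)
    (hI : IsOpen I) (ht : t ∈ I) {F F' : ℝ × E3 → ℝ} (hF : ContinuousOn F (I ×ˢ closure Ω))
    (hF' : ContinuousOn F' (I ×ˢ closure Ω))
    (hd : ∀ s ∈ I, ∀ x ∈ Ω, HasDerivAt (fun s => F (s, x)) (F' (s, x)) s) :
    HasDerivAt (fun s => ∫ x in Ω, F (s, x)) (∫ x in Ω, F' (t, x)) t := by
  obtain ⟨δ, hδ, hδI, B, hB⟩ := exists_bound_near hb hI ht hF'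
  refine (hasDerivAt_integral_of_dominated_loc_of_deriv_le (bound := fun _ => B)
    (F := fun s x => F (s, x)) (F' := fun s x => F' (s, x)) (Metric.ball_mem_nhds t hδ)
    ?_ ?_ ?_ ?_ ?_ ?_).2
  · filter_upwards [hI.mem_nhds ht] with s hs
    exact (integrableOn_of_continuousOn_closure hb (continuousOn_slice hF hs)).aestronglyMeasurable
  · exact integrableOn_of_continuousOn_closure hb (continuousOn_slice hF ht)
  · exact (integrableOn_of_continuousOn_closure hb (continuousOn_slice hF' ht)).aestronglyMeasurable
  · filter_upwards [ae_restrict_mem hΩ.measurableSet] with x hx s hs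
    exact hB s hs x (subset_closure hx)
  · exact integrableOn_const hb.measure_lt_top.ne
  · filter_upwards [ae_restrict_mem hΩ.measurableSet] with x hx s hs
    exact hd s (hδI hs) x hx

end

section

variable {I : Set ℝ} {Ω : Set E3} {M : ℝ → E3 → E3} {t : ℝ} {x : E3}

/-- The full space-time derivative of a time-dependent field. -/
def stDeriv (I : Set ℝ) (Ω : Set E3) (M : ℝ → E3 → E3) (q : ℝ × E3) : ℝ × E3 →L[ℝ] E3 :=
  fderivWithin ℝ (fun q : ℝ × E3 => M q.1 q.2) (I ×ˢ closure Ω) q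

/-- The second space-time derivative of a time-dependent field. -/
def stDeriv₂ (I : Set ℝ) (Ω : Set E3) (M : ℝ → E3 → E3) (q : ℝ × E3) :
    ℝ × E3 →L[ℝ] ℝ × E3 →L[ℝ] E3 :=
  fderivWithin ℝ (stDeriv I Ω M) (I ×ˢ closure Ω) q

/-- A field which is twice continuously differentiable in space-time, up to the boundary of the
space domain. -/
structure IsC2Field (I : Set ℝ) (Ω : Set E3) (M : ℝ → E3 → E3) : Prop where
  isOpen_time : IsOpen I
  isOpen : IsOpen Ω
  isBounded : Bornology.IsBounded Ω
  uniqueDiffOn : UniqueDiffOn ℝ (closure Ω)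
  contDiffOn : ContDiffOn ℝ 2 (fun q : ℝ × E3 => M q.1 q.2) (I ×ˢ closure Ω)

namespace IsC2Field

lemma contDiffOn_stDeriv (h : IsC2Field I Ω M) :
    ContDiffOn ℝ 1 (stDeriv I Ω M) (I ×ˢ closure Ω) :=
  h.contDiffOn.fderivWithin (h.isOpen_time.uniqueDiffOn.prod h.uniqueDiffOn) (by norm_num)

lemma continuousOn_stDeriv₂ (h : IsC2Field I Ω M) :
    ContinuousOn (stDeriv₂ I Ω M) (I ×ˢ closure Ω) :=
  h.contDiffOn_stDeriv.continuousOn_fderivWithin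
    (h.isOpen_time.uniqueDiffOn.prod h.uniqueDiffOn) (by norm_num)

lemma hasDerivAt (h : IsC2Field I Ω M) (ht : t ∈ I) (hx : x ∈ closure Ω) :
    HasDerivAt (fun s => M s x) (stDeriv I Ω M (t, x) (1, 0)) t :=
  hasDerivAt_time (Φ := fun q : ℝ × E3 => M q.1 q.2) h.isOpen_time
    (h.contDiffOn.of_le (by norm_num)) ht hx

lemma timeDeriv_eq (h : IsC2Field I Ω M) (ht : t ∈ I) (hx : x ∈ closure Ω) :
    timeDeriv M t x = stDeriv I Ω M (t, x) (1, 0) := (h.hasDerivAt ht hx).deriv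

lemma fderivWithin_eq (h : IsC2Field I Ω M) (ht : t ∈ I) (hx : x ∈ closure Ω) (v : E3) :
    fderivWithin ℝ (M t) (closure Ω) x v = stDeriv I Ω M (t, x) (0, v) := by
  have h1 := hasFDerivWithinAt_space (Φ := fun q : ℝ × E3 => M q.1 q.2)
    (h.contDiffOn.of_le (by norm_num)) ht hx
  have h2 : fderivWithin ℝ (M t) (closure Ω) x = _ := h1.fderivWithin (h.uniqueDiffOn x hx)
  rw [h2]
  rfl

lemma closure_mem_nhds (h : IsC2Field I Ω M) (hx : x ∈ Ω) : closure Ω ∈ 𝓝 x :=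
  mem_of_superset (h.isOpen.mem_nhds hx) subset_closure

lemma fderiv_eq (h : IsC2Field I Ω M) (ht : t ∈ I) (hx : x ∈ Ω) (v : E3) :
    fderiv ℝ (M t) x v = stDeriv I Ω M (t, x) (0, v) := by
  rw [← h.fderivWithin_eq ht (subset_closure hx), fderivWithin_of_mem_nhds (h.closure_mem_nhds hx)]

lemma hasDerivAt_stDeriv (h : IsC2Field I Ω M) (ht : t ∈ I) (hx : x ∈ closure Ω) (w : ℝ × E3) :
    HasDerivAt (fun s => stDeriv I Ω M (s, x) w) (stDeriv₂ I Ω M (t, x) (1, 0) w) t :=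
  (hasDerivAt_time h.isOpen_time h.contDiffOn_stDeriv ht hx).clm_apply (hasDerivAt_const t w)
    |>.congr_deriv (by simp [stDeriv₂])

lemma hasFDerivAt_stDeriv (h : IsC2Field I Ω M) (ht : t ∈ I) (hx : x ∈ Ω) :
    HasFDerivAt (fun y => stDeriv I Ω M (t, y))
      ((stDeriv₂ I Ω M (t, x)).comp (ContinuousLinearMap.inr ℝ ℝ E3)) x :=
  (hasFDerivWithinAt_space h.contDiffOn_stDeriv ht (subset_closure hx)).hasFDerivAt
    (h.closure_mem_nhds hx)

lemma timeDeriv_timeDeriv_eq (h : IsC2Field I Ω M) (ht : t ∈ I) (hx : x ∈ closure Ω) :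
    timeDeriv (timeDeriv M) t x = stDeriv₂ I Ω M (t, x) (1, 0) (1, 0) := by
  have h1 : (fun s => timeDeriv M s x) =ᶠ[𝓝 t] fun s => stDeriv I Ω M (s, x) (1, 0) := by
    filter_upwards [h.isOpen_time.mem_nhds ht] with s hs using h.timeDeriv_eq hs hx
  rw [timeDeriv, h1.deriv_eq, (h.hasDerivAt_stDeriv ht hx _).deriv]

/-- At interior points the derivatives within the set are genuine derivatives, so Schwarz's theorem
applies. This exchanges `∂ₜ` and `∂ᵢ` in the exchange energy. -/
lemma stDeriv₂_symm (h : IsC2Field I Ω M) (ht : t ∈ I) (hx : x ∈ Ω) (v w : ℝ × E3) :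
    stDeriv₂ I Ω M (t, x) v w = stDeriv₂ I Ω M (t, x) w v := by
  have hU : ∀ q ∈ I ×ˢ Ω, I ×ˢ closure Ω ∈ 𝓝 q := fun q hq =>
    mem_of_superset ((h.isOpen_time.prod h.isOpen).mem_nhds hq) (prod_mono Subset.rfl subset_closure)
  have h1 : ∀ q ∈ I ×ˢ Ω, stDeriv I Ω M q = fderiv ℝ (fun q : ℝ × E3 => M q.1 q.2) q :=
    fun q hq => fderivWithin_of_mem_nhds (hU q hq)
  have hq : (t, x) ∈ I ×ˢ Ω := ⟨ht, hx⟩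
  have h2 : stDeriv₂ I Ω M (t, x) = fderiv ℝ (fderiv ℝ (fun q : ℝ × E3 => M q.1 q.2)) (t, x) := by
    rw [stDeriv₂, fderivWithin_of_mem_nhds (hU _ hq)]
    apply EventuallyEq.fderiv_eq
    filter_upwards [(h.isOpen_time.prod h.isOpen).mem_nhds hq] with q hq using h1 q hq
  rw [h2]
  exact ((h.contDiffOn.contDiffAt (hU _ hq)).isSymmSndFDerivAt (by simp)) v w

lemma laplacian_eq (h : IsC2Field I Ω M) (ht : t ∈ I) (hx : x ∈ Ω) :
    Laplacian.laplacian (M t) x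
      = ∑ i, stDeriv₂ I Ω M (t, x) (0, basisVec i) (0, basisVec i) := by
  rw [InnerProductSpace.laplacian_eq_iteratedFDeriv_orthonormalBasis _
    (EuclideanSpace.basisFun (Fin 3) ℝ)]
  refine Finset.sum_congr rfl fun i _ => ?_
  rw [iteratedFDeriv_two_apply]
  have h1 : fderiv ℝ (M t) =ᶠ[𝓝 x]
      fun y => (stDeriv I Ω M (t, y)).comp (ContinuousLinearMap.inr ℝ ℝ E3) := by
    filter_upwards [h.isOpen.mem_nhds hx] with y hy
    ext1 v
    rw [h.fderiv_eq ht hy]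
    rfl
  have h2 := (h.hasFDerivAt_stDeriv ht hx).clm_comp
    (hasFDerivAt_const (ContinuousLinearMap.inr ℝ ℝ E3) x)
  rw [h1.fderiv_eq, h2.fderiv]
  simp [basisVec]

lemma isRegularField (h : IsC2Field I Ω M) (ht : t ∈ I) : IsRegularField Ω (M t) := by
  have hc : ContDiffOn ℝ 2 (M t) (closure Ω) :=
    h.contDiffOn.comp (contDiff_prodMk_right t).contDiffOn fun y hy => ⟨ht, hy⟩
  obtain ⟨B, hB⟩ := h.isBounded.isCompact_closure.exists_bound_of_continuousOn hc.continuousOn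
  exact ⟨hc.mono subset_closure, B, fun x hx => hB x (subset_closure hx)⟩

lemma continuousOn_stDeriv (h : IsC2Field I Ω M) (w : ℝ × E3) :
    ContinuousOn (fun q => stDeriv I Ω M q w) (I ×ˢ closure Ω) :=
  h.contDiffOn_stDeriv.continuousOn.clm_apply continuousOn_const

lemma continuousOn_stDeriv₂_apply (h : IsC2Field I Ω M) (v w : ℝ × E3) :
    ContinuousOn (fun q => stDeriv₂ I Ω M q v w) (I ×ˢ closure Ω) :=
  (h.continuousOn_stDeriv₂.clm_apply continuousOn_const).clm_apply continuousOn_const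

lemma isBoundedField_timeDeriv (h : IsC2Field I Ω M) (ht : t ∈ I) :
    IsBoundedField (Ω.indicator (timeDeriv M t)) := by
  have hc : ContinuousOn (timeDeriv M t) (closure Ω) :=
    (continuousOn_slice (h.continuousOn_stDeriv (1, 0)) ht).congr fun x hx => h.timeDeriv_eq ht hx
  obtain ⟨B, hB⟩ := h.isBounded.isCompact_closure.exists_bound_of_continuousOn hc
  obtain ⟨R, hR⟩ := h.isBounded.subset_closedBall 0
  refine ⟨(aestronglyMeasurable_indicator_iff h.isOpen.measurableSet).2
    ((hc.mono subset_closure).aestronglyMeasurable h.isOpen.measurableSet), ⟨max B 0, fun x => ?_⟩,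
    R, fun x hx => mem_closedBall_zero_iff.1 (hR (mem_of_indicator_ne_zero hx))⟩
  by_cases hx : x ∈ Ω
  · rw [indicator_of_mem hx]; exact (hB x (subset_closure hx)).trans (le_max_left _ _)
  · rw [indicator_of_notMem hx, norm_zero]; exact le_max_right _ _

/-- The mean value inequality is applied twice in time. The constant is uniform in `x` because
`∂ₜₜM` is bounded on a compact time interval times the closure of `Ω`. -/
lemma exists_taylor_bound (h : IsC2Field I Ω M) (ht : t ∈ I) :
    ∃ C, ∀ᶠ s in 𝓝 t, ∀ x ∈ Ω,
      ‖M s x - M t x - (s - t) • timeDeriv M t x‖ ≤ C * (s - t) ^ 2 := by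
  obtain ⟨δ, hδ, hδI, B, hB⟩ := exists_bound_near h.isBounded h.isOpen_time ht
    (h.continuousOn_stDeriv₂_apply (1, 0) (1, 0))
  refine ⟨B, ?_⟩
  filter_upwards [Metric.ball_mem_nhds t hδ] with s hs x hx
  have hx' := subset_closure hx
  have hB0 : 0 ≤ B := (norm_nonneg _).trans (hB s hs x hx')
  have hvel : ∀ r ∈ Metric.ball t δ,
      ‖stDeriv I Ω M (r, x) (1, 0) - stDeriv I Ω M (t, x) (1, 0)‖ ≤ B * ‖r - t‖ := fun r hr =>
    (convex_ball t δ).norm_image_sub_le_of_norm_hasDerivWithin_le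
      (fun r hr => (h.hasDerivAt_stDeriv (hδI hr) hx' (1, 0)).hasDerivWithinAt)
      (fun r hr => hB r hr x hx') (Metric.mem_ball_self hδ) hr
  have hseg : uIcc t s ⊆ Metric.ball t δ :=
    (convex_ball t δ).ordConnected.uIcc_subset (Metric.mem_ball_self hδ) hs
  have hmv := (convex_uIcc t s).norm_image_sub_le_of_norm_hasDerivWithin_le
    (f := fun r => M r x - (r - t) • timeDeriv M t x) (C := B * ‖s - t‖)
    (f' := fun r => stDeriv I Ω M (r, x) (1, 0) - timeDeriv M t x)
    (fun r hr => by
      have h1 := (h.hasDerivAt (hδI (hseg hr)) hx').sub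
        (((hasDerivAt_id r).sub_const t).smul_const (timeDeriv M t x))
      rw [one_smul] at h1
      exact h1.hasDerivWithinAt)
    (fun r hr => by
      rw [h.timeDeriv_eq ht hx']
      refine (hvel r (hseg hr)).trans ?_
      gcongr
      exact abs_sub_left_of_mem_uIcc hr)
    left_mem_uIcc right_mem_uIcc
  have e1 : M s x - M t x - (s - t) • timeDeriv M t x
      = M s x - (s - t) • timeDeriv M t x - (M t x - (t - t) • timeDeriv M t x) := by
    rw [sub_self, zero_smul]; abel
  rw [e1]
  refine hmv.trans_eq ?_
  rw [mul_assoc, ← pow_two, Real.norm_eq_abs, sq_abs]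

end IsC2Field

end

/-! ### The energy law -/

lemma inner_cross_self (a b : E3) : ⟪b, cross a b⟫ = 0 := by
  rw [cross, PiLp.inner_apply, Fin.sum_univ_three]
  simp [cross_apply]
  ring

section

variable {I : Set ℝ} {Ω : Set E3} {He M : ℝ → E3 → E3} {P : Params} {t : ℝ} {x : E3}

lemma gradNormSq_eq (h : IsC2Field I Ω M) (ht : t ∈ I) (hx : x ∈ Ω) :
    gradNormSq (M t) x = ∑ i, ‖stDeriv I Ω M (t, x) (0, basisVec i)‖ ^ 2 :=
  Finset.sum_congr rfl fun i _ => by rw [h.fderiv_eq ht hx]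

/-- The energy density as a function continuous up to the boundary. -/
def spaceTimeDensity (P : Params) (I : Set ℝ) (Ω : Set E3) (He M : ℝ → E3 → E3) (q : ℝ × E3) : ℝ :=
  P.A / P.Ms ^ 2 * (∑ i, ‖stDeriv I Ω M q (0, basisVec i)‖ ^ 2) + anisotropy P (M q.1 q.2)
    - 2 * P.μ₀ * ⟪He q.1 q.2, M q.1 q.2⟫

/-- The time derivative of `spaceTimeDensity`. -/
def spaceTimeDensityDeriv (P : Params) (I : Set ℝ) (Ω : Set E3) (He M : ℝ → E3 → E3)
    (q : ℝ × E3) : ℝ :=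
  P.A / P.Ms ^ 2 * (∑ i, 2 * ⟪stDeriv I Ω M q (0, basisVec i),
      stDeriv₂ I Ω M q (1, 0) (0, basisVec i)⟫)
    + P.Ku * (2 * M q.1 q.2 1 * stDeriv I Ω M q (1, 0) 1
      + 2 * M q.1 q.2 2 * stDeriv I Ω M q (1, 0) 2) / P.Ms ^ 2
    - 2 * P.μ₀ * (⟪He q.1 q.2, stDeriv I Ω M q (1, 0)⟫ + ⟪timeDeriv He q.1 q.2, M q.1 q.2⟫)

lemma energyDensity_eq (h : IsC2Field I Ω M) (ht : t ∈ I) (hx : x ∈ Ω) :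
    energyDensity P (He t) (M t) x = spaceTimeDensity P I Ω He M (t, x) := by
  rw [energyDensity, gradNormSq_eq h ht hx, spaceTimeDensity]

lemma continuousOn_coord {S : Set (ℝ × E3)} {f : ℝ × E3 → E3} (hf : ContinuousOn f S) (i : Fin 3) :
    ContinuousOn (fun q => f q i) S :=
  (EuclideanSpace.proj (𝕜 := ℝ) i).continuous.comp_continuousOn hf

lemma continuousOn_spaceTimeDensity (h : IsC2Field I Ω M) (hHe : IsExternalField Ω I He) :
    ContinuousOn (spaceTimeDensity P I Ω He M) (I ×ˢ closure Ω) := by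
  have hM := h.contDiffOn.continuousOn
  refine ((continuousOn_const.mul (continuousOn_finsetSum _ fun i _ =>
    (h.continuousOn_stDeriv (0, basisVec i)).norm.pow 2)).add ?_).sub
    (continuousOn_const.mul (hHe.continuousOn.inner hM))
  exact (continuousOn_const.mul (((continuousOn_coord hM 1).pow 2).add
    ((continuousOn_coord hM 2).pow 2))).div_const _

lemma continuousOn_spaceTimeDensityDeriv (h : IsC2Field I Ω M) (hHe : IsExternalField Ω I He) :
    ContinuousOn (spaceTimeDensityDeriv P I Ω He M) (I ×ˢ closure Ω) := by
  have hM := h.contDiffOn.continuousOn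
  have hV := h.continuousOn_stDeriv (1, 0)
  refine ((continuousOn_const.mul (continuousOn_finsetSum _ fun i _ => continuousOn_const.mul
    ((h.continuousOn_stDeriv (0, basisVec i)).inner
      (h.continuousOn_stDeriv₂_apply (1, 0) (0, basisVec i))))).add ?_).sub
    (continuousOn_const.mul ((hHe.continuousOn.inner hV).add (hHe.continuousOn_timeDeriv.inner hM)))
  exact (continuousOn_const.mul (((continuousOn_const.mul (continuousOn_coord hM 1)).mul
    (continuousOn_coord hV 1)).add ((continuousOn_const.mul (continuousOn_coord hM 2)).mul
    (continuousOn_coord hV 2)))).div_const _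

lemma hasDerivAt_coord {f : ℝ → E3} {f' : E3} (hf : HasDerivAt f f' t) (i : Fin 3) :
    HasDerivAt (fun s => f s i) (f' i) t :=
  (EuclideanSpace.proj (𝕜 := ℝ) i).hasFDerivAt.comp_hasDerivAt t hf

lemma hasDerivAt_spaceTimeDensity (h : IsC2Field I Ω M) (hHe : IsExternalField Ω I He)
    (ht : t ∈ I) (hx : x ∈ closure Ω) :
    HasDerivAt (fun s => spaceTimeDensity P I Ω He M (s, x))
      (spaceTimeDensityDeriv P I Ω He M (t, x)) t := by
  have hM := h.hasDerivAt ht hx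
  have hH : HasDerivAt (fun s => He s x) (timeDeriv He t x) t :=
    (hHe.differentiableAt t ht x hx).hasDerivAt
  refine (((HasDerivAt.fun_sum fun i _ =>
    (h.hasDerivAt_stDeriv ht hx (0, basisVec i)).norm_sq).const_mul _).add ?_).sub
    ((hH.inner ℝ hM).const_mul _)
  refine ((((hasDerivAt_coord hM 1).pow 2).add ((hasDerivAt_coord hM 2).pow 2)).const_mul
    P.Ku).div_const (P.Ms ^ 2) |>.congr_deriv ?_
  simp

lemma hasDerivAt_integral_energyDensity (h : IsC2Field I Ω M) (hHe : IsExternalField Ω I He)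
    (ht : t ∈ I) :
    HasDerivAt (fun s => ∫ x in Ω, energyDensity P (He s) (M s) x)
      (∫ x in Ω, spaceTimeDensityDeriv P I Ω He M (t, x)) t := by
  refine (hasDerivAt_setIntegral h.isOpen h.isBounded h.isOpen_time ht
    (continuousOn_spaceTimeDensity h hHe) (continuousOn_spaceTimeDensityDeriv h hHe)
    fun s hs x hx => hasDerivAt_spaceTimeDensity h hHe hs (subset_closure hx)).congr_of_eventuallyEq ?_
  filter_upwards [h.isOpen_time.mem_nhds ht] with s hs
  exact setIntegral_congr_fun h.isOpen.measurableSet fun x hx => energyDensity_eq h hs hx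

lemma hasDerivAt_integral_norm_timeDeriv_sq (h : IsC2Field I Ω M) (ht : t ∈ I) :
    HasDerivAt (fun s => ∫ x in Ω, ‖timeDeriv M s x‖ ^ 2)
      (∫ x in Ω, 2 * ⟪timeDeriv M t x, timeDeriv (timeDeriv M) t x⟫) t := by
  have h1 := hasDerivAt_setIntegral h.isOpen h.isBounded h.isOpen_time ht
    (F := fun q => ‖stDeriv I Ω M q (1, 0)‖ ^ 2)
    (F' := fun q => 2 * ⟪stDeriv I Ω M q (1, 0), stDeriv₂ I Ω M q (1, 0) (1, 0)⟫)
    ((h.continuousOn_stDeriv (1, 0)).norm.pow 2)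
    (continuousOn_const.mul ((h.continuousOn_stDeriv (1, 0)).inner
      (h.continuousOn_stDeriv₂_apply (1, 0) (1, 0))))
    fun s hs x hx => (h.hasDerivAt_stDeriv hs (subset_closure hx) (1, 0)).norm_sq
  refine (h1.congr_of_eventuallyEq ?_).congr_deriv ?_
  · filter_upwards [h.isOpen_time.mem_nhds ht] with s hs
    exact setIntegral_congr_fun h.isOpen.measurableSet fun x hx => by
      simp only [h.timeDeriv_eq hs (subset_closure hx)]
  · exact setIntegral_congr_fun h.isOpen.measurableSet fun x hx => by
      simp only [h.timeDeriv_eq ht (subset_closure hx), h.timeDeriv_timeDeriv_eq ht (subset_closure hx)]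

/-- The flux `∑ᵢ ⟪∂ᵢM, ∂ₜM⟫ eᵢ` of exchange energy. -/
def exchangeFlux (I : Set ℝ) (Ω : Set E3) (M : ℝ → E3 → E3) (q : ℝ × E3) : E3 :=
  WithLp.toLp 2 fun i => ⟪stDeriv I Ω M q (0, basisVec i), stDeriv I Ω M q (1, 0)⟫

lemma contDiffOn_exchangeFlux (h : IsC2Field I Ω M) (ht : t ∈ I) :
    ContDiffOn ℝ 1 (fun x => exchangeFlux I Ω M (t, x)) (closure Ω) := by
  have h1 : ContDiffOn ℝ 1 (fun x => stDeriv I Ω M (t, x)) (closure Ω) :=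
    h.contDiffOn_stDeriv.comp (contDiff_prodMk_right t).contDiffOn fun y hy => ⟨ht, hy⟩
  exact contDiffOn_euclidean.2 fun i =>
    (h1.clm_apply contDiffOn_const).inner ℝ (h1.clm_apply contDiffOn_const)

/-- The pointwise form of Green's identity: the product rule and the symmetry of mixed derivatives.
-/
lemma divergence_exchangeFlux (h : IsC2Field I Ω M) (ht : t ∈ I) (hx : x ∈ Ω) :
    divergence (fun x => exchangeFlux I Ω M (t, x)) x
      = ⟪Laplacian.laplacian (M t) x, stDeriv I Ω M (t, x) (1, 0)⟫
        + ∑ i, ⟪stDeriv I Ω M (t, x) (0, basisVec i),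
          stDeriv₂ I Ω M (t, x) (1, 0) (0, basisVec i)⟫ := by
  have hd : DifferentiableAt ℝ (fun x => exchangeFlux I Ω M (t, x)) x :=
    ((contDiffOn_exchangeFlux h ht).contDiffAt (h.closure_mem_nhds hx)).differentiableAt (by simp)
  rw [h.laplacian_eq ht hx, sum_inner, ← Finset.sum_add_distrib, divergence]
  refine Finset.sum_congr rfl fun i _ => ?_
  rw [← fderiv_coord hd]
  have h1 : ∀ w : ℝ × E3, HasFDerivAt (fun y => stDeriv I Ω M (t, y) w)
      (((stDeriv₂ I Ω M (t, x)).comp (ContinuousLinearMap.inr ℝ ℝ E3)).flip w) x := fun w =>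
    ((h.hasFDerivAt_stDeriv ht hx).clm_apply (hasFDerivAt_const w x)).congr_fderiv (by
      ext1 v; simp)
  have h2 := ((h1 (0, basisVec i)).inner ℝ (h1 (1, 0))).fderiv
  change fderiv ℝ (fun y => ⟪stDeriv I Ω M (t, y) (0, basisVec i), stDeriv I Ω M (t, y) (1, 0)⟫) x
    (basisVec i) = _
  rw [h2, h.stDeriv₂_symm ht hx (1, 0)]
  simp [add_comm]

lemma integrableOn_divergence_exchangeFlux (h : IsC2Field I Ω M) (ht : t ∈ I) :
    IntegrableOn (divergence fun x => exchangeFlux I Ω M (t, x)) Ω := by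
  have hV := h.continuousOn_stDeriv (1, 0)
  have h1 : ContinuousOn (fun q => ⟪∑ i, stDeriv₂ I Ω M q (0, basisVec i) (0, basisVec i),
      stDeriv I Ω M q (1, 0)⟫ + ∑ i, ⟪stDeriv I Ω M q (0, basisVec i),
          stDeriv₂ I Ω M q (1, 0) (0, basisVec i)⟫) (I ×ˢ closure Ω) :=
    ((continuousOn_finsetSum _ fun i _ => h.continuousOn_stDeriv₂_apply _ _).inner hV).add
      (continuousOn_finsetSum _ fun i _ =>
        (h.continuousOn_stDeriv _).inner (h.continuousOn_stDeriv₂_apply _ _))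
  refine (integrableOn_of_continuousOn_closure h.isBounded (continuousOn_slice h1 ht)).congr_fun
    (fun x hx => ?_) h.isOpen.measurableSet
  rw [divergence_exchangeFlux h ht hx, h.laplacian_eq ht hx]

/-- By linearity the normal flux involves only the derivative of `M` along `ν`, which the Neumann
condition makes zero. -/
lemma inner_exchangeFlux (q : ℝ × E3) (ν : E3) :
    ⟪exchangeFlux I Ω M q, ν⟫ = ⟪stDeriv I Ω M q (0, ν), stDeriv I Ω M q (1, 0)⟫ := by
  have h1 : stDeriv I Ω M q (0, ν) = ∑ i, ν i • stDeriv I Ω M q (0, basisVec i) := by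
    have h2 : ((0 : ℝ), ν) = ∑ i, ν i • ((0 : ℝ), basisVec i) := by
      rw [Prod.ext_iff]
      simp only [Prod.fst_sum, Prod.snd_sum, Prod.smul_mk, smul_zero, Finset.sum_const_zero,
        true_and]
      exact eq_sum_basisVec ν
    rw [h2, map_sum]
    simp only [map_smul]
  rw [h1, sum_inner, PiLp.inner_apply]
  refine Finset.sum_congr rfl fun i _ => ?_
  rw [real_inner_smul_left]
  simp [exchangeFlux]

lemma integral_divergence_exchangeFlux (h : IsC2Field I Ω M) (hLip : HasLipschitzBoundary Ω)
    (ht : t ∈ I) (hN : ∀ p ∈ frontier Ω, ∀ ν : E3, IsOutwardUnitNormal Ω p ν →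
      fderivWithin ℝ (M t) (closure Ω) p ν = 0) :
    ∫ x in Ω, divergence (fun x => exchangeFlux I Ω M (t, x)) x = 0 := by
  refine integral_divergence_eq_zero h.isOpen h.isBounded hLip
    (contDiffOn_exchangeFlux h ht).continuousOn
    ((contDiffOn_exchangeFlux h ht).mono subset_closure)
    (integrableOn_divergence_exchangeFlux h ht) fun p hp ν hν => ?_
  rw [inner_exchangeFlux, ← h.fderivWithin_eq ht (frontier_subset_closure hp), hN p hp ν hν,
    inner_zero_left]

lemma IsClassicalSolution.isC2Field (hM : IsClassicalSolution P Ω I He M) (hI : IsOpen I)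
    (hΩ : IsOpen Ω) (hb : Bornology.IsBounded Ω) (hLip : HasLipschitzBoundary Ω) :
    IsC2Field I Ω M :=
  ⟨hI, hΩ, hb, hLip.uniqueDiffOn_closure hΩ, hM.contDiffOn⟩

/-- The effective field, less the damping, does no work. -/
lemma IsClassicalSolution.power_eq_zero (hM : IsClassicalSolution P Ω I He M) (ht : t ∈ I)
    (hx : x ∈ Ω) :
    P.A / P.Ms ^ 2 * ⟪Laplacian.laplacian (M t) x, timeDeriv M t x⟫
      - P.Ku / P.Ms ^ 2 * (M t x 1 * timeDeriv M t x 1 + M t x 2 * timeDeriv M t x 2)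
      + P.μ₀ * ⟪He t x, timeDeriv M t x⟫
      - P.μ₀ * ⟪gradient (potential Ω (M t)) x, timeDeriv M t x⟫
      - P.α / (P.γ * P.Ms) * (‖timeDeriv M t x‖ ^ 2
        + P.τ * ⟪timeDeriv M t x, timeDeriv (timeDeriv M) t x⟫) = 0 := by
  set X := effectiveField P Ω (He t) (M t) x
    - (P.α / (P.γ * P.Ms)) • (timeDeriv M t x + P.τ • timeDeriv (timeDeriv M) t x) with hX
  have h1 : ⟪X, timeDeriv M t x⟫ = 0 := by
    rw [hM.equation t ht x hx, inner_neg_right, real_inner_smul_right, inner_cross_self]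
    simp
  rw [← h1, hX, effectiveField, strayField]
  have hb : ∀ i, ⟪basisVec i, timeDeriv M t x⟫ = timeDeriv M t x i := fun i => by
    rw [real_inner_comm, inner_basisVec]
  simp only [inner_sub_left, inner_add_left, real_inner_smul_left, inner_neg_left, hb,
    real_inner_self_eq_norm_sq, real_inner_comm (timeDeriv M t x) (timeDeriv (timeDeriv M) t x)]
  ring

lemma IsClassicalSolution.hasDerivAt_totalEnergy (hM : IsClassicalSolution P Ω I He M)
    (hI : IsOpen I) (hΩ : IsOpen Ω) (hb : Bornology.IsBounded Ω) (hLip : HasLipschitzBoundary Ω)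
    (hHe : IsExternalField Ω I He) (ht : t ∈ I) :
    HasDerivAt (totalEnergy P Ω He M)
      (-(P.α / (P.γ * P.Ms)) * (∫ x in Ω, ‖timeDeriv M t x‖ ^ 2)
        - P.μ₀ * (∫ x in Ω, ⟪M t x, timeDeriv He t x⟫)) t := by
  have h := hM.isC2Field hI hΩ hb hLip
  have h0 := hLip.measure_frontier
  obtain ⟨C, hC⟩ := h.exists_taylor_bound ht
  have hfield := hasDerivAt_field_energy hΩ hb h0 hI ht (fun s hs => h.isRegularField hs)
    (h.isBoundedField_timeDeriv ht) hC
  refine ((((hasDerivAt_integral_energyDensity h hHe ht).const_mul (1 / 2)).add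
    (hfield.const_mul (P.μ₀ / 2))).add ((hasDerivAt_integral_norm_timeDeriv_sq h ht).const_mul
    (P.α * P.τ / (2 * P.γ * P.Ms)))).congr_deriv ?_
  have hdiv := integral_divergence_exchangeFlux h hLip ht (hM.neumann t ht)
  have hdivi := integrableOn_divergence_exchangeFlux h ht
  have hV : ContinuousOn (timeDeriv M t) (closure Ω) :=
    (continuousOn_slice (h.continuousOn_stDeriv (1, 0)) ht).congr fun x hx => h.timeDeriv_eq ht hx
  have hW : ContinuousOn (timeDeriv (timeDeriv M) t) (closure Ω) :=
    (continuousOn_slice (h.continuousOn_stDeriv₂_apply (1, 0) (1, 0)) ht).congr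
      fun x hx => h.timeDeriv_timeDeriv_eq ht hx
  have hi1 : IntegrableOn (fun x => spaceTimeDensityDeriv P I Ω He M (t, x)) Ω :=
    integrableOn_of_continuousOn_closure hb
      (continuousOn_slice (continuousOn_spaceTimeDensityDeriv h hHe) ht)
  have hi2 : IntegrableOn (fun x => ⟪gradient (potential Ω (M t)) x, timeDeriv M t x⟫) Ω := by
    have hU := (h.isRegularField ht).memLp_gradient_potential hΩ hb h0
    have hV2 := (h.isBoundedField_timeDeriv ht).memLp 2
    have h1 : IntegrableOn (fun x => ⟪gradient (potential Ω (M t)) x,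
        Ω.indicator (timeDeriv M t) x⟫) Ω := by
      refine ((L2.integrable_inner hU.toLp hV2.toLp).congr ?_).integrableOn
      filter_upwards [hU.coeFn_toLp, hV2.coeFn_toLp] with x hx hx' using by rw [hx, hx']
    exact h1.congr_fun (fun x hx => by simp only [indicator_of_mem hx]) hΩ.measurableSet
  have hi3 : IntegrableOn (fun x => 2 * ⟪timeDeriv M t x, timeDeriv (timeDeriv M) t x⟫) Ω :=
    integrableOn_of_continuousOn_closure hb (continuousOn_const.mul (hV.inner hW))
  have hi4 : IntegrableOn (fun x => ‖timeDeriv M t x‖ ^ 2) Ω :=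
    integrableOn_of_continuousOn_closure hb (hV.norm.pow 2)
  have hi5 : IntegrableOn (fun x => ⟪M t x, timeDeriv He t x⟫) Ω :=
    integrableOn_of_continuousOn_closure hb
      ((continuousOn_slice h.contDiffOn.continuousOn ht).inner
        (continuousOn_slice hHe.continuousOn_timeDeriv ht))
  -- The integrands agree pointwise: their difference is a multiple of the vanishing power. Only the
  -- divergence, the damping and the time derivative of the external field remain.
  have key : ∫ x in Ω, (1 / 2 * spaceTimeDensityDeriv P I Ω He M (t, x)
      + P.μ₀ * ⟪gradient (potential Ω (M t)) x, timeDeriv M t x⟫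
      + P.α * P.τ / (2 * P.γ * P.Ms) * (2 * ⟪timeDeriv M t x, timeDeriv (timeDeriv M) t x⟫))
      = ∫ x in Ω, (P.A / P.Ms ^ 2 * divergence (fun x => exchangeFlux I Ω M (t, x)) x
        - P.α / (P.γ * P.Ms) * ‖timeDeriv M t x‖ ^ 2 - P.μ₀ * ⟪M t x, timeDeriv He t x⟫) := by
    refine setIntegral_congr_fun hΩ.measurableSet fun x hx => ?_
    have hp := hM.power_eq_zero ht hx
    simp only [divergence_exchangeFlux h ht hx, spaceTimeDensityDeriv,
      ← h.timeDeriv_eq ht (subset_closure hx), ← Finset.mul_sum,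
      real_inner_comm (M t x) (timeDeriv He t x)]
    have e : P.α * P.τ / (2 * P.γ * P.Ms) = P.α / (P.γ * P.Ms) * P.τ / 2 := by
      rw [mul_assoc 2, mul_comm 2, ← div_div, mul_div_right_comm]
    rw [e]
    linear_combination -hp
  rw [integral_add ?_ (hi3.const_mul _), integral_add (hi1.const_mul _) (hi2.const_mul _),
    integral_sub ?_ (hi5.const_mul _), integral_sub (hdivi.const_mul _) (hi4.const_mul _)] at key
  rotate_left
  · exact (hdivi.const_mul _).sub (hi4.const_mul _)
  · exact (hi1.const_mul _).add (hi2.const_mul _)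
  simp only [integral_const_mul, hdiv] at key ⊢
  linear_combination key

lemma timeDeriv_eq_zero (hI : IsOpen I) (ht : t ∈ I) (hconst : ∀ s ∈ I, He s x = He t x) :
    timeDeriv He t x = 0 := by
  have h1 : (fun s => He s x) =ᶠ[𝓝 t] fun _ => He t x := by
    filter_upwards [hI.mem_nhds ht] with s hs using hconst s hs
  rw [timeDeriv, h1.deriv_eq, deriv_const]

end

end ILLG

end

theorem proposition1 (P : ILLG.Params) (hMs : 0 < P.Ms) (hγ : 0 < P.γ) (hα : 0 ≤ P.α)
    (Ω : Set ILLG.E3) (hΩ_open : IsOpen Ω) (hΩ_bdd : Bornology.IsBounded Ω)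
    (hΩ_lip : ILLG.HasLipschitzBoundary Ω)
    (I : Set ℝ) (hI : IsOpen I) (He M : ℝ → ILLG.E3 → ILLG.E3)
    (hHe : ILLG.IsExternalField Ω I He) (hM : ILLG.IsClassicalSolution P Ω I He M) :
    -- all integrals in the energy law converge, and `∇U` exists where it is used
    (∀ t ∈ I,
      IntegrableOn (ILLG.energyDensity P (He t) (M t)) Ω ∧
      (∀ x, IntegrableOn (fun y => ⟪gradient ILLG.newton (x - y), M t y⟫) Ω) ∧
      (∀ x ∉ frontier Ω, DifferentiableAt ℝ (ILLG.potential Ω (M t)) x) ∧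
      Integrable (fun x : ILLG.E3 => ‖gradient (ILLG.potential Ω (M t)) x‖ ^ 2) ∧
      IntegrableOn (fun x => ‖ILLG.timeDeriv M t x‖ ^ 2) Ω ∧
      IntegrableOn (fun x => ⟪M t x, ILLG.timeDeriv He t x⟫) Ω) ∧
    -- the energy law
    (∀ t ∈ I, HasDerivAt (ILLG.totalEnergy P Ω He M)
      (-(P.α / (P.γ * P.Ms)) * (∫ x in Ω, ‖ILLG.timeDeriv M t x‖ ^ 2)
        - P.μ₀ * (∫ x in Ω, ⟪M t x, ILLG.timeDeriv He t x⟫)) t) ∧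
    -- dissipation for an external field that does not depend on time
    ((∀ s ∈ I, ∀ t ∈ I, ∀ x ∈ Ω, He s x = He t x) →
      ∀ t ∈ I,
        HasDerivAt (ILLG.totalEnergy P Ω He M)
          (-(P.α / (P.γ * P.Ms)) * (∫ x in Ω, ‖ILLG.timeDeriv M t x‖ ^ 2)) t ∧
        -(P.α / (P.γ * P.Ms)) * (∫ x in Ω, ‖ILLG.timeDeriv M t x‖ ^ 2) ≤ 0) := by
  have h := hM.isC2Field hI hΩ_open hΩ_bdd hΩ_lip
  have hlaw : ∀ t ∈ I, HasDerivAt (ILLG.totalEnergy P Ω He M) _ t := fun t ht =>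
    hM.hasDerivAt_totalEnergy hI hΩ_open hΩ_bdd hΩ_lip hHe ht
  refine ⟨fun t ht => ⟨?_, fun x => ?_, fun x hx => ?_, ?_, ?_, ?_⟩, hlaw, fun hconst t ht => ⟨?_, ?_⟩⟩
  · exact (ILLG.integrableOn_of_continuousOn_closure hΩ_bdd (ILLG.continuousOn_slice
      (ILLG.continuousOn_spaceTimeDensity h hHe) ht)).congr_fun
      (fun x hx => (ILLG.energyDensity_eq h ht hx).symm) hΩ_open.measurableSet
  · have h1 := (((h.isRegularField ht).isBoundedField hΩ_open hΩ_bdd).integrable_potential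
      x).integrableOn (s := Ω)
    exact h1.congr_fun (fun y hy => by simp only [indicator_of_mem hy]) hΩ_open.measurableSet
  · exact (h.isRegularField ht).differentiableAt_potential hΩ_open hΩ_bdd hx
  · exact ((h.isRegularField ht).memLp_gradient_potential hΩ_open hΩ_bdd
      hΩ_lip.measure_frontier).integrable_norm_pow two_ne_zero
  · refine (ILLG.integrableOn_of_continuousOn_closure hΩ_bdd ((ILLG.continuousOn_slice
      (h.continuousOn_stDeriv (1, 0)) ht).norm.pow 2)).congr_fun (fun x hx => ?_)
      hΩ_open.measurableSet
    rw [h.timeDeriv_eq ht (subset_closure hx)]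
    rfl
  · exact ILLG.integrableOn_of_continuousOn_closure hΩ_bdd
      ((ILLG.continuousOn_slice h.contDiffOn.continuousOn ht).inner
        (ILLG.continuousOn_slice hHe.continuousOn_timeDeriv ht))
  · refine (hlaw t ht).congr_deriv ?_
    have h1 : ∫ x in Ω, ⟪M t x, ILLG.timeDeriv He t x⟫ = 0 :=
      setIntegral_eq_zero_of_forall_eq_zero fun x hx => by
        rw [ILLG.timeDeriv_eq_zero hI ht fun s hs => hconst s hs t ht x hx, inner_zero_right]
    rw [h1, mul_zero, sub_zero]
  · rw [neg_mul]
    exact neg_nonpos.2 (mul_nonneg (by positivity) (integral_nonneg fun x => by positivity))
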